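/- Corollary 4.4 (Every AF-algebra contains a subalgebra which is diagonal in Kumjian's sense). Let $A$ be an AF-algebra, unital or not; that is, a $C^*$-algebra containing an increasing sequence of finite-dimensional $C^*$-subalgebras with dense union. Then there are an increasing sequence $D_0\subset D_1\subset\cdots$ of finite-dimensional $C^*$-subalgebras of $A$ with dense union and a corresponding Bratteli diagram $E$ as follows. The vertices $v^n_1,\dots,v^n_{p_n}$ of level $n$ are the simple summands $M_{[n,i]}(\mathbb C)$ of $D_n$, and there are $k^{(n)}_{i,j}$ edges from $v^n_j$ to $v^{n+1}_i$, where $k^{(n)}_{i,j}$ is the multiplicity of the partial embedding of the $j$-th summand of $D_n$ into the $i$-th summand of $D_{n+1}$. All slacks $$\sigma^0_i=[0,i],\qquad \sigma^{n+1}_i=[n+1,i]-\sum_{j}k^{(n)}_{i,j}[n,j]$$ are at most $1$. Moreover, with $S=\{v^n_i:\sigma^n_i=1\}$ and $\mathcal G=\mathcal G_E|_S$ the pointed path groupoid, there is an isomorphism of $A$ with the full groupoid $C^*$-algebra $C^*(\mathcal G)$ under which $C_0(\mathcal G^0)\subset C^*(\mathcal G)$ corresponds to an abelian $C^*$-subalgebra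 $B\subset A$ that is diagonal in $A$ in Kumjian's sense. Here $\mathcal G_E$ is the groupoid of triples $(x,k,y)$, with $x,y$ infinite paths in $E$ and $k\in\mathbb Z$ such that $x_i=y_{i+k}$ for all large $i$. Its operations are $(x,k,y)^{-1}=(y,-k,x)$ and $(x,k,y)(y,l,z)=(x,k+l,z)$. Its topology is generated by the sets $Z(\alpha,\beta)=\{(\alpha z,|\beta|-|\alpha|,\beta z)\}$, where $\alpha,\beta$ are finite paths (possibly of length zero) with the same range and $z$ runs over the infinite paths starting there. $\mathcal G_E|_S$ is its reduction, with the relative topology, to the infinite paths whose source lies in $S$, and $\mathcal G^0$ is the unit space of $\mathcal G$. The subalgebra $C_0(\mathcal G^0)\subset C^*(\mathcal G)$ is the one obtained from the inclusion $C_c(\mathcal G^0)\subset C_c(\mathcal G)$ given by extension by zero. An abelian $C^*$-subalgebra $B$ of $A$ is diagonal in Kumjian's sense if it contains a positive element that is strictly positive in $A$ (every nonzero positive linear functional on $A$ is strictly positive at it), and if there is a faithful conditional expectation $P:A\to B$ such that the free normalizers of $B$, i.e. the $a\in A$ with $a^*Ba\cup aBa^*\subset B$ and $a^2=0$, span a dense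 subspace of $\ker P$. -/

import Mathlib

open scoped ComplexOrder CompactlySupported ZeroAtInfty

universe u v

noncomputable section

/-! ## AF-algebras and Bratteli diagrams -/

/-- An increasing sequence of finite-dimensional C*-subalgebras of `A` with dense union; that is,
`A` is the C*-algebraic direct limit of the `D n` along the (injective) inclusions. -/
structure IsAFTower {A : Type u} [NonUnitalCStarAlgebra A]
    (D : ℕ → NonUnitalStarSubalgebra ℂ A) : Prop where
  mono : Monotone D
  finite_dim : ∀ n, FiniteDimensional ℂ (D n)
  dense : Dense (⋃ n, (D n : Set A))

/-- `A` (unital or not) is an AF-algebra. -/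
def IsAFAlgebra (A : Type u) [NonUnitalCStarAlgebra A] : Prop :=
  ∃ D : ℕ → NonUnitalStarSubalgebra ℂ A, IsAFTower D

/-- The data of a Bratteli diagram: level `n` has `p n` vertices, the `i`-th of them labelled by
the positive integer `size n i`, and there are `mult n i j` edges from the `j`-th vertex of level
`n` to the `i`-th vertex of level `n + 1`. The levels are numbered from `0`. -/
structure BratteliDiagram where
  p : ℕ → ℕ
  size : (n : ℕ) → Fin (p n) → ℕ
  size_pos : ∀ n i, 0 < size n i
  mult : (n : ℕ) → Fin (p (n + 1)) → Fin (p n) → ℕ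

namespace BratteliDiagram

/-- The finite-dimensional C*-algebra `⨁ i, M_{size n i}(ℂ)` attached to level `n`. -/
abbrev LevelAlgebra (E : BratteliDiagram) (n : ℕ) : Type :=
  (i : Fin (E.p n)) → Matrix (Fin (E.size n i)) (Fin (E.size n i)) ℂ

/-- `E` is the Bratteli diagram corresponding to the tower `D`: the simple summands of `D n` are
matrix algebras of the sizes given by level `n`, and `mult n i j` is the multiplicity of the
partial embedding of the `j`-th summand of `D n` into the `i`-th summand of `D (n + 1)`, i.e. the
rank in that summand of the image of a diagonal matrix unit of the `j`-th summand. -/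
def Corresponds {A : Type u} [NonUnitalCStarAlgebra A] (E : BratteliDiagram)
    (D : ℕ → NonUnitalStarSubalgebra ℂ A) : Prop :=
  ∃ Φ : (n : ℕ) → D n ≃⋆ₐ[ℂ] E.LevelAlgebra n,
    ∀ (n : ℕ) (i : Fin (E.p (n + 1))) (j : Fin (E.p n)) (a : Fin (E.size n j))
      (y : D (n + 1)),
      (y : A) = ((Φ n).symm (Pi.single j (Matrix.single a a 1)) : D n) →
      (Φ (n + 1) y i).rank = E.mult n i j

/-- The vertices, over all levels. -/
abbrev Vertex (E : BratteliDiagram) : Type := Σ n : ℕ, Fin (E.p n)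

/-- The slack at a vertex: the extent to which the embeddings of the algebras at the previous level
fail to fill up the matrix algebra at that vertex (at the initial level, the whole size). -/
def slack (E : BratteliDiagram) : E.Vertex → ℤ
  | ⟨0, i⟩ => E.size 0 i
  | ⟨n + 1, i⟩ => E.size (n + 1) i - ∑ j : Fin (E.p n), (E.mult n i j : ℤ) * E.size n j

/-- The distinguished set of vertices: those where the slack is `1`. -/
def points (E : BratteliDiagram) : Set E.Vertex := {w | E.slack w = 1}

end BratteliDiagram

/-! ## Directed graphs and their path groupoids -/

/-- A directed graph; multiple edges are allowed. -/
structure DirectedGraph where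
  V : Type
  Edge : Type
  s : Edge → V
  r : Edge → V

/-- A Bratteli diagram as a directed graph. -/
def BratteliDiagram.graph (E : BratteliDiagram) : DirectedGraph where
  V := E.Vertex
  Edge := Σ (n : ℕ) (i : Fin (E.p (n + 1))) (j : Fin (E.p n)), Fin (E.mult n i j)
  s e := ⟨e.1, e.2.2.1⟩
  r e := ⟨e.1 + 1, e.2.1⟩

namespace DirectedGraph

/-- Finite paths `e₁ e₂ ⋯ eₙ` with `s eᵢ₊₁ = r eᵢ`, including a path of length zero at each
vertex. -/
structure FinPath (E : DirectedGraph) where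
  source : E.V
  edges : List E.Edge
  chain : edges.IsChain (fun e f => E.r e = E.s f)
  source_eq : ∀ e ∈ edges.head?, E.s e = source

namespace FinPath

variable {E : DirectedGraph}

/-- The length of a finite path. -/
def length (α : E.FinPath) : ℕ := α.edges.length

/-- The vertex at which a finite path ends. -/
def range (α : E.FinPath) : E.V := (α.edges.getLast?.map E.r).getD α.source

end FinPath

/-- Infinite paths. -/
structure InfPath (E : DirectedGraph) where
  edge : ℕ → E.Edge
  chain : ∀ i, E.r (edge i) = E.s (edge (i + 1))

namespace InfPath

variable {E : DirectedGraph}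

/-- The vertex at which an infinite path starts. -/
def source (x : E.InfPath) : E.V := E.s (x.edge 0)

/-- `x = α z`: the infinite path `x` is the finite path `α` followed by the infinite path `z`. -/
def IsConcat (x : E.InfPath) (α : E.FinPath) (z : E.InfPath) : Prop :=
  x.source = α.source ∧ (∀ (i : ℕ) (h : i < α.edges.length), x.edge i = α.edges[i]) ∧
    ∀ j, x.edge (α.length + j) = z.edge j

/-- `x ∼ₖ y`: `x i = y (i + k)` for all large `i`. -/
def TailEq (k : ℤ) (x y : E.InfPath) : Prop :=
  ∃ N : ℕ, ∀ i j : ℕ, N ≤ i → (j : ℤ) = i + k → x.edge i = y.edge j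

end InfPath

/-- The path groupoid of `E`: all triples `(x, k, y)` with `x ∼ₖ y`. -/
@[ext]
structure PathGroupoid (E : DirectedGraph) where
  x : E.InfPath
  k : ℤ
  y : E.InfPath
  tailEq : x.TailEq k y

namespace PathGroupoid

variable {E : DirectedGraph}

/-- `(x, k, y)⁻¹ = (y, -k, x)`. -/
def inv (γ : E.PathGroupoid) : E.PathGroupoid where
  x := γ.y
  k := -γ.k
  y := γ.x
  tailEq := by
    obtain ⟨N, hN⟩ := γ.tailEq
    exact ⟨N + γ.k.natAbs, fun i j hi hj => (hN j i (by omega) (by omega)).symm⟩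

/-- `(x, k, y) (y, l, z) = (x, k + l, z)`. -/
def comp (γ η : E.PathGroupoid) (h : γ.y = η.x) : E.PathGroupoid where
  x := γ.x
  k := γ.k + η.k
  y := η.y
  tailEq := by
    obtain ⟨N, hN⟩ := γ.tailEq
    obtain ⟨M, hM⟩ := η.tailEq
    refine ⟨N + M + γ.k.natAbs, fun i j hi hj => ?_⟩
    obtain ⟨m, hm⟩ := Int.eq_ofNat_of_zero_le (show 0 ≤ (i : ℤ) + γ.k by omega)
    rw [hN i m (by omega) (by omega), h, hM m j (by omega) (by omega)]

/-- The units `(x, 0, x)`. -/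
def IsUnitArrow (γ : E.PathGroupoid) : Prop := γ.k = 0 ∧ γ.x = γ.y

/-- The set `Z(α, β)` of all `(α z, |β| - |α|, β z)`, `z` an infinite path. -/
def Z (α β : E.FinPath) : Set E.PathGroupoid :=
  {γ | γ.k = (β.length : ℤ) - α.length ∧ ∃ z : E.InfPath, γ.x.IsConcat α z ∧ γ.y.IsConcat β z}

/-- The topology generated by the sets `Z(α, β)` with `r(α) = r(β)`. -/
instance : TopologicalSpace E.PathGroupoid :=
  TopologicalSpace.generateFrom {U | ∃ α β : E.FinPath, α.range = β.range ∧ U = Z α β}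

end PathGroupoid

/-- The path groupoid of the graph `E` pointed at `S`: the reduction of the path groupoid to the
set of those infinite paths whose source is in `S`, with the relative topology. -/
abbrev PointedPathGroupoid (E : DirectedGraph) (S : Set E.V) : Type :=
  {γ : E.PathGroupoid // γ.x.source ∈ S ∧ γ.y.source ∈ S}

namespace PointedPathGroupoid

variable {E : DirectedGraph} {S : Set E.V}

/-- The unit space, with the relative topology. -/
abbrev UnitSpace (E : DirectedGraph) (S : Set E.V) : Type :=
  {γ : E.PointedPathGroupoid S // γ.1.IsUnitArrow}

/-- The convolution `(f * g)(γ) = ∑ f(γ₁) g(γ₂)` over all factorizations `γ = γ₁ γ₂`; the sum has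
only finitely many nonzero terms when `f` and `g` are continuous with compact support. -/
def convolution (f g : E.PointedPathGroupoid S → ℂ) (γ : E.PointedPathGroupoid S) : ℂ :=
  ∑ᶠ q : {q : E.PointedPathGroupoid S × E.PointedPathGroupoid S //
      ∃ h : q.1.1.y = q.2.1.x, q.1.1.comp q.2.1 h = γ.1}, f q.1.1 * g q.1.2

/-- The involution `f*(γ) = conj (f(γ⁻¹))`. -/
def involution (f : E.PointedPathGroupoid S → ℂ) (γ : E.PointedPathGroupoid S) : ℂ :=
  star (f ⟨γ.1.inv, γ.2.2, γ.2.1⟩)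

/-- `π` is a *-homomorphism from the convolution *-algebra `C_c(𝒢)` to `C`. -/
structure IsStarHom {C : Type v} [NonUnitalRing C] [Module ℂ C] [Star C]
    (π : C_c(E.PointedPathGroupoid S, ℂ) →ₗ[ℂ] C) : Prop where
  map_mul : ∀ f g : C_c(E.PointedPathGroupoid S, ℂ),
    ∃ h : C_c(E.PointedPathGroupoid S, ℂ), ⇑h = convolution f g ∧ π h = π f * π g
  map_star : ∀ f : C_c(E.PointedPathGroupoid S, ℂ),
    ∃ h : C_c(E.PointedPathGroupoid S, ℂ), ⇑h = involution f ∧ π h = star (π f)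

/-- `A`, together with `ι : C_c(𝒢) → A`, is the (full) groupoid C*-algebra `C*(𝒢)`: the completion
of the convolution *-algebra `C_c(𝒢)` in the norm `‖f‖ = sup ‖π f‖`, where `π` runs over all
*-representations of `C_c(𝒢)` on Hilbert spaces. The inequality `‖ι f‖ ≤ sup ‖π f‖` is
automatic, since `ι` is a *-homomorphism to a C*-algebra. -/
structure IsGroupoidCStarAlgebra {A : Type u} [NonUnitalCStarAlgebra A]
    (ι : C_c(E.PointedPathGroupoid S, ℂ) →ₗ[ℂ] A) : Prop where
  isStarHom : IsStarHom ι
  denseRange : DenseRange ι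
  norm_le : ∀ (H : Type v) [NormedAddCommGroup H] [InnerProductSpace ℂ H] [CompleteSpace H]
    (π : C_c(E.PointedPathGroupoid S, ℂ) →ₗ[ℂ] (H →L[ℂ] H)), IsStarHom π →
      ∀ f : C_c(E.PointedPathGroupoid S, ℂ), ‖π f‖ ≤ ‖ι f‖

end PointedPathGroupoid

end DirectedGraph

/-! ## Diagonal subalgebras -/

section Diagonal

variable {A : Type u} [NonUnitalCStarAlgebra A]

/-- The positive element `h` is strictly positive in `A`: every nonzero positive linear functional
on `A` is strictly positive at `h`. -/
def IsStrictlyPositiveIn [PartialOrder A] [StarOrderedRing A] (h : A) : Prop :=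
  0 ≤ h ∧ ∀ φ : A →ₚ[ℂ] ℂ, (∃ a, φ a ≠ 0) → 0 < φ h

/-- `P` is a conditional expectation of `A` onto the subalgebra `B`. -/
structure IsConditionalExpectation [PartialOrder A] [StarOrderedRing A]
    (B : NonUnitalStarSubalgebra ℂ A) (P : A →ₗ[ℂ] A) : Prop where
  map_mem : ∀ a, P a ∈ B
  map_eq : ∀ b ∈ B, P b = b
  map_nonneg : ∀ a, 0 ≤ a → 0 ≤ P a
  norm_map_le : ∀ a, ‖P a‖ ≤ ‖a‖
  map_mul_left : ∀ b ∈ B, ∀ a, P (b * a) = b * P a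
  map_mul_right : ∀ b ∈ B, ∀ a, P (a * b) = P a * b

/-- The free normalizers of `B` in `A`. -/
def freeNormalizers (B : NonUnitalStarSubalgebra ℂ A) : Set A :=
  {a | (∀ b ∈ B, star a * b * a ∈ B) ∧ (∀ b ∈ B, a * b * star a ∈ B) ∧ a * a = 0}

/-- `B` is an abelian C*-subalgebra of `A` which is diagonal in `A` in the sense of Kumjian. -/
structure IsKumjianDiagonal [PartialOrder A] [StarOrderedRing A]
    (B : NonUnitalStarSubalgebra ℂ A) : Prop where
  isClosed : IsClosed (B : Set A)
  comm : ∀ b ∈ B, ∀ c ∈ B, b * c = c * b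
  exists_strictlyPositive : ∃ h ∈ B, IsStrictlyPositiveIn h
  exists_expectation : ∃ P : A →ₗ[ℂ] A, IsConditionalExpectation B P ∧
    (∀ a, P (star a * a) = 0 → a = 0) ∧
    closure (Submodule.span ℂ (freeNormalizers B) : Set A) = {a | P a = 0}

end Diagonal

end

/-! Every AF-algebra is the C*-algebra of a pointed path groupoid, with a Kumjian diagonal.

A tower of finite-dimensional algebras is first replaced by a tower of systems of matrix units
`e i a b` in which each matrix unit is a block-diagonal sum of matrix units of the next level and at
most one diagonal index of a summand is not reached from below (`MatrixSystem.exists_tower`). To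
refine a system lying in a finite-dimensional algebra `F`, its diagonal matrix units are decomposed
into minimal projections of `F`. The result exhausts a corner of `F`; a minimal projection of `F`
orthogonal to the system enlarges that corner by one index per summand at most, and after finitely
many such steps the corner is all of `F`. The tower starts from the zero algebra, so that the
initial slacks cause no difficulty.

Tracing an index `a` of the summand at a vertex `v` back to the level where it is not reached from
below identifies the indices with the finite paths `α` from the distinguished vertices to `v`
(`MatrixSystem.pathEquiv`). The matrix units become elements `e v α β`, and their embeddings become
`e v α β = ∑ g, e (r g) (α g) (β g)`, the sum taken over the edges `g` starting at `v`. The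
indicator functions of the compact open sets `Z(α, β)` satisfy the same relations in `C_c(𝒢)`, and
every function in `C_c(𝒢)` is approximated by the locally constant functions `disc n f`, uniformly
and within a compact set that is a finite union of sets `Z(α, β)`. On functions vanishing outside
such a set every representation of `C_c(𝒢)` is bounded by a multiple of the supremum norm, as the
C*-identity reduces this to functions on the units. Therefore sending the indicator functions to the
matrix units extends to a *-homomorphism `IsPathUnits.rep` with dense range. Its norm dominates
every other representation, because all C*-seminorms on a direct sum of matrix algebras lie below
the unique C*-norm (`IsPathUnits.isGroupoidCStarAlgebra`).

The diagonal `B` is the image of `C₀(𝒢⁰)`, the closed span of the `e v α α`. The compressions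
`a ↦ ∑ α, e v α α * a * e v α α` to the diagonals of the successive levels are contractions, and
converge to a conditional expectation `IsPathUnits.cexp` onto `B`. It commutes with conjugation by
matrix units (`IsPathUnits.cexp_conj`). Hence its left kernel is invariant under right
multiplication by matrix units, and looking at columns of matrices shows that the kernel vanishes
(`IsPathUnits.cexp_faithful`). The matrix units `e v α β` with `α ≠ β` are free normalizers and span
a dense subspace of the kernel of the expectation, while the expectation vanishes at any free
normalizer (`IsPathUnits.cexp_eq_zero_of_mem_freeNormalizers`). -/

noncomputable section

/-! ### Systems of matrix units -/

/-- A finite direct sum of systems of matrix units `e i a b` in a *-algebra, the `i`-th of them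
indexed by `ι i`. The matrix units may vanish. -/
structure IsMatrixUnits {A : Type*} [NonUnitalRing A] [StarRing A] {κ : Type*} {ι : κ → Type*}
    [∀ i, DecidableEq (ι i)] (e : ∀ i, ι i → ι i → A) : Prop where
  star_eq : ∀ i a b, star (e i a b) = e i b a
  mul_same : ∀ i a b c d, e i a b * e i c d = if b = c then e i a d else 0
  mul_ne : ∀ i j a b c d, i ≠ j → e i a b * e j c d = 0

namespace IsMatrixUnits

section Hom

variable {A : Type*} [NonUnitalRing A] [StarRing A] [Module ℂ A] [IsScalarTower ℂ A A]
  [SMulCommClass ℂ A A] [StarModule ℂ A]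
  {κ : Type*} {ι : κ → Type*} [∀ i, DecidableEq (ι i)] [Fintype κ] [∀ i, Fintype (ι i)]
  {e : ∀ i, ι i → ι i → A}

/-- The *-homomorphism from `⨁ i, M_{ι i}(ℂ)` determined by a system of matrix units. -/
def hom (h : IsMatrixUnits e) : (∀ i, Matrix (ι i) (ι i) ℂ) →⋆ₙₐ[ℂ] A where
  toFun M := ∑ i, ∑ a, ∑ b, M i a b • e i a b
  map_smul' c M := by simp [Finset.smul_sum, mul_smul]
  map_zero' := by simp
  map_add' M N := by simp [Finset.sum_add_distrib, add_smul]
  map_mul' M N := by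
    classical
    have key : ∀ i j : κ, (∑ a, ∑ b, M i a b • e i a b) * (∑ c, ∑ d, N j c d • e j c d) =
        if i = j then ∑ a, ∑ d, (M i * N i) a d • e i a d else 0 := by
      intro i j
      split_ifs with hij
      · subst hij
        rw [Finset.sum_mul]
        refine Finset.sum_congr rfl fun a _ => ?_
        have h1 : ∀ b, M i a b • e i a b * (∑ c, ∑ d, N i c d • e i c d) =
            ∑ d, (M i a b * N i b d) • e i a d := fun b => by
          rw [Finset.mul_sum, Finset.sum_eq_single b]
          · simp only [Finset.mul_sum, smul_mul_smul_comm, h.mul_same, if_true]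
          · intro c _ hc
            simp [Finset.mul_sum, smul_mul_smul_comm, h.mul_same, hc.symm]
          · simp
        rw [Finset.sum_mul, Finset.sum_congr rfl fun b _ => h1 b, Finset.sum_comm]
        simp only [Matrix.mul_apply, Finset.sum_smul]
      · simp only [Finset.sum_mul, Finset.mul_sum, smul_mul_smul_comm, h.mul_ne _ _ _ _ _ _ hij,
          smul_zero, Finset.sum_const_zero]
    rw [Finset.sum_mul_sum]
    simp_rw [key]
    simp
  map_star' M := by
    simp only [star_sum, star_smul, h.star_eq]
    refine Finset.sum_congr rfl fun i _ => ?_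
    rw [Finset.sum_comm]
    rfl

theorem hom_apply (h : IsMatrixUnits e) (M : ∀ i, Matrix (ι i) (ι i) ℂ) :
    h.hom M = ∑ i, ∑ a, ∑ b, M i a b • e i a b := rfl

theorem hom_single [DecidableEq κ] (h : IsMatrixUnits e) (i : κ) (a b : ι i) :
    h.hom (Pi.single i (Matrix.single a b 1)) = e i a b := by
  rw [hom_apply, Finset.sum_eq_single i, Finset.sum_eq_single a, Finset.sum_eq_single b]
  · simp
  · intro c _ hc; simp [Matrix.single, hc.symm]
  · simp
  · intro c _ hc; simp [Matrix.single, hc.symm]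
  · simp
  · intro c _ hc; simp [Pi.single_eq_of_ne hc]
  · simp

theorem mul_hom_mul (h : IsMatrixUnits e) (M : ∀ i, Matrix (ι i) (ι i) ℂ) (i : κ) (a b c d : ι i) :
    e i a b * h.hom M * e i c d = M i b c • e i a d := by
  rw [hom_apply, Finset.mul_sum, Finset.sum_mul, Finset.sum_eq_single i]
  · simp [Finset.mul_sum, Finset.sum_mul, h.mul_same, mul_smul_comm, smul_mul_assoc,
      Finset.sum_ite_eq]
  · intro j _ hj
    simp [Finset.mul_sum, h.mul_ne _ _ _ _ _ _ hj.symm, mul_smul_comm]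
  · simp

theorem hom_injective (h : IsMatrixUnits e) (h0 : ∀ i a, e i a a ≠ 0) :
    Function.Injective h.hom := by
  rw [injective_iff_map_eq_zero]
  intro M hM
  funext i
  ext a b
  have := h.mul_hom_mul M i a a b a
  rw [hM, mul_zero, zero_mul] at this
  simpa [h0 i a] using this.symm

theorem mem_of_forall_mem (h : IsMatrixUnits e) {D : NonUnitalStarSubalgebra ℂ A}
    (hD : ∀ i a b, e i a b ∈ D) (M : ∀ i, Matrix (ι i) (ι i) ℂ) : h.hom M ∈ D :=
  sum_mem fun i _ => sum_mem fun a _ => sum_mem fun b _ => SMulMemClass.smul_mem _ (hD i a b)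

end Hom

section Norm

open scoped Matrix.Norms.L2Operator

variable {A : Type*} [NonUnitalCStarAlgebra A]
  {κ : Type*} {ι : κ → Type*} [∀ i, DecidableEq (ι i)] [Fintype κ] [∀ i, Fintype (ι i)]
  {e : ∀ i, ι i → ι i → A}

theorem norm_hom_le (h : IsMatrixUnits e) (M : ∀ i, Matrix (ι i) (ι i) ℂ) : ‖h.hom M‖ ≤ ‖M‖ :=
  NonUnitalStarAlgHom.norm_apply_le h.hom M

theorem norm_hom (h : IsMatrixUnits e) (h0 : ∀ i a, e i a a ≠ 0)
    (M : ∀ i, Matrix (ι i) (ι i) ℂ) : ‖h.hom M‖ = ‖M‖ :=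
  NonUnitalStarAlgHom.norm_map h.hom (h.hom_injective h0) M

/-- Another system of matrix units of the same shape satisfies no stronger norm bound than a
nonvanishing one: all C*-norms agree on a finite direct sum of matrix algebras. -/
theorem norm_hom_le_norm_hom {C : Type*} [NonUnitalCStarAlgebra C] {e' : ∀ i, ι i → ι i → C}
    (h : IsMatrixUnits e) (h0 : ∀ i a, e i a a ≠ 0) (h' : IsMatrixUnits e')
    (M : ∀ i, Matrix (ι i) (ι i) ℂ) : ‖h'.hom M‖ ≤ ‖h.hom M‖ :=
  (h'.norm_hom_le M).trans_eq (h.norm_hom h0 M).symm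

theorem norm_hom_diagonal_le (h : IsMatrixUnits e) (d : ∀ i, ι i → ℂ) {C : ℝ} (hC : 0 ≤ C)
    (hd : ∀ i a, ‖d i a‖ ≤ C) : ‖h.hom fun i => Matrix.diagonal (d i)‖ ≤ C := by
  refine (h.norm_hom_le _).trans ((pi_norm_le_iff_of_nonneg hC).2 fun i => ?_)
  rw [Matrix.l2_opNorm_diagonal]
  exact (pi_norm_le_iff_of_nonneg hC).2 (hd i)

omit [Fintype κ] [∀ i, Fintype (ι i)] in
theorem norm_le_one (h : IsMatrixUnits e) (i : κ) (a b : ι i) : ‖e i a b‖ ≤ 1 := by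
  have h2 : ‖e i b b‖ * ‖e i b b‖ = ‖e i b b‖ := by
    rw [← CStarRing.norm_star_mul_self, h.star_eq, h.mul_same, if_pos rfl]
  have h1 : ‖e i a b‖ * ‖e i a b‖ = ‖e i b b‖ := by
    rw [← CStarRing.norm_star_mul_self, h.star_eq, h.mul_same, if_pos rfl]
  have h3 : ‖e i b b‖ ≤ 1 := by nlinarith [norm_nonneg (e i b b)]
  nlinarith [norm_nonneg (e i a b)]

theorem hom_mul_column (h : IsMatrixUnits e) (M : ∀ i, Matrix (ι i) (ι i) ℂ) (i : κ) (b : ι i)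
    (ξ : ι i → ℂ) :
    h.hom M * ∑ a, ξ a • e i a b = ∑ a, (M i).mulVec ξ a • e i a b := by
  rw [hom_apply, Finset.sum_mul, Finset.sum_eq_single i]
  · rw [Finset.sum_mul]
    refine Finset.sum_congr rfl fun c _ => ?_
    rw [Finset.sum_mul, Matrix.mulVec, dotProduct, Finset.sum_smul]
    refine Finset.sum_congr rfl fun d _ => ?_
    simp [Finset.mul_sum, smul_mul_smul_comm, h.mul_same]
  · intro j _ hj
    simp [Finset.mul_sum, Finset.sum_mul, smul_mul_smul_comm, h.mul_ne _ _ _ _ _ _ hj]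
  · simp

omit [Fintype κ] in
theorem star_column_mul_column (h : IsMatrixUnits e) (i : κ) (b : ι i) (ξ : ι i → ℂ) :
    star (∑ a, ξ a • e i a b) * ∑ a, ξ a • e i a b =
      ((‖WithLp.toLp 2 ξ‖ ^ 2 : ℝ) : ℂ) • e i b b := by
  rw [EuclideanSpace.norm_sq_eq, star_sum, Finset.sum_mul, Complex.ofReal_sum, Finset.sum_smul]
  refine Finset.sum_congr rfl fun a _ => ?_
  simp only [star_smul, h.star_eq, Finset.mul_sum, smul_mul_smul_comm, h.mul_same, smul_ite,
    smul_zero, Finset.sum_ite_eq, Finset.mem_univ, if_true]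
  rw [Complex.ofReal_pow, ← Complex.conj_mul']
  rfl

/-- The operator norm of a matrix is almost attained on a column: there is a column vector of the
matrix algebra, supported in one summand, on which the norm is at least halved. -/
theorem exists_column (h : IsMatrixUnits e) (M : ∀ i, Matrix (ι i) (ι i) ℂ) (hM : M ≠ 0) :
    ∃ (i : κ) (b : ι i) (ξ : ι i → ℂ) (t : ℝ),
      ‖∑ a, ξ a • e i a b‖ ≤ 1 ∧ ‖M‖ / 2 ≤ t ∧
      star (h.hom M * ∑ a, ξ a • e i a b) * (h.hom M * ∑ a, ξ a • e i a b) =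
        ((t ^ 2 : ℝ) : ℂ) • e i b b := by
  have hpos : 0 < ‖M‖ := norm_pos_iff.2 hM
  obtain ⟨i, hi⟩ : ∃ i, ‖M‖ ≤ ‖M i‖ := by
    by_contra! hlt
    exact lt_irrefl _ ((pi_norm_lt_iff hpos).2 hlt)
  have hlt : ‖M‖ / 2 < ‖Matrix.toEuclideanCLM (n := ι i) (𝕜 := ℂ) (M i)‖ := by
    rw [Matrix.l2_opNorm_toEuclideanCLM]
    linarith
  obtain ⟨x, hx1, hx2⟩ := ContinuousLinearMap.exists_lt_apply_of_lt_opNorm _ hlt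
  obtain ⟨b⟩ : Nonempty (ι i) := by
    by_contra hemp
    rw [not_nonempty_iff] at hemp
    have : M i = 0 := Subsingleton.elim _ _
    rw [this, norm_zero] at hi
    linarith
  refine ⟨i, b, x.ofLp, ‖Matrix.toEuclideanCLM (n := ι i) (𝕜 := ℂ) (M i) x‖, ?_, hx2.le, ?_⟩
  · have hsq : ‖∑ a, x.ofLp a • e i a b‖ * ‖∑ a, x.ofLp a • e i a b‖ ≤ 1 := by
      rw [← CStarRing.norm_star_mul_self, h.star_column_mul_column, norm_smul]
      have h1 := h.norm_le_one i b b
      have h2 : ‖((‖WithLp.toLp 2 x.ofLp‖ ^ 2 : ℝ) : ℂ)‖ ≤ 1 := by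
        rw [Complex.norm_real, Real.norm_of_nonneg (by positivity)]
        have h3 : ‖WithLp.toLp 2 x.ofLp‖ = ‖x‖ := rfl
        rw [h3]
        nlinarith [norm_nonneg x]
      exact mul_le_one₀ h2 (norm_nonneg _) h1
    nlinarith [norm_nonneg (∑ a, x.ofLp a • e i a b)]
  · rw [h.hom_mul_column, h.star_column_mul_column]
    congr 4

end Norm

end IsMatrixUnits

/-! ### Minimal projections in finite-dimensional C*-algebras -/

/-- `f` is a minimal projection of the C*-subalgebra `F`, in the form `f F f = ℂ f`. -/
structure IsMinimalProjection {A : Type*} [NonUnitalCStarAlgebra A]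
    (F : NonUnitalStarSubalgebra ℂ A) (f : A) : Prop where
  mem : f ∈ F
  star_eq : star f = f
  mul_self : f * f = f
  ne_zero : f ≠ 0
  scalar : ∀ x ∈ F, ∃ c : ℂ, f * x * f = c • f

/-- A right ideal of the C*-subalgebra `F`. -/
structure IsRightIdealOf {A : Type*} [NonUnitalCStarAlgebra A]
    (F : NonUnitalStarSubalgebra ℂ A) (R : Submodule ℂ A) : Prop where
  mem : ∀ r ∈ R, r ∈ F
  mul_mem_right : ∀ r ∈ R, ∀ x ∈ F, r * x ∈ R

section MinimalProjection

variable {A : Type*} [NonUnitalCStarAlgebra A] {F : NonUnitalStarSubalgebra ℂ A}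

theorem finiteDimensional_of_forall_mem [FiniteDimensional ℂ F] {R : Submodule ℂ A}
    (h : ∀ r ∈ R, r ∈ F) : FiniteDimensional ℂ R :=
  have : FiniteDimensional ℂ F.toSubmodule := ‹FiniteDimensional ℂ F›
  Submodule.finiteDimensional_of_le (S₂ := F.toSubmodule) h

theorem IsRightIdealOf.map_mulLeft {R : Submodule ℂ A} (hR : IsRightIdealOf F R) {t : A}
    (ht : t ∈ F) : IsRightIdealOf F (R.map (LinearMap.mulLeft ℂ t)) where
  mem := by
    rintro _ ⟨r, hr, rfl⟩
    exact mul_mem ht (hR.mem r hr)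
  mul_mem_right := by
    rintro _ ⟨r, hr, rfl⟩ x hx
    exact ⟨r * x, hR.mul_mem_right r hr x hx, by simp [mul_assoc]⟩

theorem isRightIdealOf_self (F : NonUnitalStarSubalgebra ℂ A) : IsRightIdealOf F F.toSubmodule where
  mem _ h := h
  mul_mem_right _ hr _ hx := mul_mem (S := NonUnitalStarSubalgebra ℂ A) hr hx

/-- Every nonzero right ideal `R₀` of a finite-dimensional C*-algebra contains a minimal
projection. A minimal right ideal `R ⊆ R₀` contains a nonzero self-adjoint `x = t t*`; then
`x R = R` provides `e ∈ R` with `x e = x`, and injectivity of `x` on `R` makes `e` a projection. -/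
theorem IsRightIdealOf.exists_isMinimalProjection [FiniteDimensional ℂ F] {R₀ : Submodule ℂ A}
    (hR₀ : IsRightIdealOf F R₀) (h0 : R₀ ≠ ⊥) : ∃ e ∈ R₀, IsMinimalProjection F e := by
  obtain ⟨R, ⟨hle, hR, hne⟩, hmin⟩ := (measure fun R : Submodule ℂ A => Module.finrank ℂ R).wf.has_min
    {R | R ≤ R₀ ∧ IsRightIdealOf F R ∧ R ≠ ⊥} ⟨R₀, le_rfl, hR₀, h0⟩
  have hfd : FiniteDimensional ℂ R := finiteDimensional_of_forall_mem hR.mem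
  have heq : ∀ R' : Submodule ℂ A, R' ≤ R → IsRightIdealOf F R' → R' ≠ ⊥ → R' = R := by
    intro R' h1 h2 h3
    exact Submodule.eq_of_le_of_finrank_le h1 (not_lt.1 (hmin R' ⟨h1.trans hle, h2, h3⟩))
  obtain ⟨t, ht, ht0⟩ := Submodule.exists_mem_ne_zero_of_ne_bot hne
  have hx : t * star t ∈ R := hR.mul_mem_right t ht _ (star_mem (hR.mem t ht))
  have hxs : star (t * star t) = t * star t := by simp
  have hx0 : t * star t ≠ 0 := fun h => ht0 ((CStarRing.mul_star_self_eq_zero_iff t).1 h)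
  generalize t * star t = x at hx hxs hx0
  have hxx : x * x ≠ 0 := fun h => hx0 ((CStarRing.star_mul_self_eq_zero_iff x).1 (by rwa [hxs]))
  have hxR : R.map (LinearMap.mulLeft ℂ x) = R := by
    refine heq _ ?_ (hR.map_mulLeft (hR.mem x hx)) ?_
    · rintro _ ⟨r, hr, rfl⟩
      exact hR.mul_mem_right x hx r (hR.mem r hr)
    · rw [Submodule.ne_bot_iff]
      exact ⟨x * x, ⟨x, hx, rfl⟩, hxx⟩
  have hinj : ∀ r ∈ R, x * r = 0 → r = 0 := by
    intro r hr hxr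
    by_contra hr0
    have hker : R ⊓ (LinearMap.mulLeft ℂ x).ker = R := by
      refine heq _ inf_le_left ⟨fun r hr => hR.mem r hr.1, ?_⟩ ?_
      · rintro r ⟨hr, hr'⟩ y hy
        refine ⟨hR.mul_mem_right r hr y hy, ?_⟩
        simp only [SetLike.mem_coe, LinearMap.mem_ker, LinearMap.mulLeft_apply] at hr' ⊢
        rw [← mul_assoc, hr', zero_mul]
      · rw [Submodule.ne_bot_iff]
        exact ⟨r, ⟨hr, hxr⟩, hr0⟩
    have : x ∈ R ⊓ (LinearMap.mulLeft ℂ x).ker := hker.symm ▸ hx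
    exact hxx this.2
  obtain ⟨e, he, hxe⟩ : x ∈ R.map (LinearMap.mulLeft ℂ x) := hxR.symm ▸ hx
  rw [LinearMap.mulLeft_apply] at hxe
  have heF := hR.mem e he
  have hex : e * x = x := by
    have h1 : x * (e * x - x) = 0 := by rw [mul_sub, ← mul_assoc, hxe, sub_self]
    exact sub_eq_zero.1 (hinj _ (sub_mem (hR.mul_mem_right e he x (hR.mem x hx)) hx) h1)
  have hee : e * star e = e := by
    have hxse : x * star e = x := by
      have := congrArg star hex
      rwa [star_mul, hxs] at this
    have h1 : x * (e * star e - e) = 0 := by rw [mul_sub, ← mul_assoc, hxe, hxse, sub_self]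
    exact sub_eq_zero.1 (hinj _ (sub_mem (hR.mul_mem_right e he _ (star_mem heF)) he) h1)
  have hes : star e = e := by
    rw [← hee, star_mul, star_star]
  have hid : e * e = e := by rwa [hes] at hee
  have he0 : e ≠ 0 := by
    rintro rfl
    exact hx0 (by rw [← hxe, mul_zero])
  refine ⟨e, hle he, heF, hes, hid, he0, fun z hz => ?_⟩
  -- an eigenvector of right multiplication by `e z e` on `e F e`
  let V : Submodule ℂ A := (F.toSubmodule).map
    ((LinearMap.mulRight ℂ e).comp (LinearMap.mulLeft ℂ e))
  have hVmem : ∀ w ∈ V, w ∈ F ∧ w * e = w ∧ e * w = w := by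
    rintro _ ⟨y, hy, rfl⟩
    simp only [LinearMap.comp_apply, LinearMap.mulLeft_apply, LinearMap.mulRight_apply]
    refine ⟨mul_mem (mul_mem heF hy) heF, ?_, ?_⟩
    · rw [mul_assoc, hid]
    · rw [← mul_assoc, ← mul_assoc, hid]
  have hV : FiniteDimensional ℂ V := finiteDimensional_of_forall_mem fun w hw => (hVmem w hw).1
  have heV : e ∈ V := ⟨e, heF, by simp [hid]⟩
  have : Nontrivial V := ⟨⟨⟨e, heV⟩, 0, fun h => he0 (congrArg Subtype.val h)⟩⟩
  have hVV : ∀ w ∈ V, LinearMap.mulRight ℂ (e * z * e) w ∈ V := by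
    intro w hw
    obtain ⟨hwF, hwe, hew⟩ := hVmem w hw
    refine ⟨w * z, (mul_mem hwF hz : w * z ∈ F), ?_⟩
    simp only [LinearMap.comp_apply, LinearMap.mulLeft_apply, LinearMap.mulRight_apply,
      ← mul_assoc, hwe, hew]
  obtain ⟨c, hc⟩ := Module.End.exists_eigenvalue ((LinearMap.mulRight ℂ (e * z * e)).restrict hVV)
  obtain ⟨⟨w, hw⟩, hwc⟩ := hc.exists_hasEigenvector
  have hw0 : w ≠ 0 := fun h => hwc.2 (Subtype.ext h)
  have hweq : w * (e * z * e) = c • w := congrArg Subtype.val hwc.apply_eq_smul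
  refine ⟨c, sub_eq_zero.1 ?_⟩
  by_contra ht0
  have htR : e * z * e - c • e ∈ R := by
    refine sub_mem ?_ (R.smul_mem c he)
    rw [mul_assoc]
    exact hR.mul_mem_right e he _ (mul_mem hz heF)
  have htF : (F.toSubmodule).map (LinearMap.mulLeft ℂ (e * z * e - c • e)) = R := by
    refine heq _ ?_ ((isRightIdealOf_self F).map_mulLeft (hR.mem _ htR)) ?_
    · rintro _ ⟨y, hy, rfl⟩
      exact hR.mul_mem_right _ htR y hy
    · rw [Submodule.ne_bot_iff]
      refine ⟨_, ⟨e, heF, rfl⟩, ?_⟩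
      rw [LinearMap.mulLeft_apply, sub_mul, mul_assoc _ e e, hid, smul_mul_assoc, hid]
      exact ht0
  obtain ⟨y, hy, hye⟩ : e ∈ (F.toSubmodule).map (LinearMap.mulLeft ℂ (e * z * e - c • e)) :=
    htF.symm ▸ he
  rw [LinearMap.mulLeft_apply] at hye
  apply hw0
  rw [← (hVmem w hw).2.1, ← hye, ← mul_assoc, mul_sub, hweq, mul_smul_comm, (hVmem w hw).2.1,
    sub_self, zero_mul]

/-- A projection of a finite-dimensional C*-algebra is a sum of orthogonal minimal projections. -/
theorem exists_sum_isMinimalProjection [FiniteDimensional ℂ F] {q : A} (hq : q ∈ F)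
    (hqs : star q = q) (hqq : q * q = q) :
    ∃ (k : ℕ) (f : Fin k → A), (∀ i, IsMinimalProjection F (f i)) ∧
      (∀ i j, i ≠ j → f i * f j = 0) ∧ ∑ i, f i = q := by
  obtain ⟨n, hn⟩ : ∃ n, Module.finrank ℂ ((F.toSubmodule).map (LinearMap.mulLeft ℂ q)) ≤ n :=
    ⟨_, le_rfl⟩
  induction n generalizing q with
  | zero =>
    have : FiniteDimensional ℂ ((F.toSubmodule).map (LinearMap.mulLeft ℂ q)) :=
      finiteDimensional_of_forall_mem ((isRightIdealOf_self F).map_mulLeft hq).mem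
    have h0 := Submodule.finrank_eq_zero.1 (Nat.le_zero.1 hn)
    have : q ∈ (F.toSubmodule).map (LinearMap.mulLeft ℂ q) := ⟨q, hq, hqq⟩
    rw [h0, Submodule.mem_bot] at this
    exact ⟨0, Fin.elim0, fun i => i.elim0, fun i => i.elim0, by simp [this]⟩
  | succ n ih =>
    by_cases hq0 : q = 0
    · exact ⟨0, Fin.elim0, fun i => i.elim0, fun i => i.elim0, by simp [hq0]⟩
    obtain ⟨e, heq, he⟩ := ((isRightIdealOf_self F).map_mulLeft hq).exists_isMinimalProjection
      ((Submodule.ne_bot_iff _).2 ⟨q, ⟨q, hq, hqq⟩, hq0⟩)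
    have hqe : q * e = e := by
      obtain ⟨y, hy, rfl⟩ := heq
      rw [LinearMap.mulLeft_apply, ← mul_assoc, hqq]
    have heq' : e * q = e := by
      have := congrArg star hqe
      rwa [star_mul, he.star_eq, hqs] at this
    have hpF : q - e ∈ F := sub_mem hq he.mem
    have hqp : q * (q - e) = q - e := by rw [mul_sub, hqq, hqe]
    have hep : e * (q - e) = 0 := by rw [mul_sub, heq', he.mul_self, sub_self]
    have hpp : (q - e) * (q - e) = q - e := by rw [sub_mul, hqp, hep, sub_zero]
    have hps : star (q - e) = q - e := by rw [star_sub, hqs, he.star_eq]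
    have : FiniteDimensional ℂ ((F.toSubmodule).map (LinearMap.mulLeft ℂ q)) :=
      finiteDimensional_of_forall_mem ((isRightIdealOf_self F).map_mulLeft hq).mem
    have hlt : (F.toSubmodule).map (LinearMap.mulLeft ℂ (q - e)) <
        (F.toSubmodule).map (LinearMap.mulLeft ℂ q) := by
      refine lt_of_le_of_ne ?_ fun h => he.ne_zero ?_
      · rintro _ ⟨y, hy, rfl⟩
        refine ⟨(q - e) * y, (mul_mem hpF (show y ∈ F from hy) : (q - e) * y ∈ F), ?_⟩
        simp only [LinearMap.mulLeft_apply, ← mul_assoc, hqp]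
      · rw [← h] at heq
        obtain ⟨y, hy, hye⟩ := heq
        rw [← he.mul_self]
        nth_rw 2 [← hye]
        rw [LinearMap.mulLeft_apply, ← mul_assoc, hep, zero_mul]
    obtain ⟨k, f, hf, hort, hsum⟩ := ih hpF hps hpp
      (Nat.lt_succ_iff.1 ((Submodule.finrank_lt_finrank_of_lt hlt).trans_le hn))
    have hef : ∀ i, e * f i = 0 := by
      intro i
      have h1 : (q - e) * f i = f i := by
        rw [← hsum, Finset.sum_mul, Finset.sum_eq_single i (fun j _ hj => hort j i hj) (by simp),
          (hf i).mul_self]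
      rw [← h1, ← mul_assoc, hep, zero_mul]
    refine ⟨k + 1, Fin.cons e f, ?_, ?_, ?_⟩
    · intro i
      refine Fin.cases ?_ (fun i => ?_) i
      · simpa using he
      · simpa using hf i
    · intro i j
      refine Fin.cases ?_ (fun i => ?_) i <;> refine Fin.cases ?_ (fun j => ?_) j <;> intro hij
      · exact absurd rfl hij
      · simpa using hef j
      · have := congrArg star (hef i)
        rw [star_mul, star_zero, he.star_eq, (hf i).star_eq] at this
        simpa using this
      · simpa using hort i j fun h => hij (congrArg Fin.succ h)
    · rw [Fin.sum_univ_succ]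
      simp [hsum]

theorem mul_star_mul_self_of_isProjection {w g : A} (h : star w * w = g) (hg : g * g = g) :
    w * g = w := by
  have hgs : star g = g := by rw [← h]; simp
  have h0 : star (w * g - w) * (w * g - w) = 0 := by
    have h1 : star (w * g - w) * (w * g - w) =
        g * (star w * w) * g - g * (star w * w) - (star w * w) * g + star w * w := by
      rw [star_sub, star_mul, hgs]
      noncomm_ring
    rw [h1, h, hg, hg]
    simp
  exact sub_eq_zero.1 ((CStarRing.star_mul_self_eq_zero_iff _).1 h0)

/-- Two minimal projections `f`, `g` of `F` with `f F g ≠ 0` are Murray–von Neumann equivalent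
in `F`. -/
theorem IsMinimalProjection.exists_partialIsometry [PartialOrder A] [StarOrderedRing A] {f g : A}
    (hf : IsMinimalProjection F f) (hg : IsMinimalProjection F g) {x : A} (hx : x ∈ F)
    (h0 : f * x * g ≠ 0) : ∃ w ∈ F, star w * w = g ∧ w * star w = f := by
  set y := f * x * g with hy
  have hyF : y ∈ F := mul_mem (mul_mem hf.mem hx) hg.mem
  obtain ⟨c, hc⟩ := hg.scalar (star x * f * x) (mul_mem (mul_mem (star_mem hx) hf.mem) hx)
  have hyy : star y * y = c • g := by
    rw [← hc, hy, star_mul, star_mul, hf.star_eq, hg.star_eq]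
    calc g * (star x * f) * (f * x * g) = g * (star x * (f * f) * x) * g := by noncomm_ring
      _ = _ := by rw [hf.mul_self]
  have hyy0 : star y * y ≠ 0 := fun h => h0 ((CStarRing.star_mul_self_eq_zero_iff y).1 h)
  have hcs : star c = c := by
    have h1 : star (star y * y) = star y * y := by simp
    rw [hyy, star_smul, hg.star_eq] at h1
    exact smul_left_injective ℂ hg.ne_zero h1
  obtain ⟨r, rfl⟩ : ∃ r : ℝ, (r : ℂ) = c := Complex.conj_eq_iff_real.1 hcs |>.imp fun _ h => h.symm
  have hr : 0 < r := by
    by_contra! hr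
    have h1 : 0 ≤ star y * y := star_mul_self_nonneg y
    have h2 : 0 ≤ star ((√(-r) : ℂ) • g) * ((√(-r) : ℂ) • g) := star_mul_self_nonneg _
    have h3 : star ((√(-r) : ℂ) • g) * ((√(-r) : ℂ) • g) = - (star y * y) := by
      rw [hyy, star_smul, hg.star_eq, smul_mul_smul_comm, hg.mul_self]
      have : star (√(-r) : ℂ) * (√(-r) : ℂ) = ((-r : ℝ) : ℂ) := by
        rw [Complex.star_def, Complex.conj_ofReal, ← Complex.ofReal_mul,
          Real.mul_self_sqrt (by linarith)]
      rw [this]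
      simp
    rw [h3] at h2
    exact hyy0 (le_antisymm (neg_nonneg.1 h2) h1)
  set w := ((√r)⁻¹ : ℂ) • y with hw
  have hwF : w ∈ F := SMulMemClass.smul_mem _ hyF
  have hww : star w * w = g := by
    rw [hw, star_smul, smul_mul_smul_comm, hyy, smul_smul]
    have : star ((√r)⁻¹ : ℂ) * ((√r)⁻¹ : ℂ) * (r : ℂ) = 1 := by
      rw [star_inv₀, Complex.star_def, Complex.conj_ofReal, ← mul_inv, ← Complex.ofReal_mul,
        Real.mul_self_sqrt hr.le, ← Complex.ofReal_inv, ← Complex.ofReal_mul, inv_mul_cancel₀ hr.ne',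
        Complex.ofReal_one]
    rw [this, one_smul]
  have hwg : w * g = w := mul_star_mul_self_of_isProjection hww hg.mul_self
  have hfw : f * w = w := by
    rw [hw, mul_smul_comm, hy, ← mul_assoc, ← mul_assoc, hf.mul_self]
  have hwf : star w * f = star w := by
    have := congrArg star hfw
    rwa [star_mul, hf.star_eq] at this
  refine ⟨w, hwF, hww, ?_⟩
  obtain ⟨d, hd⟩ := hf.scalar (w * star w) (mul_mem hwF (star_mem hwF))
  have hd' : w * star w = d • f := by
    rw [← hd, ← mul_assoc, hfw, mul_assoc, hwf]
  have hidem : (w * star w) * (w * star w) = w * star w := by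
    calc (w * star w) * (w * star w) = w * (star w * w) * star w := by noncomm_ring
      _ = _ := by rw [hww, hwg]
  have hd0 : d ≠ 0 := by
    rintro rfl
    rw [zero_smul] at hd'
    have hw0 := (CStarRing.mul_star_self_eq_zero_iff w).1 hd'
    exact hg.ne_zero (by rw [← hww, hw0, mul_zero])
  rw [hd', smul_mul_smul_comm, hf.mul_self] at hidem
  have hdd : d * d = d := smul_left_injective ℂ hf.ne_zero hidem
  rw [hd', mul_left_cancel₀ hd0 (hdd.trans (mul_one d).symm), one_smul]

end MinimalProjection

/-! ### Towers of matrix units with slack at most one -/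

/-- A finite-dimensional C*-subalgebra of `A` with chosen nonzero matrix units: `p` summands, the
`i`-th of them being a matrix algebra of size `size i`. -/
structure MatrixSystem (A : Type*) [NonUnitalCStarAlgebra A] where
  p : ℕ
  size : Fin p → ℕ
  size_pos : ∀ i, 0 < size i
  e : ∀ i, Fin (size i) → Fin (size i) → A
  isMatrixUnits : IsMatrixUnits e
  ne_zero : ∀ i a, e i a a ≠ 0

namespace MatrixSystem

variable {A : Type*} [NonUnitalCStarAlgebra A]

/-- The C*-subalgebra spanned by the matrix units. -/
def toSubalgebra (s : MatrixSystem A) : NonUnitalStarSubalgebra ℂ A :=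
  NonUnitalStarAlgHom.range s.isMatrixUnits.hom

theorem mem_toSubalgebra (s : MatrixSystem A) (i : Fin s.p) (a b : Fin (s.size i)) :
    s.e i a b ∈ s.toSubalgebra := by
  rw [← s.isMatrixUnits.hom_single]
  exact NonUnitalStarAlgHom.mem_range_self _ _

theorem toSubalgebra_le (s : MatrixSystem A) {F : NonUnitalStarSubalgebra ℂ A}
    (h : ∀ i a b, s.e i a b ∈ F) : s.toSubalgebra ≤ F := by
  rintro _ ⟨M, rfl⟩
  exact s.isMatrixUnits.mem_of_forall_mem h M

instance (s : MatrixSystem A) : FiniteDimensional ℂ s.toSubalgebra :=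
  Module.Finite.of_surjective
    ({ toFun := fun M => ⟨s.isMatrixUnits.hom M, NonUnitalStarAlgHom.mem_range_self _ M⟩
       map_add' := fun M N => Subtype.ext (map_add s.isMatrixUnits.hom M N)
       map_smul' := fun c M => Subtype.ext (map_smul s.isMatrixUnits.hom c M) } :
        (∀ i, Matrix (Fin (s.size i)) (Fin (s.size i)) ℂ) →ₗ[ℂ] s.toSubalgebra)
    (by rintro ⟨_, M, rfl⟩; exact ⟨M, rfl⟩)

/-- The system `s` embeds block-diagonally into the system `s'`, which has at most one diagonal
matrix unit in each summand that does not come from `s`. For `t : Fin (mult i j)`, the index map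
`emb i j t` describes one copy of the `j`-th summand of `s` inside the `i`-th summand of `s'`. -/
structure Refinement (s s' : MatrixSystem A) where
  mult : Fin s'.p → Fin s.p → ℕ
  emb : ∀ i j, Fin (mult i j) → Fin (s.size j) → Fin (s'.size i)
  emb_injective : ∀ i, Function.Injective
    fun x : Σ j, Fin (mult i j) × Fin (s.size j) => emb i x.1 x.2.1 x.2.2
  compl_subsingleton : ∀ i c c', (∀ j t a, emb i j t a ≠ c) → (∀ j t a, emb i j t a ≠ c') → c = c'
  sum_eq : ∀ j a b, s.e j a b = ∑ i, ∑ t, s'.e i (emb i j t a) (emb i j t b)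

theorem Refinement.toSubalgebra_le {s s' : MatrixSystem A} (R : Refinement s s') :
    s.toSubalgebra ≤ s'.toSubalgebra :=
  s.toSubalgebra_le fun i a b => by
    rw [R.sum_eq]
    exact sum_mem fun j _ => sum_mem fun t _ => s'.mem_toSubalgebra _ _ _

/-- The corner of `F` cut down by the unit of the system `s` lies in the span of `s`. -/
def IsCornerOf (s : MatrixSystem A) (F : NonUnitalStarSubalgebra ℂ A) : Prop :=
  (∀ i a b, s.e i a b ∈ F) ∧
    ∀ x ∈ F, ∀ i a j b, s.e i a a * x * s.e j b b ∈ s.toSubalgebra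

/-- Let the system `s` lie in a finite-dimensional C*-algebra `F`. Decomposing the diagonal matrix
units of `s` into minimal projections of `F` refines `s` to matrix units of a corner of `F`.
The type `X` with at most one element allows one further minimal projection `f` of `F`, orthogonal
to `s`, to be included in that corner. -/
theorem exists_refinement [PartialOrder A] [StarOrderedRing A] (s : MatrixSystem A)
    {F : NonUnitalStarSubalgebra ℂ A} [FiniteDimensional ℂ F] (hs : ∀ i a b, s.e i a b ∈ F)
    (X : Type) [Finite X] [Subsingleton X] (f : X → A) (hf : ∀ x, IsMinimalProjection F (f x))
    (hsf : ∀ x i a, s.e i a a * f x = 0) :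
    ∃ s' : MatrixSystem A, Nonempty (Refinement s s') ∧ s'.IsCornerOf F ∧
      ∀ x, f x ∈ s'.toSubalgebra := by
  classical
  have := Fintype.ofFinite X
  let b : ∀ j, Fin (s.size j) := fun j => ⟨0, s.size_pos j⟩
  have hdec : ∀ j, ∃ (k : ℕ) (m : Fin k → A), (∀ i, IsMinimalProjection F (m i)) ∧
      (∀ i j, i ≠ j → m i * m j = 0) ∧ ∑ i, m i = s.e j (b j) (b j) := fun j =>
    exists_sum_isMinimalProjection (hs j _ _) (s.isMatrixUnits.star_eq _ _ _)
      (by rw [s.isMatrixUnits.mul_same, if_pos rfl])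
  choose k m hm hmort hmsum using hdec
  have hem : ∀ j t, s.e j (b j) (b j) * m j t = m j t := by
    intro j t
    rw [← hmsum, Finset.sum_mul, Finset.sum_eq_single t (fun i _ hi => hmort j i t hi) (by simp),
      (hm j t).mul_self]
  have hme : ∀ j t, m j t * s.e j (b j) (b j) = m j t := by
    intro j t
    have := congrArg star (hem j t)
    rwa [star_mul, (hm j t).star_eq, s.isMatrixUnits.star_eq] at this
  -- `g` lists the chosen minimal projections
  let T := (Σ j, Fin (k j)) ⊕ X
  let g : T → A := Sum.elim (fun t => m t.1 t.2) f
  have hg : ∀ τ, IsMinimalProjection F (g τ) := by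
    rintro (t | x)
    · exact hm t.1 t.2
    · exact hf x
  let r : Setoid T :=
    { r := fun τ τ' => ∃ w ∈ F, star w * w = g τ' ∧ w * star w = g τ
      iseqv :=
        { refl := fun τ => ⟨g τ, (hg τ).mem, by rw [(hg τ).star_eq, (hg τ).mul_self],
            by rw [(hg τ).star_eq, (hg τ).mul_self]⟩
          symm := by
            rintro τ τ' ⟨w, hw, h1, h2⟩
            exact ⟨star w, star_mem hw, by rwa [star_star], by rwa [star_star]⟩
          trans := by
            rintro τ τ' τ'' ⟨w, hw, h1, h2⟩ ⟨w', hw', h1', h2'⟩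
            have h3 : w * g τ' = w := mul_star_mul_self_of_isProjection h1 (hg τ').mul_self
            have h4 : star w' * g τ' = star w' :=
              mul_star_mul_self_of_isProjection (by rwa [star_star]) (hg τ').mul_self
            refine ⟨w * w', mul_mem hw hw', ?_, ?_⟩
            · calc star (w * w') * (w * w') = star w' * (star w * w) * w' := by
                    rw [star_mul]; noncomm_ring
                _ = _ := by rw [h1, h4, h1']
            · calc w * w' * star (w * w') = w * (w' * star w') * star w := by
                    rw [star_mul]; noncomm_ring
                _ = _ := by rw [h2', h3, h2] } }
  let κ := Quotient r
  have : Fintype κ := Fintype.ofFinite κ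
  let cls : T → κ := Quotient.mk r
  let g₀ : κ → A := fun q => g q.out
  have hg₀ : ∀ q, IsMinimalProjection F (g₀ q) := fun q => hg _
  have hw : ∀ τ, ∃ w ∈ F, star w * w = g₀ (cls τ) ∧ w * star w = g τ := fun τ =>
    r.symm (Quotient.mk_out τ)
  choose w hwF hw1 hw2 using hw
  have hgw : ∀ τ, g τ * w τ = w τ := by
    intro τ
    have := mul_star_mul_self_of_isProjection (w := star (w τ)) (by rw [star_star, hw2])
      (hg τ).mul_self
    have := congrArg star this
    rwa [star_mul, star_star, (hg τ).star_eq] at this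
  have hort : ∀ q q' : κ, q ≠ q' → ∀ x ∈ F, g₀ q * x * g₀ q' = 0 := by
    intro q q' hqq x hx
    by_contra h
    obtain ⟨v, hv, hv1, hv2⟩ := (hg₀ q).exists_partialIsometry (hg₀ q') hx h
    exact hqq (Quotient.out_equiv_out.1 ⟨v, hv, hv1, hv2⟩)
  -- the new indices: the translates of the minimal projections below `s`, and `f`
  let ι := (Σ t : (Σ j, Fin (k j)), Fin (s.size t.1)) ⊕ X
  let base : ι → T := Sum.map (fun c => c.1) id
  let u : ι → A := Sum.elim (fun c => s.e c.1.1 c.2 (b c.1.1) * w (Sum.inl c.1))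
    (fun x => w (Sum.inr x))
  have huF : ∀ c, u c ∈ F := by
    rintro (c | x)
    · exact mul_mem (hs _ _ _) (hwF _)
    · exact hwF _
  have hegw : ∀ j t, s.e j (b j) (b j) * w (Sum.inl ⟨j, t⟩) = w (Sum.inl ⟨j, t⟩) := by
    intro j t
    rw [← hgw (Sum.inl ⟨j, t⟩), ← mul_assoc]
    exact congrArg (· * _) (hem j t)
  have hu1 : ∀ c, star (u c) * u c = g₀ (cls (base c)) := by
    rintro (⟨⟨j, t⟩, a⟩ | x)
    · calc star (s.e j a (b j) * w (Sum.inl ⟨j, t⟩)) * (s.e j a (b j) * w (Sum.inl ⟨j, t⟩))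
          = star (w (Sum.inl ⟨j, t⟩)) * (star (s.e j a (b j)) * s.e j a (b j) *
            w (Sum.inl ⟨j, t⟩)) := by rw [star_mul]; noncomm_ring
        _ = _ := by
          rw [s.isMatrixUnits.star_eq, s.isMatrixUnits.mul_same, if_pos rfl, hegw, hw1]
          rfl
    · exact hw1 _
  have hu0 : ∀ c d, c ≠ d → star (u c) * u d = 0 := by
    have hsw : ∀ x i a, s.e i a a * w (Sum.inr x) = 0 := by
      intro x i a
      rw [← hgw (Sum.inr x), ← mul_assoc]
      exact (congrArg (· * _) (hsf x i a)).trans (zero_mul _)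
    have hmix : ∀ c x, star (u (Sum.inl c)) * u (Sum.inr x) = 0 := by
      rintro ⟨⟨j, t⟩, a⟩ x
      change star (s.e j a (b j) * w (Sum.inl ⟨j, t⟩)) * w (Sum.inr x) = 0
      have : s.e j (b j) a = s.e j (b j) a * s.e j a a := by
        rw [s.isMatrixUnits.mul_same, if_pos rfl]
      rw [star_mul, s.isMatrixUnits.star_eq, this, mul_assoc, mul_assoc, hsw, mul_zero, mul_zero]
    rintro (⟨⟨j, t⟩, a⟩ | x) (⟨⟨j', t'⟩, a'⟩ | x') hcd
    · change star (s.e j a (b j) * w (Sum.inl ⟨j, t⟩)) *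
        (s.e j' a' (b j') * w (Sum.inl ⟨j', t'⟩)) = 0
      have h1 : star (s.e j a (b j) * w (Sum.inl ⟨j, t⟩)) *
          (s.e j' a' (b j') * w (Sum.inl ⟨j', t'⟩)) = star (w (Sum.inl ⟨j, t⟩)) *
          (s.e j (b j) a * s.e j' a' (b j') * w (Sum.inl ⟨j', t'⟩)) := by
        rw [star_mul, s.isMatrixUnits.star_eq]; noncomm_ring
      rw [h1]
      by_cases hj : j = j'
      · subst hj
        rw [s.isMatrixUnits.mul_same]
        split_ifs with ha
        · subst ha
          have ht : t ≠ t' := by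
            rintro rfl
            exact hcd rfl
          have h2 := congrArg star (hgw (Sum.inl ⟨j, t⟩))
          rw [star_mul] at h2
          rw [hegw, ← hgw (Sum.inl ⟨j, t'⟩), ← h2, mul_assoc, ← mul_assoc (star (g _)),
            (hg _).star_eq]
          have h3 : g (Sum.inl ⟨j, t⟩) * g (Sum.inl ⟨j, t'⟩) = 0 := hmort j t t' ht
          rw [h3, zero_mul, mul_zero]
        · rw [zero_mul, mul_zero]
      · rw [s.isMatrixUnits.mul_ne _ _ _ _ _ _ hj, zero_mul, mul_zero]
    · exact hmix _ _
    · have := congrArg star (hmix ⟨⟨j', t'⟩, a'⟩ x)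
      rwa [star_mul, star_star, star_zero] at this
    · exact absurd (congrArg Sum.inr (Subsingleton.elim x x')) hcd
  have hug : ∀ c, u c * g₀ (cls (base c)) = u c := fun c =>
    mul_star_mul_self_of_isProjection (hu1 c) (hg₀ _).mul_self
  have hgu : ∀ c, g₀ (cls (base c)) * star (u c) = star (u c) := by
    intro c
    have := congrArg star (hug c)
    rwa [star_mul, (hg₀ _).star_eq] at this
  have hune : ∀ c, u c * star (u c) ≠ 0 := by
    intro c h
    have h1 := (CStarRing.mul_star_self_eq_zero_iff _).1 h
    have h2 := hu1 c
    rw [h1, mul_zero] at h2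
    exact (hg₀ _).ne_zero h2.symm
  have huu : ∀ c d d' c', u c * star (u d) * (u d' * star (u c')) =
      if d = d' then u c * g₀ (cls (base d)) * star (u c') else 0 := by
    intro c d d' c'
    have : u c * star (u d) * (u d' * star (u c')) = u c * (star (u d) * u d') * star (u c') := by
      noncomm_ring
    rw [this]
    split_ifs with h
    · subst h
      rw [hu1]
    · rw [hu0 _ _ h, mul_zero, zero_mul]
  -- numbering of the classes, and of the indices in a class
  let eκ : Fin (Fintype.card κ) ≃ κ := (Fintype.equivFin κ).symm
  let φ : ∀ i, Fin (Fintype.card {c : ι // cls (base c) = eκ i}) ≃ {c : ι // cls (base c) = eκ i} :=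
    fun i => (Fintype.equivFin _).symm
  let e' : ∀ i, Fin (Fintype.card {c : ι // cls (base c) = eκ i}) →
      Fin (Fintype.card {c : ι // cls (base c) = eκ i}) → A :=
    fun i c d => u (φ i c) * star (u (φ i d))
  have hMU : IsMatrixUnits e' :=
    { star_eq := fun i c d => by simp [e']
      mul_same := fun i c d d' c' => by
        simp only [e']
        rw [huu, (φ i d).2]
        have : ((φ i d : ι) = φ i d') ↔ d = d' := by
          rw [Subtype.coe_inj, (φ i).injective.eq_iff]
        simp only [this]
        split_ifs
        · have h := hug (φ i c)
          rw [(φ i c).2] at h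
          rw [h]
        · rfl
      mul_ne := fun i j c d d' c' hij => by
        simp only [e']
        rw [huu, if_neg]
        intro h
        apply hij
        apply eκ.injective
        rw [← (φ i d).2, ← (φ j d').2, h] }
  let s' : MatrixSystem A :=
    { p := Fintype.card κ
      size := fun i => Fintype.card {c : ι // cls (base c) = eκ i}
      size_pos := by
        intro i
        rw [Fintype.card_pos_iff]
        obtain ⟨τ, hτ⟩ := Quotient.exists_rep (eκ i)
        rcases τ with ⟨j, t⟩ | x
        · exact ⟨⟨Sum.inl ⟨⟨j, t⟩, b j⟩, hτ⟩⟩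
        · exact ⟨⟨Sum.inr x, hτ⟩⟩
      e := e'
      isMatrixUnits := hMU
      ne_zero := fun i c => hune _ }
  have he' : ∀ c d, cls (base c) = cls (base d) → u c * star (u d) ∈ s'.toSubalgebra := by
    intro c d hcd
    obtain ⟨i, hi⟩ := eκ.surjective (cls (base c))
    have h1 := s'.mem_toSubalgebra i ((φ i).symm ⟨c, hi.symm⟩) ((φ i).symm ⟨d, hcd ▸ hi.symm⟩)
    have h2 : s'.e i ((φ i).symm ⟨c, hi.symm⟩) ((φ i).symm ⟨d, hcd ▸ hi.symm⟩) =
        u c * star (u d) := by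
      change u _ * star (u _) = _
      rw [Equiv.apply_symm_apply, Equiv.apply_symm_apply]
    rwa [h2] at h1
  refine ⟨s', ⟨?_⟩, ⟨fun i c d => mul_mem (huF _) (star_mem (huF _)), ?_⟩, ?_⟩
  · let ψ : ∀ i j, Fin (Fintype.card {t : Fin (k j) // cls (Sum.inl ⟨j, t⟩) = eκ i}) ≃
      {t : Fin (k j) // cls (Sum.inl ⟨j, t⟩) = eκ i} := fun i j => (Fintype.equivFin _).symm
    refine
      { mult := fun i j => Fintype.card {t : Fin (k j) // cls (Sum.inl ⟨j, t⟩) = eκ i}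
        emb := fun i j t a => (φ i).symm ⟨Sum.inl ⟨⟨j, ψ i j t⟩, a⟩, (ψ i j t).2⟩
        emb_injective := ?_
        compl_subsingleton := ?_
        sum_eq := ?_ }
    · rintro i ⟨j, t, a⟩ ⟨j', t', a'⟩ h
      have h1 := congrArg Subtype.val ((φ i).symm.injective h)
      obtain ⟨h2, h3⟩ := Sigma.mk.inj_iff.1 (Sum.inl_injective h1)
      obtain ⟨h4, h5⟩ := Sigma.mk.inj_iff.1 h2
      dsimp only at h4
      subst h4
      obtain rfl := (ψ i j).injective (Subtype.ext (eq_of_heq h5))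
      obtain rfl := eq_of_heq h3
      rfl
    · have hc : ∀ i c, (∀ j t a, (φ i).symm ⟨Sum.inl ⟨⟨j, ψ i j t⟩, a⟩, (ψ i j t).2⟩ ≠ c) →
          ∃ x, (φ i c : ι) = Sum.inr x := by
        intro i c hc
        rcases h : φ i c with ⟨⟨⟨j, t⟩, a⟩ | x, hx⟩
        · refine absurd ?_ (hc j ((ψ i j).symm ⟨t, hx⟩) a)
          rw [Equiv.symm_apply_eq, h]
          congr 4
          rw [Equiv.apply_symm_apply]
        · exact ⟨x, rfl⟩
      intro i c c' h h'
      obtain ⟨x, hx⟩ := hc i c h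
      obtain ⟨x', hx'⟩ := hc i c' h'
      apply (φ i).injective
      apply Subtype.ext
      rw [hx, hx', Subsingleton.elim x x']
    · intro j a a'
      have h1 : ∀ i (t : Fin (Fintype.card {t : Fin (k j) // cls (Sum.inl ⟨j, t⟩) = eκ i})),
          s'.e i ((φ i).symm ⟨Sum.inl ⟨⟨j, ψ i j t⟩, a⟩, (ψ i j t).2⟩)
            ((φ i).symm ⟨Sum.inl ⟨⟨j, ψ i j t⟩, a'⟩, (ψ i j t).2⟩) =
          s.e j a (b j) * m j (ψ i j t) * s.e j (b j) a' := by
        intro i t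
        change u _ * star (u _) = _
        rw [Equiv.apply_symm_apply, Equiv.apply_symm_apply]
        change (s.e j a (b j) * w _) * star (s.e j a' (b j) * w _) = _
        have h2 : w (Sum.inl ⟨j, ψ i j t⟩) * star (w (Sum.inl ⟨j, ψ i j t⟩)) = m j (ψ i j t) :=
          hw2 _
        rw [← h2, star_mul, s.isMatrixUnits.star_eq]
        noncomm_ring
      simp only [h1]
      have h2 : ∀ i, ∑ t, s.e j a (b j) * m j (ψ i j t) * s.e j (b j) a' =
          ∑ t : {t : Fin (k j) // cls (Sum.inl ⟨j, t⟩) = eκ i},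
            s.e j a (b j) * m j t * s.e j (b j) a' := fun i =>
        Equiv.sum_comp (ψ i j) fun t => s.e j a (b j) * m j t * s.e j (b j) a'
      simp only [h2]
      have h3 : ∑ i, ∑ t : {t : Fin (k j) // cls (Sum.inl ⟨j, t⟩) = eκ i},
            s.e j a (b j) * m j t * s.e j (b j) a' =
          ∑ q, ∑ t : {t : Fin (k j) // cls (Sum.inl ⟨j, t⟩) = q},
            s.e j a (b j) * m j t * s.e j (b j) a' :=
        Equiv.sum_comp eκ fun q => ∑ t : {t : Fin (k j) // cls (Sum.inl ⟨j, t⟩) = q},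
            s.e j a (b j) * m j t * s.e j (b j) a'
      refine Eq.trans ?_ h3.symm
      rw [Fintype.sum_fiberwise (fun t => cls (Sum.inl ⟨j, t⟩))
        (fun t => s.e j a (b j) * m j t * s.e j (b j) a'), ← Finset.sum_mul, ← Finset.mul_sum, hmsum]
      simp [s.isMatrixUnits.mul_same]
  · intro x hx i c j d
    change u (φ i c) * star (u (φ i c)) * x * (u (φ j d) * star (u (φ j d))) ∈ _
    have h1 : ∀ c d, u c * star (u c) * x * (u d * star (u d)) =
        u c * (g₀ (cls (base c)) * (star (u c) * x * u d) * g₀ (cls (base d))) * star (u d) := by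
      intro c d
      calc _ = u c * (star (u c) * x * u d) * star (u d) := by noncomm_ring
        _ = u c * ((g₀ (cls (base c)) * star (u c)) * x * (u d * g₀ (cls (base d)))) *
            star (u d) := by rw [hgu, hug]
        _ = _ := by noncomm_ring
    rw [h1]
    have hF : star (u (φ i c)) * x * u (φ j d) ∈ F :=
      mul_mem (mul_mem (star_mem (huF _)) hx) (huF _)
    by_cases hcd : cls (base (φ i c)) = cls (base (φ j d))
    · obtain ⟨z, hz⟩ := (hg₀ (cls (base (φ i c)))).scalar _ hF
      rw [← hcd, hz, mul_smul_comm, hug, smul_mul_assoc]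
      exact SMulMemClass.smul_mem _ (he' _ _ hcd)
    · rw [hort _ _ hcd _ hF, mul_zero, zero_mul]
      exact zero_mem _
  · intro x
    have := he' (Sum.inr x) (Sum.inr x) rfl
    change w (Sum.inr x) * star (w (Sum.inr x)) ∈ _ at this
    rwa [hw2] at this

end MatrixSystem

namespace MatrixSystem

variable {A : Type u} [NonUnitalCStarAlgebra A]

/-- The unit of the C*-subalgebra spanned by the matrix units. -/
def unit (s : MatrixSystem A) : A := s.isMatrixUnits.hom 1

theorem unit_eq_sum (s : MatrixSystem A) : s.unit = ∑ i, ∑ a, s.e i a a := by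
  rw [unit, IsMatrixUnits.hom_apply]
  refine Finset.sum_congr rfl fun i _ => Finset.sum_congr rfl fun a _ => ?_
  simp [Matrix.one_apply]

theorem unit_mul_of_mem (s : MatrixSystem A) {x : A} (hx : x ∈ s.toSubalgebra) :
    s.unit * x = x := by
  obtain ⟨M, rfl⟩ := hx
  exact (map_mul s.isMatrixUnits.hom 1 M).symm.trans (by rw [one_mul]; rfl)

theorem unit_mem (s : MatrixSystem A) : s.unit ∈ s.toSubalgebra :=
  NonUnitalStarAlgHom.mem_range_self _ _

theorem star_unit (s : MatrixSystem A) : star s.unit = s.unit := by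
  rw [unit, ← map_star, star_one]

theorem diag_mul_unit (s : MatrixSystem A) (i : Fin s.p) (a : Fin (s.size i)) :
    s.e i a a * s.unit = s.e i a a := by
  have h := s.unit_mul_of_mem (s.mem_toSubalgebra i a a)
  have := congrArg star h
  rwa [star_mul, s.star_unit, s.isMatrixUnits.star_eq] at this

/-- A corner of `F` containing the unit of `F` is all of `F`. -/
theorem IsCornerOf.le_toSubalgebra {s : MatrixSystem A} {F : NonUnitalStarSubalgebra ℂ A}
    (h : s.IsCornerOf F) (h1 : ∀ x ∈ F, s.unit * x = x) : F ≤ s.toSubalgebra := by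
  intro x hx
  have h2 : x * s.unit = x := by
    have := congrArg star (h1 (star x) (star_mem hx))
    rwa [star_mul, star_star, s.star_unit] at this
  rw [← h2, ← h1 x hx, unit_eq_sum]
  simp only [Finset.sum_mul, Finset.mul_sum]
  exact sum_mem fun i _ => sum_mem fun a _ => sum_mem fun j _ => sum_mem fun b _ => h.2 x hx _ _ _ _

/-- One step of the interpolation of a tower `F` by matrix units: if `s` already spans everything
in `F m`, it is refined inside `F (m + 1)`; otherwise one minimal projection of `F m` is added. -/
theorem exists_next [PartialOrder A] [StarOrderedRing A] {F : ℕ → NonUnitalStarSubalgebra ℂ A}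
    (hF : IsAFTower F) (s : MatrixSystem A) (m : ℕ) (h : s.IsCornerOf (F m)) :
    ∃ (s' : MatrixSystem A) (m' : ℕ), s'.IsCornerOf (F m') ∧ Nonempty (Refinement s s') ∧
      ((m' = m + 1 ∧ F m ≤ s.toSubalgebra) ∨
        (m' = m ∧ s.toSubalgebra < s'.toSubalgebra)) := by
  have hfd := hF.finite_dim
  by_cases hle : F m ≤ s.toSubalgebra
  · obtain ⟨s', hR, hC, -⟩ := s.exists_refinement (F := F (m + 1))
      (fun i a b => hF.mono (Nat.le_succ m) (h.1 i a b)) Empty Empty.elim (fun x => x.elim)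
      (fun x => x.elim)
    exact ⟨s', m + 1, hC, hR, Or.inl ⟨rfl, hle⟩⟩
  · obtain ⟨x, hx, hpx⟩ : ∃ x ∈ F m, s.unit * x ≠ x := by
      by_contra! hcon
      exact hle (h.le_toSubalgebra hcon)
    have hpF : s.unit ∈ F m := s.toSubalgebra_le h.1 s.unit_mem
    have hR₀ : IsRightIdealOf (F m)
        ((F m).toSubmodule ⊓ (LinearMap.mulLeft ℂ s.unit).ker) :=
      { mem := fun r hr => hr.1
        mul_mem_right := by
          rintro r ⟨hr, hr'⟩ y hy
          refine ⟨(mul_mem (show r ∈ F m from hr) hy : r * y ∈ F m), ?_⟩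
          simp only [SetLike.mem_coe, LinearMap.mem_ker, LinearMap.mulLeft_apply] at hr' ⊢
          rw [← mul_assoc, hr', zero_mul] }
    obtain ⟨f, hf, hfmin⟩ := hR₀.exists_isMinimalProjection <| by
      rw [Submodule.ne_bot_iff]
      refine ⟨x - s.unit * x, ⟨(sub_mem hx (mul_mem hpF hx) : _ ∈ F m), ?_⟩,
        sub_ne_zero.2 hpx.symm⟩
      simp [mul_sub, ← mul_assoc, s.unit_mul_of_mem s.unit_mem]
    have hpf : s.unit * f = 0 := hf.2
    obtain ⟨s', hR, hC, hfs⟩ := s.exists_refinement h.1 Unit (fun _ => f) (fun _ => hfmin)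
      (fun _ i a => by rw [← s.diag_mul_unit, mul_assoc, hpf, mul_zero])
    refine ⟨s', m, hC, hR, Or.inr ⟨rfl, lt_of_le_not_ge hR.some.toSubalgebra_le fun hge => ?_⟩⟩
    refine hfmin.ne_zero ?_
    rw [← s.unit_mul_of_mem (hge (hfs ())), hpf]

/-- The empty system of matrix units. -/
def empty (A : Type u) [NonUnitalCStarAlgebra A] : MatrixSystem A where
  p := 0
  size := Fin.elim0
  size_pos i := i.elim0
  e i := i.elim0
  isMatrixUnits := ⟨fun i => i.elim0, fun i => i.elim0, fun i => i.elim0⟩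
  ne_zero i := i.elim0

/-- An AF-algebra has a tower of matrix units starting from the zero algebra, in which the
successive embeddings are block-diagonal with slack at most one. -/
theorem exists_tower [PartialOrder A] [StarOrderedRing A] (hA : IsAFAlgebra A) :
    ∃ s : ℕ → MatrixSystem A, (s 0).p = 0 ∧ Nonempty (∀ n, Refinement (s n) (s (n + 1))) ∧
      IsAFTower fun n => (s n).toSubalgebra := by
  obtain ⟨F, hF⟩ := hA
  have hfd := hF.finite_dim
  let σ := {x : MatrixSystem A × ℕ // x.1.IsCornerOf (F x.2)}
  have hnext : ∀ x : σ, ∃ y : σ, Nonempty (Refinement x.1.1 y.1.1) ∧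
      ((y.1.2 = x.1.2 + 1 ∧ F x.1.2 ≤ x.1.1.toSubalgebra) ∨
        (y.1.2 = x.1.2 ∧ x.1.1.toSubalgebra < y.1.1.toSubalgebra)) := fun x => by
    obtain ⟨s', m', h1, h2, h3⟩ := exists_next hF x.1.1 x.1.2 x.2
    exact ⟨⟨(s', m'), h1⟩, h2, h3⟩
  choose next hR hcase using hnext
  let q : ℕ → σ := fun n => Nat.rec ⟨(empty A, 0), fun i => i.elim0, fun x _ i => i.elim0⟩
    (fun _ => next) n
  have hq : ∀ n, q (n + 1) = next (q n) := fun n => rfl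
  have hmono : Monotone fun n => (q n).1.1.toSubalgebra :=
    monotone_nat_of_le_succ fun n => (hR (q n)).some.toSubalgebra_le
  -- every `F m` is eventually exhausted, since dimensions cannot grow forever inside `F m`
  have hreach : ∀ m, ∃ n, (q n).1.2 = m := by
    intro m
    induction m with
    | zero => exact ⟨0, rfl⟩
    | succ m ih =>
      obtain ⟨n, hn⟩ := ih
      by_contra! hcon
      have hstay : ∀ k, (q (n + k)).1.2 = m ∧
          k ≤ Module.finrank ℂ (q (n + k)).1.1.toSubalgebra := by
        intro k
        induction k with
        | zero => exact ⟨hn, Nat.zero_le _⟩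
        | succ k ih =>
          rcases hcase (q (n + k)) with h | h
          · exact absurd (h.1.trans (by rw [ih.1])) (hcon (n + k + 1))
          · refine ⟨h.1.trans ih.1, ?_⟩
            have h2 : (q (n + k)).1.1.toSubalgebra.toSubmodule <
                (q (n + (k + 1))).1.1.toSubalgebra.toSubmodule := h.2
            have : FiniteDimensional ℂ (q (n + (k + 1))).1.1.toSubalgebra.toSubmodule :=
              inferInstanceAs (FiniteDimensional ℂ (q (n + (k + 1))).1.1.toSubalgebra)
            exact ih.2.trans_lt (Submodule.finrank_lt_finrank_of_lt h2)
      have hbig := hstay (Module.finrank ℂ (F m) + 1)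
      have hle : (q (n + (Module.finrank ℂ (F m) + 1))).1.1.toSubalgebra.toSubmodule ≤
          (F m).toSubmodule := by
        have h3 := toSubalgebra_le _ (q (n + (Module.finrank ℂ (F m) + 1))).2.1
        rwa [hbig.1] at h3
      have : FiniteDimensional ℂ (F m).toSubmodule := hfd m
      have h4 := Submodule.finrank_mono hle
      have h5 := hbig.2
      change _ ≤ Module.finrank ℂ (F m) at h4
      change _ ≤ Module.finrank ℂ
        (q (n + (Module.finrank ℂ (F m) + 1))).1.1.toSubalgebra.toSubmodule at h5
      omega
  have hcover : ∀ m, ∃ n, F m ≤ (q n).1.1.toSubalgebra := by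
    intro m
    by_contra! hcon
    obtain ⟨n, hn⟩ := hreach m
    obtain ⟨n', hn'⟩ := hreach (m + 1)
    have hstay : ∀ k, (q k).1.2 ≤ m := by
      intro k
      induction k with
      | zero => exact Nat.zero_le _
      | succ k ih =>
        rcases hcase (q k) with h | h
        · rw [hq, h.1]
          rcases ih.lt_or_eq with h' | h'
          · exact h'
          · exact absurd (h' ▸ h.2) (hcon k)
        · rw [hq, h.1]
          exact ih
    have := hstay n'
    omega
  refine ⟨fun n => (q n).1.1, rfl, ⟨fun n => (hR (q n)).some⟩, hmono, fun n => inferInstance, ?_⟩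
  refine hF.dense.mono (Set.iUnion_subset fun m => ?_)
  obtain ⟨n, hn⟩ := hcover m
  exact Set.subset_iUnion_of_subset n hn

end MatrixSystem

/-! ### Finite and infinite paths in graphs with finite levels -/

namespace DirectedGraph

/-- The vertices of the graph `E` are arranged in finite levels, every edge leads to the next
level, every vertex emits finitely many edges, and no vertex is a sink. -/
class Leveled (E : DirectedGraph) where
  lev : E.V → ℕ
  lev_r : ∀ g, lev (E.r g) = lev (E.s g) + 1
  finite_lev : ∀ n, {v | lev v = n}.Finite
  finite_out : ∀ v, {g | E.s g = v}.Finite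
  exists_out : ∀ v, ∃ g, E.s g = v

open Leveled

variable {E : DirectedGraph} {S : Set E.V}

/-- The edges that start at `v`. -/
abbrev Out (E : DirectedGraph) (v : E.V) : Type := {g : E.Edge // E.s g = v}

/-- The finite paths that start in `S` and end at `v`. -/
abbrev PathsTo (S : Set E.V) (v : E.V) : Type := {α : E.FinPath // α.source ∈ S ∧ α.range = v}

/-- The infinite paths that start at `v`. -/
abbrev Tail (E : DirectedGraph) (v : E.V) : Type := {z : E.InfPath // z.source = v}

theorem FinPath.ext {α β : E.FinPath} (h1 : α.source = β.source) (h2 : α.edges = β.edges) :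
    α = β := by
  cases α; cases β; simp_all

theorem InfPath.ext {x y : E.InfPath} (h : ∀ i, x.edge i = y.edge i) : x = y := by
  cases x; cases y; simp only [InfPath.mk.injEq]; exact funext h

namespace FinPath

/-- The path of length zero at `v`. -/
def nil (v : E.V) : E.FinPath := ⟨v, [], by simp, by simp⟩

theorem range_eq_of_length_eq (α : E.FinPath) (i : ℕ) (h : i < α.edges.length)
    (hi : i + 1 = α.edges.length) : α.range = E.r α.edges[i] := by
  have : α.edges.getLast? = some α.edges[i] := by
    rw [List.getLast?_eq_getElem?, List.getElem?_eq_getElem (by omega)]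
    congr 2
    omega
  simp [range, this]

theorem range_eq_of_edges_eq_nil (α : E.FinPath) (h : α.edges = []) : α.range = α.source := by
  simp [range, h]

/-- The path `α` followed by the edge `g`. -/
def snoc (α : E.FinPath) (g : E.Edge) (h : E.s g = α.range) : E.FinPath where
  source := α.source
  edges := α.edges ++ [g]
  chain := by
    rw [List.isChain_append]
    refine ⟨α.chain, by simp, ?_⟩
    intro e he f hf
    simp only [List.head?_cons, Option.mem_def, Option.some.injEq] at hf
    subst hf
    rw [Option.mem_def] at he
    rw [h, range, he]
    rfl
  source_eq := by
    intro e he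
    rcases hα : α.edges with _ | ⟨a, l⟩
    · rw [hα] at he
      simp only [List.nil_append, List.head?_cons, Option.mem_def, Option.some.injEq] at he
      subst he
      rw [h, range_eq_of_edges_eq_nil α hα]
    · rw [hα] at he
      exact α.source_eq e (by rw [hα]; simpa using he)

@[simp] theorem range_snoc (α : E.FinPath) (g : E.Edge) (h : E.s g = α.range) :
    (α.snoc g h).range = E.r g := by
  simp [range, snoc]

@[elab_as_elim]
theorem snoc_induction {motive : E.FinPath → Prop} (nil : ∀ v, motive (nil v))
    (snoc : ∀ α g h, motive α → motive (snoc α g h)) (α : E.FinPath) : motive α := by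
  obtain ⟨n, hn⟩ : ∃ n, α.edges.length = n := ⟨_, rfl⟩
  induction n generalizing α with
  | zero =>
    have : α = FinPath.nil α.source := FinPath.ext rfl (List.length_eq_zero_iff.1 hn)
    rw [this]
    exact nil _
  | succ n ih =>
    have hne : α.edges ≠ [] := by
      rintro h
      simp [h] at hn
    have hsplit := List.dropLast_append_getLast hne
    have hch := α.chain
    rw [← hsplit, List.isChain_append] at hch
    let β : E.FinPath := ⟨α.source, α.edges.dropLast, hch.1, fun e he => by
      refine α.source_eq e ?_
      rw [← hsplit]
      rcases h : α.edges.dropLast with _ | ⟨a, l⟩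
      · simp [h] at he
      · simpa [h] using he⟩
    have hβ : E.s (α.edges.getLast hne) = β.range := by
      rcases h : α.edges.dropLast with _ | ⟨a, l⟩
      · rw [range_eq_of_edges_eq_nil β h]
        refine α.source_eq _ ?_
        have h5 : α.edges = [α.edges.getLast hne] := by
          rw [h, List.nil_append] at hsplit
          exact hsplit.symm
        generalize α.edges.getLast hne = a at h5 ⊢
        rw [h5]
        rfl
      · have h1 : β.edges ≠ [] := by simp [β, h]
        have h2 : β.edges.getLast? = some (β.edges.getLast h1) := List.getLast?_eq_getLast_of_ne_nil h1
        rw [range, h2]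
        exact (hch.2.2 _ h2 _ (by simp)).symm
    have : α = FinPath.snoc β (α.edges.getLast hne) hβ := FinPath.ext rfl hsplit.symm
    rw [this]
    refine snoc _ _ _ (ih β ?_)
    simp [β, hn]

variable [Leveled E]

theorem lev_range (α : E.FinPath) : lev α.range = lev α.source + α.length := by
  induction α using snoc_induction with
  | nil v => rfl
  | snoc α g h ih =>
    rw [range_snoc, lev_r, h, ih]
    simp [snoc, length]
    omega

theorem finite_lev_range (n : ℕ) : {α : E.FinPath | lev α.range = n}.Finite := by
  have hnil : ∀ n, (nil '' {v : E.V | lev v = n}).Finite := fun n => (finite_lev n).image _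
  induction n with
  | zero =>
    refine (hnil 0).subset fun α hα => ?_
    induction α using snoc_induction with
    | nil v => exact ⟨v, hα, rfl⟩
    | snoc α g h _ =>
      rw [Set.mem_ofPred_eq, range_snoc, lev_r] at hα
      omega
  | succ n ih =>
    have h2 : (⋃ α ∈ {α : E.FinPath | lev α.range = n},
        Set.range fun g : {g | E.s g = α.range} => α.snoc g.1 g.2).Finite :=
      ih.biUnion fun α _ => by
        have := (finite_out (E := E) α.range).to_subtype
        exact Set.finite_range _
    refine ((hnil (n + 1)).union h2).subset fun α hα => ?_
    induction α using snoc_induction with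
    | nil v => exact Or.inl ⟨v, hα, rfl⟩
    | snoc α g h _ =>
      rw [Set.mem_ofPred_eq, range_snoc, lev_r, h] at hα
      refine Or.inr (Set.mem_biUnion (x := α) (show lev α.range = n by omega) ⟨⟨g, h⟩, rfl⟩)

end FinPath

instance [Leveled E] (v : E.V) : Finite (PathsTo S v) :=
  ((FinPath.finite_lev_range (lev v)).subset
    (show {α : E.FinPath | α.source ∈ S ∧ α.range = v} ⊆ _ from
      fun _ hα => congrArg lev hα.2)).to_subtype

instance [Leveled E] (v : E.V) : Finite (Out E v) := (finite_out v).to_subtype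

instance [Leveled E] (n : ℕ) : Finite {v : E.V // lev v = n} := (finite_lev n).to_subtype

namespace Tail

variable {v : E.V}

/-- The first edge of an infinite path. -/
def head (z : Tail E v) : Out E v := ⟨z.1.edge 0, z.2⟩

/-- The infinite path without its first edge. -/
def tail (z : Tail E v) : Tail E (E.r z.head.1) :=
  ⟨⟨fun i => z.1.edge (i + 1), fun i => z.1.chain (i + 1)⟩, (z.1.chain 0).symm⟩

/-- The infinite path `z` preceded by the edge `g`. -/
def cons (g : Out E v) (z : Tail E (E.r g.1)) : Tail E v :=
  ⟨{ edge := fun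
      | 0 => g.1
      | i + 1 => z.1.edge i
     chain := by
      rintro (_ | i)
      · exact z.2.symm
      · exact z.1.chain i }, g.2⟩

theorem ext_edge {z w : Tail E v} (h : ∀ i, z.1.edge i = w.1.edge i) : z = w :=
  Subtype.ext (InfPath.ext h)

theorem nonempty [Leveled E] (v : E.V) : Nonempty (Tail E v) := by
  choose g hg using exists_out (E := E)
  let w : ℕ → E.V := fun n => Nat.rec v (fun _ x => E.r (g x)) n
  exact ⟨⟨⟨fun n => g (w n), fun n => (hg (w (n + 1))).symm⟩, hg v⟩⟩

/-- A choice of an infinite path starting at `v`. -/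
def some [Leveled E] (v : E.V) : Tail E v := (nonempty v).some

end Tail

namespace PathsTo

variable {v : E.V}

/-- The path of length zero at a vertex of `S`. -/
def nil (h : v ∈ S) : PathsTo S v := ⟨FinPath.nil v, h, rfl⟩

/-- The path `α` followed by the edge `g`. -/
def snoc (α : PathsTo S v) (g : Out E v) : PathsTo S (E.r g.1) :=
  ⟨α.1.snoc g.1 (g.2.trans α.2.2.symm), α.2.1, FinPath.range_snoc _ _ _⟩

theorem snoc_injective (g : Out E v) :
    Function.Injective fun α : PathsTo S v => α.snoc g := by
  intro α β h
  have h1 := congrArg Subtype.val h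
  simp only [snoc, FinPath.snoc, FinPath.mk.injEq, List.append_cancel_right_eq] at h1
  exact Subtype.ext (FinPath.ext h1.1 h1.2)

@[elab_as_elim]
theorem snoc_induction {motive : ∀ v, PathsTo S v → Prop}
    (nil : ∀ v (h : v ∈ S), motive v (nil h))
    (snoc : ∀ v (α : PathsTo S v) (g : Out E v), motive v α → motive (E.r g.1) (snoc α g))
    {v : E.V} (α : PathsTo S v) : motive v α := by
  obtain ⟨α, hα, rfl⟩ := α
  induction α using FinPath.snoc_induction with
  | nil v => exact nil v hα
  | snoc α g h ih =>
    have h1 : ∀ w (hw : w = E.r g), (motive w ⟨α.snoc g h, hα, (FinPath.range_snoc α g h).trans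
        hw.symm⟩) := by
      rintro _ rfl
      exact snoc _ ⟨α, hα, rfl⟩ ⟨g, h⟩ (ih hα)
    exact h1 _ (FinPath.range_snoc α g h)

/-- The infinite path `α z`. -/
def append (α : PathsTo S v) (z : Tail E v) : E.InfPath where
  edge i := if h : i < α.1.edges.length then α.1.edges[i] else z.1.edge (i - α.1.edges.length)
  chain i := by
    rcases lt_trichotomy (i + 1) α.1.edges.length with h | h | h
    · rw [dif_pos (by omega), dif_pos h]
      exact (List.isChain_iff_getElem.1 α.1.chain) i h
    · rw [dif_pos (by omega), dif_neg (by omega),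
        ← FinPath.range_eq_of_length_eq α.1 i (by omega) h, α.2.2, h, Nat.sub_self]
      exact z.2.symm
    · rw [dif_neg (by omega), dif_neg (by omega), z.1.chain]
      congr 2
      omega

theorem append_edge_of_lt (α : PathsTo S v) (z : Tail E v) (i : ℕ) (h : i < α.1.edges.length) :
    (α.append z).edge i = α.1.edges[i] := dif_pos h

theorem append_edge_add (α : PathsTo S v) (z : Tail E v) (i : ℕ) :
    (α.append z).edge (α.1.edges.length + i) = z.1.edge i := by
  refine (dif_neg (by omega)).trans ?_
  congr 1
  omega

@[simp] theorem source_append (α : PathsTo S v) (z : Tail E v) :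
    (α.append z).source = α.1.source := by
  rcases h : α.1.edges with _ | ⟨a, l⟩
  · have h0 : (α.append z).edge 0 = z.1.edge 0 := by
      have := α.append_edge_add z 0
      rwa [h] at this
    rw [InfPath.source, h0, ← FinPath.range_eq_of_edges_eq_nil _ h, α.2.2]
    exact z.2
  · have hlt : 0 < α.1.edges.length := by simp [h]
    rw [InfPath.source, α.append_edge_of_lt z 0 hlt]
    refine α.1.source_eq _ ?_
    simp [h]

theorem isConcat_append (α : PathsTo S v) (z : Tail E v) : (α.append z).IsConcat α.1 z.1 :=
  ⟨α.source_append z, α.append_edge_of_lt z, α.append_edge_add z⟩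

theorem eq_append_of_isConcat {x z : E.InfPath} (α : PathsTo S v) (h : x.IsConcat α.1 z) :
    ∃ hz : z.source = v, x = α.append ⟨z, hz⟩ := by
  obtain ⟨h1, h2, h3⟩ := h
  have hz : z.source = v := by
    have h4 : x.edge α.1.length = z.edge 0 := h3 0
    rw [InfPath.source, ← h4]
    refine Eq.trans ?_ α.2.2
    rcases Nat.eq_zero_or_pos α.1.edges.length with h | h
    · rw [FinPath.range_eq_of_edges_eq_nil _ (List.length_eq_zero_iff.1 h), ← h1]
      rw [FinPath.length, h]
      rfl
    · rw [FinPath.range_eq_of_length_eq α.1 (α.1.edges.length - 1) (by omega) (by omega),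
        ← h2 _ (by omega), x.chain, FinPath.length]
      congr 2
      omega
  refine ⟨hz, InfPath.ext fun i => ?_⟩
  rcases lt_or_ge i α.1.edges.length with h | h
  · rw [h2 i h, α.append_edge_of_lt _ i h]
  · obtain ⟨j, rfl⟩ := Nat.exists_eq_add_of_le h
    rw [α.append_edge_add]
    exact h3 j

theorem append_snoc_tail (α : PathsTo S v) (z : Tail E v) :
    (α.snoc z.head).append z.tail = α.append z := by
  refine InfPath.ext fun i => ?_
  have hlen : (α.snoc z.head).1.edges.length = α.1.edges.length + 1 := by
    simp [snoc, FinPath.snoc]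
  rcases lt_trichotomy i α.1.edges.length with h | h | h
  · rw [append_edge_of_lt _ _ _ h, append_edge_of_lt _ _ _ (by omega)]
    simp only [snoc, FinPath.snoc]
    exact List.getElem_append_left h
  · rw [append_edge_of_lt _ _ _ (by omega)]
    have h1 := append_edge_add α z 0
    rw [add_zero, ← h] at h1
    rw [h1]
    simp [snoc, FinPath.snoc, h, Tail.head]
  · obtain ⟨j, rfl⟩ := Nat.exists_eq_add_of_lt h
    have h1 := append_edge_add (α.snoc z.head) z.tail j
    rw [hlen] at h1
    rw [add_right_comm, h1, add_assoc, add_comm 1 j, ← add_assoc, add_assoc, append_edge_add]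
    rfl

theorem append_snoc (α : PathsTo S v) (g : Out E v) (z : Tail E (E.r g.1)) :
    (α.snoc g).append z = α.append (Tail.cons g z) :=
  α.append_snoc_tail (Tail.cons g z)

theorem append_nil (h : v ∈ S) (z : Tail E v) : (nil h).append z = z.1 :=
  InfPath.ext fun i => by
    have := append_edge_add (nil h) z i
    simpa [nil, FinPath.nil] using this

theorem exists_append (x : E.InfPath) (hx : x.source ∈ S) (i : ℕ) :
    ∃ α : PathsTo S (E.s (x.edge i)), α.1.length = i ∧
      α.append ⟨⟨fun j => x.edge (i + j), fun j => x.chain (i + j)⟩, rfl⟩ = x := by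
  induction i with
  | zero =>
    refine ⟨nil (v := E.s (x.edge 0)) hx, rfl, ?_⟩
    refine (append_nil (v := E.s (x.edge 0)) hx _).trans ?_
    exact InfPath.ext fun i => by simp
  | succ i ih =>
    obtain ⟨α, h1, h2⟩ := ih
    have h3 : ∀ w (hw : E.r (x.edge i) = w) (hz), ∃ α : PathsTo S w, α.1.length = i + 1 ∧
      α.append ⟨⟨fun j => x.edge (i + 1 + j), fun j => x.chain (i + 1 + j)⟩, hz⟩ = x := by
      rintro _ rfl hz
      refine ⟨α.snoc ⟨x.edge i, rfl⟩, ?_, ?_⟩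
      · simp [snoc, FinPath.snoc, FinPath.length] at h1 ⊢
        exact h1
      · refine Eq.trans ?_ h2
        rw [append_snoc]
        congr 1
        refine Tail.ext_edge fun j => ?_
        rcases j with _ | j
        · rfl
        · change x.edge (i + 1 + j) = x.edge (i + (j + 1))
          congr 1
          omega
    exact h3 _ (x.chain i) rfl

variable [Leveled E]

theorem lev_eq (α : PathsTo S v) : lev v = lev α.1.source + α.1.edges.length :=
  (congrArg lev α.2.2).symm.trans (FinPath.lev_range α.1)

/-- The decomposition of an infinite path into a finite path and a tail starting on a given level
is unique. -/
theorem append_inj {w : E.V} (hvw : lev v = lev w) {α : PathsTo S v} {z : Tail E v}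
    {β : PathsTo S w} {y : Tail E w} (h : α.append z = β.append y) :
    (⟨v, α, z⟩ : Σ v, PathsTo S v × Tail E v) = ⟨w, β, y⟩ := by
  have hs : α.1.source = β.1.source := by rw [← α.source_append z, h, source_append]
  have hl : α.1.edges.length = β.1.edges.length := by
    have h1 := α.lev_eq
    have h2 := β.lev_eq
    rw [hs] at h1
    omega
  have he : α.1 = β.1 := by
    refine FinPath.ext hs (List.ext_getElem hl fun i h1 h2 => ?_)
    rw [← α.append_edge_of_lt z i h1, h, β.append_edge_of_lt y i h2]
  obtain rfl : v = w := by rw [← α.2.2, ← β.2.2, he]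
  obtain rfl : α = β := Subtype.ext he
  have : z = y := Tail.ext_edge fun i => by
    rw [← α.append_edge_add z i, h, α.append_edge_add]
  rw [this]

end PathsTo

end DirectedGraph

/-! ### The topology of the path groupoid -/

namespace DirectedGraph

open Leveled

variable {E : DirectedGraph} {S : Set E.V}

theorem PathGroupoid.isOpen_Z {α β : E.FinPath} (h : α.range = β.range) :
    IsOpen (PathGroupoid.Z α β) :=
  TopologicalSpace.isOpen_generateFrom_of_mem ⟨α, β, h, rfl⟩

namespace PointedPathGroupoid

variable {v : E.V}

/-- The arrow `(α z, |β| - |α|, β z)`. -/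
def arr (α β : PathsTo S v) (z : Tail E v) : E.PointedPathGroupoid S :=
  ⟨{ x := α.append z
     k := (β.1.length : ℤ) - α.1.length
     y := β.append z
     tailEq := ⟨α.1.length, fun i j hi hj => by
      obtain ⟨m, rfl⟩ := Nat.exists_eq_add_of_le hi
      obtain rfl : j = β.1.length + m := by omega
      exact (α.append_edge_add z m).trans (β.append_edge_add z m).symm⟩ },
    by rw [PathsTo.source_append]; exact α.2.1, by rw [PathsTo.source_append]; exact β.2.1⟩

/-- The arrows `(α z, |β| - |α|, β z)`, for fixed `α` and `β`. -/
def cylinder (α β : PathsTo S v) : Set (E.PointedPathGroupoid S) := Set.range (arr α β)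

theorem arr_mem_cylinder (α β : PathsTo S v) (z : Tail E v) : arr α β z ∈ cylinder α β := ⟨z, rfl⟩

theorem arr_snoc_tail (α β : PathsTo S v) (z : Tail E v) :
    arr (α.snoc z.head) (β.snoc z.head) z.tail = arr α β z := by
  refine Subtype.ext (PathGroupoid.ext (α.append_snoc_tail z) ?_ (β.append_snoc_tail z))
  simp [arr, PathsTo.snoc, FinPath.snoc, FinPath.length]

theorem arr_snoc (α β : PathsTo S v) (g : Out E v) (z : Tail E (E.r g.1)) :
    arr (α.snoc g) (β.snoc g) z = arr α β (Tail.cons g z) :=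
  arr_snoc_tail α β (Tail.cons g z)

theorem cylinder_snoc_subset (α β : PathsTo S v) (g : Out E v) :
    cylinder (α.snoc g) (β.snoc g) ⊆ cylinder α β := by
  rintro _ ⟨z, rfl⟩
  exact ⟨Tail.cons g z, (arr_snoc α β g z).symm⟩

theorem cylinder_eq_preimage (α β : PathsTo S v) :
    cylinder α β = Subtype.val ⁻¹' PathGroupoid.Z α.1 β.1 := by
  ext γ
  constructor
  · rintro ⟨z, rfl⟩
    exact ⟨rfl, z.1, α.isConcat_append z, β.isConcat_append z⟩
  · rintro ⟨hk, z, hx, hy⟩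
    obtain ⟨hz, hx⟩ := α.eq_append_of_isConcat hx
    obtain ⟨_, hy'⟩ := β.eq_append_of_isConcat hy
    exact ⟨⟨z, hz⟩, Subtype.ext (PathGroupoid.ext hx.symm hk.symm hy'.symm)⟩

theorem isOpen_cylinder (α β : PathsTo S v) : IsOpen (cylinder α β) := by
  rw [cylinder_eq_preimage]
  exact (PathGroupoid.isOpen_Z (α.2.2.trans β.2.2.symm)).preimage continuous_subtype_val

theorem comp_arr (α δ β : PathsTo S v) (z : Tail E v) :
    (arr α δ z).1.comp (arr δ β z).1 rfl = (arr α β z).1 :=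
  PathGroupoid.ext rfl (by simp [PathGroupoid.comp, arr]) rfl

theorem inv_arr (α β : PathsTo S v) (z : Tail E v) : (arr α β z).1.inv = (arr β α z).1 :=
  PathGroupoid.ext rfl (by simp [PathGroupoid.inv, arr]) rfl

theorem exists_arr (γ : E.PointedPathGroupoid S) : ∃ (v : E.V) (α β : PathsTo S v) (z : Tail E v),
    γ = arr α β z := by
  obtain ⟨⟨x, k, y, N, hN⟩, hx, hy⟩ := γ
  obtain ⟨j, hj⟩ := Int.eq_ofNat_of_zero_le (show 0 ≤ ((N + k.natAbs : ℕ) : ℤ) + k by omega)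
  have hxy : ∀ m, x.edge (N + k.natAbs + m) = y.edge (j + m) := fun m =>
    hN _ _ (by omega) (by omega)
  obtain ⟨α, hα, hαx⟩ := PathsTo.exists_append x hx (N + k.natAbs)
  obtain ⟨β, hβ, hβy⟩ := PathsTo.exists_append y hy j
  have hv : E.s (y.edge j) = E.s (x.edge (N + k.natAbs)) := (congrArg E.s (hxy 0)).symm
  have hβ' : ∀ w (hw : E.s (y.edge j) = w), ∃ β : PathsTo S w, β.1.length = j ∧
      β.append ⟨⟨fun i => y.edge (j + i), fun i => y.chain (j + i)⟩, hw⟩ = y := by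
    rintro _ rfl
    exact ⟨β, hβ, hβy⟩
  obtain ⟨β', hβ1, hβ2⟩ := hβ' _ hv
  refine ⟨_, α, β', ⟨⟨fun i => x.edge (N + k.natAbs + i), fun i => x.chain _⟩, rfl⟩, ?_⟩
  refine Subtype.ext (PathGroupoid.ext hαx.symm ?_ ?_)
  · change k = (β'.1.length : ℤ) - α.1.length
    rw [hβ1, hα]
    omega
  · change y = _
    refine hβ2.symm.trans ?_
    change β'.append _ = β'.append _
    congr 1
    exact Tail.ext_edge fun i => (hxy i).symm

variable [Leveled E]

/-- Every arrow of a cylinder lies in a smaller cylinder on each higher level. -/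
theorem exists_arr_lev (α β : PathsTo S v) (z : Tail E v) {n : ℕ} (hn : lev v ≤ n) :
    ∃ (w : E.V) (_ : lev w = n) (α' β' : PathsTo S w) (z' : Tail E w),
      arr α β z = arr α' β' z' ∧ cylinder α' β' ⊆ cylinder α β := by
  induction n, hn using Nat.le_induction with
  | base => exact ⟨v, rfl, α, β, z, rfl, subset_rfl⟩
  | succ n hn ih =>
    obtain ⟨w, hw, α', β', z', h1, h2⟩ := ih
    exact ⟨_, by rw [lev_r, z'.head.2, hw], α'.snoc z'.head, β'.snoc z'.head, z'.tail,
      by rw [arr_snoc_tail, h1], (cylinder_snoc_subset _ _ _).trans h2⟩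

theorem arr_inj {w : E.V} (hvw : lev v = lev w) {α β : PathsTo S v} {z : Tail E v}
    {α' β' : PathsTo S w} {z' : Tail E w} (h : arr α β z = arr α' β' z') :
    (⟨v, α, β, z⟩ : Σ v, PathsTo S v × PathsTo S v × Tail E v) = ⟨w, α', β', z'⟩ := by
  have hx : α.append z = α'.append z' := congrArg (fun γ => γ.1.x) h
  have hy : β.append z = β'.append z' := congrArg (fun γ => γ.1.y) h
  have h1 := PathsTo.append_inj hvw hx
  obtain rfl : v = w := congrArg Sigma.fst h1
  obtain ⟨rfl, rfl⟩ := Prod.mk_inj.1 (eq_of_heq (Sigma.mk.inj_iff.1 h1).2)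
  have h2 := PathsTo.append_inj rfl hy
  obtain ⟨rfl, -⟩ := Prod.mk_inj.1 (eq_of_heq (Sigma.mk.inj_iff.1 h2).2)
  rfl

theorem arr_injective (α β : PathsTo S v) : Function.Injective (arr α β) := by
  intro z z' h
  exact (Prod.mk_inj.1 (Prod.mk_inj.1 (eq_of_heq (Sigma.mk.inj_iff.1 (arr_inj rfl h)).2)).2).2

/-- Two cylinders are either disjoint or nested. -/
theorem cylinder_subset_of_mem {w : E.V} (hvw : lev v ≤ lev w) {α β : PathsTo S v}
    {α' β' : PathsTo S w} {γ : E.PointedPathGroupoid S} (h : γ ∈ cylinder α β)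
    (h' : γ ∈ cylinder α' β') : cylinder α' β' ⊆ cylinder α β := by
  obtain ⟨z, rfl⟩ := h
  obtain ⟨z', h'⟩ := h'
  obtain ⟨u, hu, α'', β'', z'', h1, h2⟩ := exists_arr_lev α β z hvw
  have h3 := arr_inj hu.symm (h'.trans h1)
  obtain rfl : w = u := congrArg Sigma.fst h3
  obtain ⟨rfl, h4⟩ := Prod.mk_inj.1 (eq_of_heq (Sigma.mk.inj_iff.1 h3).2)
  obtain ⟨rfl, -⟩ := Prod.mk_inj.1 h4
  exact h2

theorem isTopologicalBasis_cylinder : TopologicalSpace.IsTopologicalBasis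
    {U : Set (E.PointedPathGroupoid S) | ∃ (v : E.V) (α β : PathsTo S v), U = cylinder α β} := by
  refine TopologicalSpace.isTopologicalBasis_of_isOpen_of_nhds ?_ ?_
  · rintro _ ⟨v, α, β, rfl⟩
    exact isOpen_cylinder α β
  · intro γ U hγ hU
    obtain ⟨W, hW, rfl⟩ := isOpen_induced_iff.1 hU
    have key : ∀ γ : E.PointedPathGroupoid S, γ.1 ∈ W →
        ∃ (v : E.V) (α β : PathsTo S v), γ ∈ cylinder α β ∧ cylinder α β ⊆ Subtype.val ⁻¹' W := by
      change TopologicalSpace.GenerateOpen _ W at hW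
      clear hγ hU γ
      induction hW with
      | basic W hW =>
        obtain ⟨α, β, hαβ, rfl⟩ := hW
        rintro γ hγ
        obtain ⟨-, z, hx, hy⟩ := id hγ
        let α' : PathsTo S α.range := ⟨α, hx.1 ▸ γ.2.1, rfl⟩
        let β' : PathsTo S α.range := ⟨β, hy.1 ▸ γ.2.2, hαβ.symm⟩
        refine ⟨α.range, α', β', ?_, (cylinder_eq_preimage α' β').subset⟩
        rw [cylinder_eq_preimage]
        exact hγ
      | univ =>
        intro γ _
        obtain ⟨v, α, β, z, rfl⟩ := exists_arr γ
        exact ⟨v, α, β, arr_mem_cylinder α β z, fun _ _ => trivial⟩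
      | inter W₁ W₂ _ _ ih₁ ih₂ =>
        intro γ hγ
        obtain ⟨v, α, β, h1, h2⟩ := ih₁ γ hγ.1
        obtain ⟨w, α', β', h3, h4⟩ := ih₂ γ hγ.2
        rcases le_total (lev v) (lev w) with h | h
        · exact ⟨w, α', β', h3, fun x hx => ⟨h2 (cylinder_subset_of_mem h h1 h3 hx), h4 hx⟩⟩
        · exact ⟨v, α, β, h1, fun x hx => ⟨h2 hx, h4 (cylinder_subset_of_mem h h3 h1 hx)⟩⟩
      | sUnion T _ ih =>
        rintro γ ⟨W, hW, hγ⟩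
        obtain ⟨v, α, β, h1, h2⟩ := ih W hW γ hγ
        exact ⟨v, α, β, h1, fun x hx => ⟨W, hW, h2 hx⟩⟩
    obtain ⟨v, α, β, h1, h2⟩ := key γ hγ
    exact ⟨_, ⟨v, α, β, rfl⟩, h1, h2⟩

/-- The arrows `(α z, k, β z)` for which `z` starts on level `n`. -/
def band (S : Set E.V) (n : ℕ) : Set (E.PointedPathGroupoid S) :=
  {γ | ∃ (v : E.V) (_ : lev v = n) (α β : PathsTo S v) (z : Tail E v), γ = arr α β z}

theorem arr_mem_band {n : ℕ} (hv : lev v = n) (α β : PathsTo S v) (z : Tail E v) :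
    arr α β z ∈ band S n := ⟨v, hv, α, β, z, rfl⟩

theorem band_mono : Monotone (band S) := by
  rintro m n hmn _ ⟨v, rfl, α, β, z, rfl⟩
  obtain ⟨w, hw, α', β', z', h, -⟩ := exists_arr_lev α β z hmn
  exact ⟨w, hw, α', β', z', h⟩

theorem exists_mem_band (γ : E.PointedPathGroupoid S) : ∃ n, γ ∈ band S n := by
  obtain ⟨v, α, β, z, rfl⟩ := exists_arr γ
  exact ⟨_, arr_mem_band rfl α β z⟩

theorem band_eq_iUnion (n : ℕ) :
    band S n = ⋃ v : {v : E.V // lev v = n}, ⋃ α : PathsTo S v.1, ⋃ β : PathsTo S v.1,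
      cylinder α β := by
  ext γ
  simp only [Set.mem_iUnion]
  constructor
  · rintro ⟨v, hv, α, β, z, rfl⟩
    exact ⟨⟨v, hv⟩, α, β, z, rfl⟩
  · rintro ⟨v, α, β, z, rfl⟩
    exact arr_mem_band v.2 α β z

theorem isOpen_band (n : ℕ) : IsOpen (band S n) := by
  rw [band_eq_iUnion]
  exact isOpen_iUnion fun v => isOpen_iUnion fun α => isOpen_iUnion fun β => isOpen_cylinder α β

theorem isClosed_cylinder (α β : PathsTo S v) : IsClosed (cylinder α β) := by
  rw [← isOpen_compl_iff, isTopologicalBasis_cylinder.isOpen_iff]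
  intro γ hγ
  obtain ⟨n, hn⟩ := exists_mem_band γ
  obtain ⟨w, hw, α', β', z, rfl⟩ := band_mono (le_max_left n (lev v)) hn
  refine ⟨_, ⟨w, α', β', rfl⟩, arr_mem_cylinder α' β' z, fun γ' h1 h2 => hγ ?_⟩
  exact cylinder_subset_of_mem (hw ▸ le_max_right _ _) h2 h1 (arr_mem_cylinder α' β' z)

theorem isClosed_band (n : ℕ) : IsClosed (band S n) := by
  rw [band_eq_iUnion]
  exact isClosed_iUnion_of_finite fun v => isClosed_iUnion_of_finite fun α =>
    isClosed_iUnion_of_finite fun β => isClosed_cylinder α β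

/-- The topology of pointwise convergence of the edges. -/
instance : TopologicalSpace (Tail E v) :=
  letI : TopologicalSpace E.Edge := ⊥
  TopologicalSpace.induced (fun z i => z.1.edge i) inferInstance

omit [Leveled E] in
theorem isOpen_setOf_edge_eq (z : Tail E v) (N : ℕ) :
    IsOpen {z' : Tail E v | ∀ i < N, z'.1.edge i = z.1.edge i} := by
  let _ : TopologicalSpace E.Edge := ⊥
  have : DiscreteTopology E.Edge := ⟨rfl⟩
  have h : {z' : Tail E v | ∀ i < N, z'.1.edge i = z.1.edge i} =
      (fun (z' : Tail E v) i => z'.1.edge i) ⁻¹'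
        (Set.pi (Set.Iio N) fun i => {z.1.edge i}) := by
    ext z'
    simp [Set.mem_pi]
  rw [h]
  exact (isOpen_set_pi (Set.finite_Iio N) fun _ _ => isOpen_discrete _).preimage
    continuous_induced_dom

omit [Leveled E] in
theorem exists_edge_eq_subset {U : Set (Tail E v)} (hU : IsOpen U) {z : Tail E v} (hz : z ∈ U) :
    ∃ N, {z' : Tail E v | ∀ i < N, z'.1.edge i = z.1.edge i} ⊆ U := by
  let _ : TopologicalSpace E.Edge := ⊥
  have : DiscreteTopology E.Edge := ⟨rfl⟩
  obtain ⟨W, hW, rfl⟩ := isOpen_induced_iff.1 hU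
  obtain ⟨I, u, h1, h2⟩ := isOpen_pi_iff.1 hW _ hz
  refine ⟨I.sup id + 1, fun z' hz' => h2 fun i hi => ?_⟩
  have h3 : i ≤ I.sup id := Finset.le_sup (f := id) hi
  have := hz' i (by omega)
  simp only [this]
  exact (h1 i hi).2

/-- There are only finitely many edges at each distance from a given vertex. -/
theorem finite_edge (v : E.V) (i : ℕ) : {g | ∃ z : Tail E v, z.1.edge i = g}.Finite := by
  have hlev : ∀ (z : Tail E v) i, lev (E.s (z.1.edge i)) = lev v + i := by
    intro z i
    induction i with
    | zero => exact congrArg lev z.2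
    | succ i ih => rw [← z.1.chain, lev_r, ih, add_assoc]
  refine ((finite_lev (E := E) (lev v + i)).biUnion fun w _ => finite_out w).subset ?_
  rintro g ⟨z, rfl⟩
  exact Set.mem_biUnion (hlev z i) rfl

instance : CompactSpace (Tail E v) := by
  let _ : TopologicalSpace E.Edge := ⊥
  have : DiscreteTopology E.Edge := ⟨rfl⟩
  have hind : Topology.IsInducing (fun (z : Tail E v) i => z.1.edge i) := ⟨rfl⟩
  rw [← isCompact_univ_iff, hind.isCompact_iff]
  have hK : IsCompact (Set.pi Set.univ fun i => {g | ∃ z : Tail E v, z.1.edge i = g}) :=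
    isCompact_univ_pi fun i => (finite_edge v i).isCompact
  have himg : (fun (z : Tail E v) i => z.1.edge i) '' Set.univ =
      (Set.pi Set.univ fun i => {g | ∃ z : Tail E v, z.1.edge i = g}) ∩
        ({f | E.s (f 0) = v} ∩ ⋂ i, {f | E.r (f i) = E.s (f (i + 1))}) := by
    ext f
    constructor
    · rintro ⟨z, -, rfl⟩
      exact ⟨fun i _ => ⟨z, rfl⟩, z.2, Set.mem_iInter.2 z.1.chain⟩
    · rintro ⟨-, h1, h2⟩
      exact ⟨⟨⟨f, Set.mem_iInter.1 h2⟩, h1⟩, trivial, rfl⟩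
  rw [himg]
  refine hK.inter_right (IsClosed.inter ?_ (isClosed_iInter fun i => ?_))
  · exact (isClosed_discrete {g | E.s g = v}).preimage
      (show Continuous fun f : ℕ → E.Edge => f 0 from continuous_apply 0)
  · exact (isClosed_discrete {p : E.Edge × E.Edge | E.r p.1 = E.s p.2}).preimage
      (show Continuous fun f : ℕ → E.Edge => (f i, f (i + 1)) from
        (continuous_apply i).prodMk (continuous_apply (i + 1)))

theorem exists_image_arr_eq_cylinder (α β : PathsTo S v) (z : Tail E v) (N : ℕ) :
    ∃ (w : E.V) (_ : lev w = lev v + N) (α' β' : PathsTo S w),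
      arr α β '' {y | ∀ i < N, y.1.edge i = z.1.edge i} = cylinder α' β' := by
  induction N generalizing v with
  | zero =>
    refine ⟨v, rfl, α, β, ?_⟩
    simp [cylinder]
  | succ N ih =>
    obtain ⟨w, hw, α', β', h⟩ := ih (α.snoc z.head) (β.snoc z.head) z.tail
    refine ⟨w, ?_, α', β', h ▸ ?_⟩
    · rw [hw, lev_r, z.head.2]
      omega
    · ext γ
      constructor
      · rintro ⟨y, hy, rfl⟩
        have h0 : E.r z.head.1 = E.r (y.1.edge 0) := congrArg E.r (hy 0 (by omega)).symm
        let y' : Tail E (E.r z.head.1) :=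
          ⟨⟨fun i => y.1.edge (i + 1), fun i => y.1.chain (i + 1)⟩, (h0.trans (y.1.chain 0)).symm⟩
        refine ⟨y', fun i hi => hy (i + 1) (by omega), ?_⟩
        rw [arr_snoc]
        congr 1
        refine Tail.ext_edge fun i => ?_
        rcases i with _ | i
        · exact (hy 0 (by omega)).symm
        · rfl
      · rintro ⟨y, hy, rfl⟩
        refine ⟨Tail.cons z.head y, ?_, (arr_snoc _ _ _ _).symm⟩
        rintro (_ | i) hi
        · rfl
        · exact hy i (by omega)

theorem isOpenEmbedding_arr (α β : PathsTo S v) : Topology.IsOpenEmbedding (arr α β) := by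
  refine .of_continuous_injective_isOpenMap ?_ (arr_injective α β) ?_
  · refine isTopologicalBasis_cylinder.continuous_iff.2 ?_
    rintro _ ⟨w, α', β', rfl⟩
    refine isOpen_iff_forall_mem_open.2 fun z hz => ?_
    refine ⟨_, fun y hy => ?_, isOpen_setOf_edge_eq z (lev w), fun _ _ => rfl⟩
    obtain ⟨u, hu, α'', β'', h⟩ := exists_image_arr_eq_cylinder α β z (lev w)
    have hz' : arr α β z ∈ cylinder α'' β'' := h ▸ ⟨z, fun _ _ => rfl, rfl⟩
    exact cylinder_subset_of_mem (by omega) hz hz' (h ▸ ⟨y, hy, rfl⟩)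
  · intro U hU
    refine isOpen_iff_forall_mem_open.2 ?_
    rintro _ ⟨z, hz, rfl⟩
    obtain ⟨N, hN⟩ := exists_edge_eq_subset hU hz
    obtain ⟨u, hu, α', β', h⟩ := exists_image_arr_eq_cylinder α β z N
    exact ⟨_, h ▸ Set.image_mono hN, isOpen_cylinder α' β', h ▸ ⟨z, fun _ _ => rfl, rfl⟩⟩

theorem isCompact_cylinder (α β : PathsTo S v) : IsCompact (cylinder α β) :=
  isCompact_range (isOpenEmbedding_arr α β).continuous

theorem isCompact_band (n : ℕ) : IsCompact (band S n) := by
  rw [band_eq_iUnion]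
  exact isCompact_iUnion fun v => isCompact_iUnion fun α => isCompact_iUnion fun β =>
    isCompact_cylinder α β

/-- Continuity on the groupoid can be tested in the coordinates `z ↦ (α z, |β| - |α|, β z)`, where
`z` starts on a high level. -/
theorem continuous_of_arr {Y : Type*} [TopologicalSpace Y] {f : E.PointedPathGroupoid S → Y}
    (N : ℕ) (h : ∀ (v : E.V), N ≤ lev v → ∀ α β : PathsTo S v, Continuous fun z => f (arr α β z)) :
    Continuous f := by
  refine continuous_iff_continuousAt.2 fun γ => ?_
  obtain ⟨n, hn⟩ := exists_mem_band γ
  obtain ⟨v, hv, α, β, z, rfl⟩ := band_mono (le_max_left n N) hn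
  exact (isOpenEmbedding_arr α β).continuousAt_iff.1
    (h v (hv ▸ le_max_right n N) α β).continuousAt

theorem exists_subset_band {K : Set (E.PointedPathGroupoid S)} (hK : IsCompact K) :
    ∃ N, K ⊆ band S N := by
  obtain ⟨N, hN⟩ := hK.elim_directed_cover (band S) isOpen_band
    (fun γ _ => Set.mem_iUnion.2 (exists_mem_band γ)) band_mono.directed_le
  exact ⟨N, hN⟩

end PointedPathGroupoid

end DirectedGraph

namespace DirectedGraph

open Leveled

variable {E : DirectedGraph} {S : Set E.V} [Leveled E]

instance (v : E.V) : Fintype (PathsTo S v) := Fintype.ofFinite _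

instance (v : E.V) : DecidableEq (PathsTo S v) := Classical.decEq _

instance (v : E.V) : Fintype (Out E v) := Fintype.ofFinite _

instance (n : ℕ) : Fintype {v : E.V // lev v = n} := Fintype.ofFinite _

instance (n : ℕ) : DecidableEq {v : E.V // lev v = n} := Classical.decEq _

namespace PointedPathGroupoid

variable {v : E.V}

/-! ### Functions on the path groupoid -/

theorem exists_support_subset_band (f : C_c(E.PointedPathGroupoid S, ℂ)) :
    ∃ N, ∀ γ, γ ∉ band S N → f γ = 0 := by
  obtain ⟨N, hN⟩ := exists_subset_band (S := S) f.hasCompactSupport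
  exact ⟨N, fun γ hγ => image_eq_zero_of_notMem_tsupport fun h => hγ (hN h)⟩

/-- A continuous function supported in a band is compactly supported. -/
def mkBand (f : E.PointedPathGroupoid S → ℂ) (hf : Continuous f) (N : ℕ)
    (h : ∀ γ, γ ∉ band S N → f γ = 0) : C_c(E.PointedPathGroupoid S, ℂ) where
  toFun := f
  continuous_toFun := hf
  hasCompactSupport' := by
    refine (isCompact_band N).of_isClosed_subset (isClosed_tsupport f) ?_
    refine closure_minimal (fun γ hγ => ?_) (isClosed_band N)
    by_contra hn
    exact hγ (h γ hn)

@[simp] theorem coe_mkBand (f : E.PointedPathGroupoid S → ℂ) (hf : Continuous f) (N : ℕ)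
    (h : ∀ γ, γ ∉ band S N → f γ = 0) : ⇑(mkBand f hf N h) = f := rfl

theorem mem_cylinder_iff {w : E.V} (hvw : lev v = lev w) {α β : PathsTo S v} {α' β' : PathsTo S w}
    {z : Tail E w} : arr α' β' z ∈ cylinder α β ↔
      (⟨v, α, β⟩ : Σ v, PathsTo S v × PathsTo S v) = ⟨w, α', β'⟩ := by
  constructor
  · rintro ⟨y, hy⟩
    have h := arr_inj hvw hy
    obtain rfl : v = w := congrArg Sigma.fst h
    obtain ⟨rfl, h2⟩ := Prod.mk_inj.1 (eq_of_heq (Sigma.mk.inj_iff.1 h).2)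
    obtain ⟨rfl, -⟩ := Prod.mk_inj.1 h2
    rfl
  · intro h
    obtain rfl : v = w := congrArg Sigma.fst h
    obtain ⟨rfl, rfl⟩ := Prod.mk_inj.1 (eq_of_heq (Sigma.mk.inj_iff.1 h).2)
    exact arr_mem_cylinder _ _ _

theorem mem_cylinder_iff_and (α β α' β' : PathsTo S v) (z : Tail E v) :
    arr α' β' z ∈ cylinder α β ↔ α = α' ∧ β = β' := by
  rw [mem_cylinder_iff rfl]
  simp

theorem cylinder_subset_band {n : ℕ} (hn : lev v ≤ n) (α β : PathsTo S v) :
    cylinder α β ⊆ band S n := by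
  rintro _ ⟨z, rfl⟩
  exact band_mono hn (arr_mem_band rfl α β z)

theorem cylinder_subset_band_of_mem {n : ℕ} (hn : n ≤ lev v) {α β : PathsTo S v} {z : Tail E v}
    (h : arr α β z ∈ band S n) : cylinder α β ⊆ band S n := by
  obtain ⟨w, rfl, α', β', z', h⟩ := h
  exact (cylinder_subset_of_mem hn (h ▸ arr_mem_cylinder α' β' z') (arr_mem_cylinder α β z)).trans
    (cylinder_subset_band le_rfl α' β')

theorem isUnitArrow_arr_iff (α β : PathsTo S v) (z : Tail E v) :
    (arr α β z).1.IsUnitArrow ↔ α = β := by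
  constructor
  · rintro ⟨-, h⟩
    exact (Prod.mk_inj.1 (eq_of_heq (Sigma.mk.inj_iff.1 (PathsTo.append_inj rfl h)).2)).1
  · rintro rfl
    exact ⟨sub_self _, rfl⟩

theorem isClopen_cylinder (α β : PathsTo S v) : IsClopen (cylinder α β) :=
  ⟨isClosed_cylinder α β, isOpen_cylinder α β⟩

/-- The indicator function of a cylinder. -/
def ind (α β : PathsTo S v) : C_c(E.PointedPathGroupoid S, ℂ) :=
  mkBand ((cylinder α β).indicator fun _ => 1)
    ((isClopen_cylinder α β).continuous_indicator continuous_const) (lev v)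
    fun _ hγ => Set.indicator_of_notMem (fun h => hγ (cylinder_subset_band le_rfl α β h)) _

theorem ind_apply (α β : PathsTo S v) (γ : E.PointedPathGroupoid S) :
    ind α β γ = (cylinder α β).indicator (fun _ => 1) γ := rfl

theorem ind_arr (α β α' β' : PathsTo S v) (z : Tail E v) :
    ind α β (arr α' β' z) = if α = α' ∧ β = β' then 1 else 0 := by
  split_ifs with h
  · rw [ind_apply]
    exact Set.indicator_of_mem ((mem_cylinder_iff_and _ _ _ _ z).2 h) _
  · rw [ind_apply]
    exact Set.indicator_of_notMem (fun h' => h ((mem_cylinder_iff_and _ _ _ _ z).1 h')) _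

theorem ind_arr_ne {w : E.V} (hvw : lev v = lev w) (hne : v ≠ w) (α β : PathsTo S v)
    (α' β' : PathsTo S w) (z : Tail E w) : ind α β (arr α' β' z) = 0 := by
  rw [ind_apply, Set.indicator_of_notMem]
  rw [mem_cylinder_iff hvw]
  exact fun h => hne (congrArg Sigma.fst h)

theorem ind_eq_sum (α β : PathsTo S v) :
    ind α β = ∑ g : Out E v, ind (α.snoc g) (β.snoc g) := by
  ext γ
  rw [CompactlySupportedContinuousMap.coe_sum, Finset.sum_apply]
  by_cases hγ : γ ∈ cylinder α β
  · obtain ⟨z, rfl⟩ := hγ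
    rw [ind_arr, if_pos ⟨rfl, rfl⟩, Finset.sum_eq_single z.head, ← arr_snoc_tail, ind_arr,
      if_pos ⟨rfl, rfl⟩]
    · intro g _ hg
      rw [ind_apply, Set.indicator_of_notMem]
      rintro ⟨y, hy⟩
      rw [arr_snoc] at hy
      exact hg (congrArg Tail.head (arr_injective α β hy))
    · simp
  · rw [ind_apply, Set.indicator_of_notMem hγ]
    refine (Finset.sum_eq_zero fun g _ => ?_).symm
    rw [ind_apply, Set.indicator_of_notMem fun h => hγ (cylinder_snoc_subset α β g h)]

/-- A function supported in a band is the sum of its restrictions to the cylinders forming it. -/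
theorem eq_sum_indicator {n : ℕ} {f : E.PointedPathGroupoid S → ℂ}
    (hf : ∀ γ, γ ∉ band S n → f γ = 0) :
    f = ∑ v : {v : E.V // lev v = n}, ∑ α : PathsTo S v.1, ∑ β : PathsTo S v.1,
      (cylinder α β).indicator f := by
  funext γ
  simp only [Finset.sum_apply]
  by_cases hγ : γ ∈ band S n
  · obtain ⟨v, hv, α, β, z, rfl⟩ := hγ
    rw [Finset.sum_eq_single ⟨v, hv⟩, Finset.sum_eq_single α, Finset.sum_eq_single β]
    · rw [Set.indicator_of_mem (arr_mem_cylinder α β z)]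
    · intro β' _ hβ
      rw [Set.indicator_of_notMem]
      exact fun h => hβ ((mem_cylinder_iff_and _ _ _ _ _).1 h).2
    · simp
    · intro α' _ hα
      refine Finset.sum_eq_zero fun β' _ => Set.indicator_of_notMem ?_ _
      exact fun h => hα ((mem_cylinder_iff_and _ _ _ _ _).1 h).1
    · simp
    · intro w _ hw
      refine Finset.sum_eq_zero fun α' _ => Finset.sum_eq_zero fun β' _ =>
        Set.indicator_of_notMem ?_ _
      rw [mem_cylinder_iff (w.2.trans hv.symm)]
      exact fun h => hw (Subtype.ext (congrArg Sigma.fst h))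
    · simp
  · rw [hf γ hγ]
    refine (Finset.sum_eq_zero fun v _ => Finset.sum_eq_zero fun α _ =>
      Finset.sum_eq_zero fun β _ => ?_).symm
    rw [Set.indicator_of_notMem fun h => hγ (cylinder_subset_band v.2.le α β h)]

/-- On the cylinders ending on a level `n`, the convolution of functions supported in the `n`-th
band is multiplication of matrices. -/
theorem convolution_arr (f : E.PointedPathGroupoid S → ℂ) {g : E.PointedPathGroupoid S → ℂ}
    (hg : ∀ γ, γ ∉ band S (lev v) → g γ = 0) (α β : PathsTo S v) (z : Tail E v) :
    convolution f g (arr α β z) = ∑ δ : PathsTo S v, f (arr α δ z) * g (arr δ β z) := by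
  let j : PathsTo S v → {q : E.PointedPathGroupoid S × E.PointedPathGroupoid S //
      ∃ h : q.1.1.y = q.2.1.x, q.1.1.comp q.2.1 h = (arr α β z).1} :=
    fun δ => ⟨(arr α δ z, arr δ β z), rfl, comp_arr α δ β z⟩
  have hj : Function.Injective j := by
    intro δ δ' h
    have h1 : arr α δ z = arr α δ' z := congrArg (fun q => q.1.1) h
    have h2 := ((mem_cylinder_iff_and α δ α δ' z).1 (h1 ▸ arr_mem_cylinder α δ z)).2
    exact h2
  have hsupp : Function.support (fun q : {q : E.PointedPathGroupoid S × E.PointedPathGroupoid S //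
      ∃ h : q.1.1.y = q.2.1.x, q.1.1.comp q.2.1 h = (arr α β z).1} => f q.1.1 * g q.1.2) ⊆
      Set.range j := by
    rintro ⟨⟨γ₁, γ₂⟩, h, hc⟩ hq
    have hg2 : g γ₂ ≠ 0 := right_ne_zero_of_mul hq
    have hmem : γ₂ ∈ band S (lev v) := by
      by_contra hn
      exact hg2 (hg _ hn)
    obtain ⟨w, hw, δ, β', z', rfl⟩ := hmem
    have hy : β'.append z' = β.append z := congrArg (fun γ => γ.y) hc
    have h3 := PathsTo.append_inj hw hy
    obtain rfl : w = v := congrArg Sigma.fst h3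
    obtain ⟨rfl, rfl⟩ := Prod.mk_inj.1 (eq_of_heq (Sigma.mk.inj_iff.1 h3).2)
    refine ⟨δ, Subtype.ext (Prod.ext ?_ rfl)⟩
    refine Subtype.ext (PathGroupoid.ext (congrArg (fun γ => γ.x) hc).symm ?_ h.symm)
    have hk : γ₁.1.k + ((β'.1.length : ℤ) - δ.1.length) = β'.1.length - α.1.length :=
      congrArg (fun γ => γ.k) hc
    change (δ.1.length : ℤ) - α.1.length = γ₁.1.k
    omega
  rw [convolution, ← finsum_mem_univ, ← finsum_mem_inter_support, Set.univ_inter,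
    ← Set.inter_eq_self_of_subset_right hsupp, finsum_mem_inter_support, finsum_mem_range hj,
    finsum_eq_sum_of_fintype]

theorem convolution_eq_zero {n : ℕ} {f g : E.PointedPathGroupoid S → ℂ}
    (hf : ∀ γ, γ ∉ band S n → f γ = 0) (hg : ∀ γ, γ ∉ band S n → g γ = 0)
    {γ : E.PointedPathGroupoid S} (hγ : γ ∉ band S n) : convolution f g γ = 0 := by
  refine finsum_eq_zero_of_forall_eq_zero ?_
  rintro ⟨⟨γ₁, γ₂⟩, h, hc⟩
  by_contra hne
  have h1 : γ₁ ∈ band S n := by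
    by_contra hn
    exact left_ne_zero_of_mul hne (hf _ hn)
  have h2 : γ₂ ∈ band S n := by
    by_contra hn
    exact right_ne_zero_of_mul hne (hg _ hn)
  obtain ⟨v, hv, α, δ, z, rfl⟩ := h1
  obtain ⟨w, hw, δ', β, z', rfl⟩ := h2
  have h3 := PathsTo.append_inj (hv.trans hw.symm) h
  obtain rfl : v = w := congrArg Sigma.fst h3
  obtain ⟨rfl, rfl⟩ := Prod.mk_inj.1 (eq_of_heq (Sigma.mk.inj_iff.1 h3).2)
  exact hγ ⟨v, hv, α, β, z, Subtype.ext (hc.symm.trans (comp_arr α δ β z))⟩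

omit [Leveled E] in
theorem involution_arr (f : E.PointedPathGroupoid S → ℂ) (α β : PathsTo S v) (z : Tail E v) :
    involution f (arr α β z) = star (f (arr β α z)) :=
  congrArg (fun γ => star (f γ)) (Subtype.ext (inv_arr α β z))

theorem involution_eq_zero {n : ℕ} {f : E.PointedPathGroupoid S → ℂ}
    (hf : ∀ γ, γ ∉ band S n → f γ = 0) {γ : E.PointedPathGroupoid S} (hγ : γ ∉ band S n) :
    involution f γ = 0 := by
  obtain ⟨m, hm⟩ := exists_mem_band γ
  obtain ⟨v, hv, α, β, z, rfl⟩ := band_mono (le_max_left m n) hm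
  rw [involution_arr, hf, star_zero]
  rintro ⟨w, hw, β', α', y, hy⟩
  refine hγ ⟨w, hw, α', β', y, ?_⟩
  refine Subtype.ext ?_
  rw [← inv_arr, hy, inv_arr]

theorem continuous_convolution {n : ℕ} {f g : E.PointedPathGroupoid S → ℂ} (hfc : Continuous f)
    (hgc : Continuous g) (hg : ∀ γ, γ ∉ band S n → g γ = 0) : Continuous (convolution f g) := by
  refine continuous_of_arr n fun v hv α β => ?_
  have : (fun z => convolution f g (arr α β z)) =
      fun z => ∑ δ : PathsTo S v, f (arr α δ z) * g (arr δ β z) :=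
    funext fun z => convolution_arr f (fun γ hγ => hg γ fun h => hγ (band_mono hv h)) α β z
  rw [this]
  exact continuous_finsetSum _ fun δ _ =>
    (hfc.comp (isOpenEmbedding_arr α δ).continuous).mul
      (hgc.comp (isOpenEmbedding_arr δ β).continuous)

theorem continuous_involution {f : E.PointedPathGroupoid S → ℂ} (hf : Continuous f) :
    Continuous (involution f) := by
  refine continuous_of_arr 0 fun v _ α β => ?_
  simp only [involution_arr]
  exact (hf.comp (isOpenEmbedding_arr β α).continuous).star

theorem exists_convolution (f g : C_c(E.PointedPathGroupoid S, ℂ)) :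
    ∃ h : C_c(E.PointedPathGroupoid S, ℂ), ⇑h = convolution f g := by
  obtain ⟨M, hM⟩ := exists_support_subset_band f
  obtain ⟨N, hN⟩ := exists_support_subset_band g
  have hg : ∀ γ, γ ∉ band S (max M N) → g γ = 0 := fun γ hγ =>
    hN γ fun h => hγ (band_mono (le_max_right M N) h)
  exact ⟨mkBand _ (continuous_convolution f.continuous g.continuous hg) (max M N) fun γ hγ =>
    convolution_eq_zero (fun γ hγ => hM γ fun h => hγ (band_mono (le_max_left M N) h)) hg hγ, rfl⟩

theorem exists_involution (f : C_c(E.PointedPathGroupoid S, ℂ)) :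
    ∃ h : C_c(E.PointedPathGroupoid S, ℂ), ⇑h = involution f := by
  obtain ⟨N, hN⟩ := exists_support_subset_band f
  exact ⟨mkBand _ (continuous_involution f.continuous) N fun γ hγ => involution_eq_zero hN hγ, rfl⟩

/-- A function supported in a single cylinder is a function on a bisection: `f* * f` is supported
on units, where it takes the values `|f|²`. -/
theorem convolution_involution_self {α β : PathsTo S v} {f : E.PointedPathGroupoid S → ℂ}
    (hf : ∀ γ, γ ∉ cylinder α β → f γ = 0) (γ : E.PointedPathGroupoid S) :
    convolution (involution f) f γ = 0 ∨ ∃ z, γ = arr β β z ∧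
      convolution (involution f) f γ = star (f (arr α β z)) * f (arr α β z) := by
  have hfb : ∀ γ, γ ∉ band S (lev v) → f γ = 0 := fun γ hγ =>
    hf γ fun h => hγ (cylinder_subset_band le_rfl α β h)
  by_cases hγ : γ ∈ band S (lev v)
  swap
  · exact Or.inl (convolution_eq_zero (fun γ => involution_eq_zero hfb) hfb hγ)
  obtain ⟨w, hw, α', β', z, rfl⟩ := hγ
  rw [convolution_arr _ (hw ▸ hfb)]
  simp only [involution_arr]
  by_cases h0 : ∑ δ, star (f (arr δ α' z)) * f (arr δ β' z) = 0
  · exact Or.inl h0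
  right
  have key : ∀ δ η : PathsTo S w, f (arr δ η z) ≠ 0 →
      (⟨v, α, β⟩ : Σ v, PathsTo S v × PathsTo S v) = ⟨w, δ, η⟩ := by
    intro δ η h
    refine (mem_cylinder_iff hw.symm (z := z)).1 ?_
    by_contra hn
    exact h (hf _ hn)
  obtain ⟨δ, -, hδ⟩ := Finset.exists_ne_zero_of_sum_ne_zero h0
  have h1 := key _ _ fun h => left_ne_zero_of_mul hδ (by rw [h, star_zero])
  have h2 := key _ _ (right_ne_zero_of_mul hδ)
  obtain rfl : v = w := congrArg Sigma.fst h1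
  obtain ⟨rfl, rfl⟩ := Prod.mk_inj.1 (eq_of_heq (Sigma.mk.inj_iff.1 h1).2)
  obtain ⟨-, rfl⟩ := Prod.mk_inj.1 (eq_of_heq (Sigma.mk.inj_iff.1 h2).2)
  refine ⟨z, rfl, Finset.sum_eq_single _ (fun δ _ hδ => ?_) (by simp)⟩
  by_contra hn
  have h3 := key _ _ (right_ne_zero_of_mul hn)
  exact hδ (Prod.mk_inj.1 (eq_of_heq (Sigma.mk.inj_iff.1 h3).2)).1.symm

/-- The locally constant function that takes on each cylinder ending on level `n` the value of `f`
at a chosen point of the cylinder, and vanishes elsewhere. -/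
def disc (n : ℕ) (f : E.PointedPathGroupoid S → ℂ) : C_c(E.PointedPathGroupoid S, ℂ) :=
  ∑ v : {v : E.V // lev v = n}, ∑ α : PathsTo S v.1, ∑ β : PathsTo S v.1,
    f (arr α β (Tail.some v.1)) • ind α β

theorem disc_eq (n : ℕ) (f : E.PointedPathGroupoid S → ℂ) :
    ⇑(disc n f) = ∑ v : {v : E.V // lev v = n}, ∑ α : PathsTo S v.1, ∑ β : PathsTo S v.1,
      f (arr α β (Tail.some v.1)) • ⇑(ind α β) := by
  simp [disc, CompactlySupportedContinuousMap.coe_sum]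

theorem disc_arr {n : ℕ} (f : E.PointedPathGroupoid S → ℂ) (hv : lev v = n) (α β : PathsTo S v)
    (z : Tail E v) : disc n f (arr α β z) = f (arr α β (Tail.some v)) := by
  rw [disc_eq]
  simp only [Finset.sum_apply, Pi.smul_apply, smul_eq_mul]
  rw [Finset.sum_eq_single ⟨v, hv⟩, Finset.sum_eq_single α, Finset.sum_eq_single β]
  · rw [ind_arr, if_pos ⟨rfl, rfl⟩, mul_one]
  · intro β' _ hβ
    rw [ind_arr, if_neg fun h => hβ h.2, mul_zero]
  · simp
  · intro α' _ hα
    refine Finset.sum_eq_zero fun β' _ => ?_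
    rw [ind_arr, if_neg fun h => hα h.1, mul_zero]
  · simp
  · intro w _ hw
    refine Finset.sum_eq_zero fun α' _ => Finset.sum_eq_zero fun β' _ => ?_
    rw [ind_arr_ne (w.2.trans hv.symm) fun h => hw (Subtype.ext h), mul_zero]
  · simp

theorem disc_eq_zero {n : ℕ} (f : E.PointedPathGroupoid S → ℂ) {γ : E.PointedPathGroupoid S}
    (hγ : γ ∉ band S n) : disc n f γ = 0 := by
  rw [disc_eq]
  simp only [Finset.sum_apply, Pi.smul_apply, smul_eq_mul]
  refine Finset.sum_eq_zero fun v _ => Finset.sum_eq_zero fun α _ => Finset.sum_eq_zero fun β _ => ?_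
  rw [ind_apply, Set.indicator_of_notMem fun h => hγ (cylinder_subset_band v.2.le α β h), mul_zero]

theorem disc_eq_zero_of_band {n N : ℕ} (hN : N ≤ n) {f : E.PointedPathGroupoid S → ℂ}
    (hf : ∀ γ, γ ∉ band S N → f γ = 0) {γ : E.PointedPathGroupoid S} (hγ : γ ∉ band S N) :
    disc n f γ = 0 := by
  by_cases h : γ ∈ band S n
  · obtain ⟨v, rfl, α, β, z, rfl⟩ := h
    rw [disc_arr f rfl]
    exact hf _ fun h => hγ (cylinder_subset_band_of_mem hN h (arr_mem_cylinder α β z))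
  · exact disc_eq_zero f h

theorem disc_eq_zero_of_unit {n : ℕ} {f : E.PointedPathGroupoid S → ℂ}
    (hf : ∀ γ, ¬ γ.1.IsUnitArrow → f γ = 0) {γ : E.PointedPathGroupoid S}
    (hγ : ¬ γ.1.IsUnitArrow) : disc n f γ = 0 := by
  by_cases h : γ ∈ band S n
  · obtain ⟨v, rfl, α, β, z, rfl⟩ := h
    rw [disc_arr f rfl]
    rw [isUnitArrow_arr_iff] at hγ
    exact hf _ (by rwa [isUnitArrow_arr_iff])
  · exact disc_eq_zero f h

/-- Continuity and vanishing at infinity, for functions on the groupoid. -/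
structure IsZeroAtInfty (f : E.PointedPathGroupoid S → ℂ) : Prop where
  continuous : Continuous f
  exists_isCompact : ∀ ε > 0, ∃ K, IsCompact K ∧ ∀ γ, γ ∉ K → ‖f γ‖ < ε

omit [Leveled E] in
theorem isZeroAtInfty (f : C_c(E.PointedPathGroupoid S, ℂ)) : IsZeroAtInfty f where
  continuous := f.continuous
  exists_isCompact ε hε := ⟨tsupport f, f.hasCompactSupport, fun γ hγ => by
    rwa [image_eq_zero_of_notMem_tsupport hγ, norm_zero]⟩

/-- The locally constant functions `disc n f` converge to `f` uniformly. -/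
theorem IsZeroAtInfty.exists_norm_sub_disc_le {f : E.PointedPathGroupoid S → ℂ}
    (hf : IsZeroAtInfty f) {ε : ℝ} (hε : 0 < ε) :
    ∃ M, ∀ n ≥ M, ∀ γ, ‖f γ - disc n f γ‖ ≤ ε := by
  obtain ⟨K, hK, hKf⟩ := hf.exists_isCompact (ε / 2) (by positivity)
  have hloc : ∀ γ : E.PointedPathGroupoid S, ∃ (v : E.V) (α β : PathsTo S v),
      γ ∈ cylinder α β ∧ ∀ γ' ∈ cylinder α β, ‖f γ' - f γ‖ < ε / 2 := by
    intro γ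
    have hU : IsOpen {γ' | ‖f γ' - f γ‖ < ε / 2} :=
      isOpen_lt (hf.continuous.sub continuous_const).norm continuous_const
    obtain ⟨_, ⟨v, α, β, rfl⟩, h1, h2⟩ := isTopologicalBasis_cylinder.exists_subset_of_mem_open
      (show γ ∈ {γ' | ‖f γ' - f γ‖ < ε / 2} by simp; positivity) hU
    exact ⟨v, α, β, h1, h2⟩
  choose v α β hmem hlt using hloc
  obtain ⟨T, hT⟩ := hK.elim_finite_subcover (fun γ => cylinder (α γ) (β γ))
    (fun γ => isOpen_cylinder _ _) fun γ _ => Set.mem_iUnion.2 ⟨γ, hmem γ⟩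
  refine ⟨T.sup fun γ => lev (v γ), fun n hn γ => ?_⟩
  have hlev : ∀ η ∈ T, lev (v η) ≤ n := fun η hη =>
    (Finset.le_sup (f := fun γ => lev (v γ)) hη).trans hn
  by_cases hband : γ ∈ band S n
  · obtain ⟨w, rfl, α', β', z, rfl⟩ := hband
    rw [disc_arr f rfl]
    by_cases hcov : ∃ y, arr α' β' y ∈ K
    · obtain ⟨y, hy⟩ := hcov
      obtain ⟨η, hη, hyη⟩ := Set.mem_iUnion₂.1 (hT hy)
      have hsub := cylinder_subset_of_mem (hlev η hη) hyη (arr_mem_cylinder α' β' y)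
      have h1 := hlt η _ (hsub (arr_mem_cylinder α' β' z))
      have h2 := hlt η _ (hsub (arr_mem_cylinder α' β' (Tail.some w)))
      rw [← dist_eq_norm] at h1 h2 ⊢
      linarith [dist_triangle_right (f (arr α' β' z)) (f (arr α' β' (Tail.some w))) (f η)]
    · push Not at hcov
      have h1 := hKf _ (hcov z)
      have h2 := hKf _ (hcov (Tail.some w))
      linarith [norm_sub_le (f (arr α' β' z)) (f (arr α' β' (Tail.some w)))]
  · rw [disc_eq_zero f hband, sub_zero]
    refine (hKf γ fun hγ => hband ?_).le.trans (by linarith)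
    obtain ⟨η, hη, hγη⟩ := Set.mem_iUnion₂.1 (hT hγ)
    exact cylinder_subset_band (hlev η hη) _ _ hγη

end PointedPathGroupoid

end DirectedGraph

/-! ### The representation of the convolution algebra by matrix units -/

namespace DirectedGraph

open Leveled PointedPathGroupoid Filter Topology

variable {E : DirectedGraph} {S : Set E.V} [Leveled E]

/-- Nonzero matrix units `e v α β` in `A`, indexed by pairs of paths from `S` to the same vertex
`v`, that embed into each other along the edges and whose span is dense. -/
structure IsPathUnits {A : Type*} [NonUnitalCStarAlgebra A]
    (e : ∀ v : E.V, PathsTo S v → PathsTo S v → A) : Prop where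
  star_eq : ∀ v α β, star (e v α β) = e v β α
  mul_same : ∀ v α β γ δ, e v α β * e v γ δ = if β = γ then e v α δ else 0
  mul_ne : ∀ v w α β γ δ, lev v = lev w → v ≠ w → e v α β * e w γ δ = 0
  split : ∀ v α β, e v α β = ∑ g : Out E v, e (E.r g.1) (α.snoc g) (β.snoc g)
  ne_zero : ∀ v α, e v α α ≠ 0
  dense : Dense (Submodule.span ℂ {a | ∃ v α β, a = e v α β} : Set A)

namespace IsPathUnits

variable {A : Type*} [NonUnitalCStarAlgebra A] {e : ∀ v : E.V, PathsTo S v → PathsTo S v → A}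
  {v : E.V}

theorem isMatrixUnits (h : IsPathUnits e) (n : ℕ) :
    IsMatrixUnits fun (v : {v : E.V // lev v = n}) => e v.1 where
  star_eq v := h.star_eq v
  mul_same v := h.mul_same v
  mul_ne v w _ _ _ _ hvw := h.mul_ne v w _ _ _ _ (v.2.trans w.2.symm) fun h => hvw (Subtype.ext h)

/-- The matrices of values of a function at chosen points of the cylinders ending on level `n`. -/
def sample (n : ℕ) (f : E.PointedPathGroupoid S → ℂ) (v : {v : E.V // lev v = n}) :
    Matrix (PathsTo S v.1) (PathsTo S v.1) ℂ :=
  Matrix.of fun α β => f (arr α β (Tail.some v.1))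

/-- The `n`-th approximation to the image in `A` of the function `f` on the groupoid. -/
def approx (h : IsPathUnits e) (n : ℕ) : (E.PointedPathGroupoid S → ℂ) →ₗ[ℂ] A where
  toFun f := (h.isMatrixUnits n).hom (sample n f)
  map_add' f g := by
    rw [← map_add]
    rfl
  map_smul' c f := by
    rw [RingHom.id_apply, ← map_smul]
    rfl

theorem approx_apply (h : IsPathUnits e) (n : ℕ) (f : E.PointedPathGroupoid S → ℂ) :
    h.approx n f = ∑ v : {v : E.V // lev v = n}, ∑ α : PathsTo S v.1, ∑ β : PathsTo S v.1,
      f (arr α β (Tail.some v.1)) • e v.1 α β := rfl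

theorem approx_eq_hom (h : IsPathUnits e) (n : ℕ) (f : E.PointedPathGroupoid S → ℂ) :
    h.approx n f = (h.isMatrixUnits n).hom (sample n f) := rfl

theorem sample_ind (α β : PathsTo S v) :
    sample (lev v) (ind α β) =
      Pi.single (M := fun w : {w : E.V // lev w = lev v} => Matrix (PathsTo S w.1) (PathsTo S w.1) ℂ)
        ⟨v, rfl⟩ (Matrix.single α β 1) := by
  funext w
  ext α' β'
  rcases eq_or_ne w ⟨v, rfl⟩ with rfl | hw
  · rw [Pi.single_eq_same]
    change ind α β (arr α' β' _) = _
    rw [ind_arr, Matrix.single_apply]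
  · rw [Pi.single_eq_of_ne hw]
    exact ind_arr_ne w.2.symm (fun h => hw (Subtype.ext h.symm)) α β α' β' _

theorem approx_ind (h : IsPathUnits e) {n : ℕ} (hn : lev v ≤ n) (α β : PathsTo S v) :
    h.approx n (ind α β) = e v α β := by
  obtain ⟨k, rfl⟩ := Nat.exists_eq_add_of_le hn
  clear hn
  induction k generalizing v with
  | zero =>
    rw [add_zero, approx_eq_hom, sample_ind]
    exact (h.isMatrixUnits _).hom_single (⟨v, rfl⟩ : {w : E.V // lev w = lev v}) α β
  | succ k ih =>
    rw [h.split, ind_eq_sum, CompactlySupportedContinuousMap.coe_sum, map_sum]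
    refine Finset.sum_congr rfl fun g _ => ?_
    have hlev : lev v + (k + 1) = lev (E.r g.1) + k := by
      rw [lev_r, g.2]
      omega
    rw [hlev]
    exact ih _ _

theorem approx_disc (h : IsPathUnits e) {m n : ℕ} (hn : n ≤ m) (f : E.PointedPathGroupoid S → ℂ) :
    h.approx m (disc n f) = h.approx n f := by
  rw [disc_eq, h.approx_apply n]
  simp only [map_sum, map_smul]
  refine Finset.sum_congr rfl fun v _ => Finset.sum_congr rfl fun α _ =>
    Finset.sum_congr rfl fun β _ => ?_
  rw [h.approx_ind (v.2.trans_le hn)]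

theorem approx_convolution (h : IsPathUnits e) {n : ℕ} (f : E.PointedPathGroupoid S → ℂ)
    {g : E.PointedPathGroupoid S → ℂ} (hg : ∀ γ, γ ∉ band S n → g γ = 0) :
    h.approx n (convolution f g) = h.approx n f * h.approx n g := by
  rw [approx_eq_hom, approx_eq_hom, approx_eq_hom, ← map_mul]
  congr 1
  funext v
  ext α β
  exact convolution_arr f (v.2.symm ▸ hg) α β _

theorem approx_involution (h : IsPathUnits e) (n : ℕ) (f : E.PointedPathGroupoid S → ℂ) :
    h.approx n (involution f) = star (h.approx n f) := by
  rw [approx_eq_hom, approx_eq_hom, ← map_star]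
  congr 1
  funext v
  ext α β
  exact involution_arr f α β _

theorem sample_eq_diagonal {f : E.PointedPathGroupoid S → ℂ}
    (hf : ∀ γ, ¬ γ.1.IsUnitArrow → f γ = 0) (n : ℕ) :
    sample n f = fun v => Matrix.diagonal fun α => f (arr α α (Tail.some v.1)) := by
  funext v
  ext α β
  rcases eq_or_ne α β with rfl | hne
  · rw [Matrix.diagonal_apply_eq]
    rfl
  · rw [Matrix.diagonal_apply_ne _ hne]
    exact hf _ fun h => hne ((isUnitArrow_arr_iff α β _).1 h)

theorem approx_of_unit (h : IsPathUnits e) {f : E.PointedPathGroupoid S → ℂ}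
    (hf : ∀ γ, ¬ γ.1.IsUnitArrow → f γ = 0) (n : ℕ) :
    h.approx n f = ∑ v : {v : E.V // lev v = n}, ∑ α : PathsTo S v.1,
      f (arr α α (Tail.some v.1)) • e v.1 α α := by
  rw [approx_apply]
  refine Finset.sum_congr rfl fun v _ => Finset.sum_congr rfl fun α _ =>
    Finset.sum_eq_single α (fun β _ hβ => ?_) (by simp)
  rw [hf _ fun h => hβ ((isUnitArrow_arr_iff α β _).1 h).symm, zero_smul]

theorem norm_approx_le_of_unit (h : IsPathUnits e) {f : E.PointedPathGroupoid S → ℂ}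
    (hf : ∀ γ, ¬ γ.1.IsUnitArrow → f γ = 0) {C : ℝ} (hC : 0 ≤ C) (hfC : ∀ γ, ‖f γ‖ ≤ C) (n : ℕ) :
    ‖h.approx n f‖ ≤ C := by
  rw [approx_eq_hom, sample_eq_diagonal hf]
  exact (h.isMatrixUnits n).norm_hom_diagonal_le _ hC fun v α => hfC _

theorem norm_approx_le_of_cylinder (h : IsPathUnits e) {α β : PathsTo S v}
    {f : E.PointedPathGroupoid S → ℂ} (hf : ∀ γ, γ ∉ cylinder α β → f γ = 0) {C : ℝ} (hC : 0 ≤ C)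
    (hfC : ∀ γ, ‖f γ‖ ≤ C) {n : ℕ} (hn : lev v ≤ n) : ‖h.approx n f‖ ≤ C := by
  have hb : ∀ γ, γ ∉ band S n → f γ = 0 := fun γ hγ =>
    hf γ fun h => hγ (cylinder_subset_band hn α β h)
  refine abs_le_of_sq_le_sq' ?_ hC |>.2
  rw [sq, ← CStarRing.norm_star_mul_self, ← h.approx_involution, ← h.approx_convolution _ hb]
  refine h.norm_approx_le_of_unit (fun γ hγ => ?_) (by positivity) (fun γ => ?_) n
  · rcases convolution_involution_self hf γ with h0 | ⟨z, rfl, -⟩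
    · exact h0
    · exact absurd ((isUnitArrow_arr_iff β β z).2 rfl) hγ
  · rcases convolution_involution_self hf γ with h0 | ⟨z, rfl, h0⟩
    · rw [h0, norm_zero]
      positivity
    · rw [h0, norm_mul, norm_star, ← sq]
      exact pow_le_pow_left₀ (norm_nonneg _) (hfC _) 2

/-- The number of cylinders forming the `N`-th band. -/
def bandCard (S : Set E.V) (N : ℕ) : ℝ :=
  ∑ v : {v : E.V // lev v = N}, ∑ _α : PathsTo S v.1, ∑ _β : PathsTo S v.1, (1 : ℝ)

omit [NonUnitalCStarAlgebra A] in
theorem bandCard_nonneg (N : ℕ) : 0 ≤ bandCard S N :=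
  Finset.sum_nonneg fun _ _ => Finset.sum_nonneg fun _ _ => Finset.sum_nonneg fun _ _ => zero_le_one

theorem norm_approx_le_of_band (h : IsPathUnits e) {N : ℕ} {f : E.PointedPathGroupoid S → ℂ}
    (hf : ∀ γ, γ ∉ band S N → f γ = 0) {C : ℝ} (hC : 0 ≤ C) (hfC : ∀ γ, ‖f γ‖ ≤ C) {n : ℕ}
    (hn : N ≤ n) : ‖h.approx n f‖ ≤ bandCard S N * C := by
  rw [eq_sum_indicator hf]
  simp only [map_sum, bandCard, Finset.sum_mul, one_mul]
  refine norm_sum_le_of_le _ fun v _ => norm_sum_le_of_le _ fun α _ =>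
    norm_sum_le_of_le _ fun β _ => ?_
  exact h.norm_approx_le_of_cylinder (α := α) (β := β)
    (fun γ hγ => Set.indicator_of_notMem hγ f) hC
    (fun γ => (norm_indicator_le_norm_self f γ).trans (hfC γ)) (v.2.trans_le hn)

/-- The approximations converge for functions that vanish at infinity and are supported either on
the units or in a band. -/
theorem exists_tendsto_approx (h : IsPathUnits e) {f : E.PointedPathGroupoid S → ℂ}
    (hf : IsZeroAtInfty f)
    (hs : (∀ γ, ¬ γ.1.IsUnitArrow → f γ = 0) ∨ ∃ N, ∀ γ, γ ∉ band S N → f γ = 0) :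
    ∃ a, Tendsto (fun n => h.approx n f) atTop (𝓝 a) := by
  obtain ⟨N, K, hK, hb⟩ : ∃ (N : ℕ) (K : ℝ), 0 ≤ K ∧ ∀ n m, N ≤ n → n ≤ m → ∀ C, 0 ≤ C →
      (∀ γ, ‖f γ - disc n f γ‖ ≤ C) → ‖h.approx m (f - disc n f)‖ ≤ K * C := by
    rcases hs with hs | ⟨N, hs⟩
    · refine ⟨0, 1, zero_le_one, fun n m _ _ C hC hfC => ?_⟩
      rw [one_mul]
      refine h.norm_approx_le_of_unit (fun γ hγ => ?_) hC hfC m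
      rw [hs γ hγ, disc_eq_zero_of_unit hs hγ, sub_zero]
    · refine ⟨N, bandCard S N, bandCard_nonneg N, fun n m hn hm C hC hfC => ?_⟩
      refine h.norm_approx_le_of_band (fun γ hγ => ?_) hC hfC (hn.trans hm)
      rw [hs γ hγ, disc_eq_zero_of_band hn hs hγ, sub_zero]
  refine cauchySeq_tendsto_of_complete (Metric.cauchySeq_iff'.2 fun ε hε => ?_)
  obtain ⟨M, hM⟩ := hf.exists_norm_sub_disc_le (show 0 < ε / (K + 1) by positivity)
  refine ⟨max M N, fun m hm => ?_⟩
  have h1 := hb (max M N) m (le_max_right _ _) hm (ε / (K + 1)) (by positivity)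
    (hM _ (le_max_left _ _))
  rw [map_sub, h.approx_disc hm] at h1
  rw [dist_eq_norm]
  refine h1.trans_lt ?_
  rw [mul_div_assoc', div_lt_iff₀ (by positivity)]
  nlinarith

/-- The image in `A` of a function on the groupoid, if the approximations converge. -/
def lim (h : IsPathUnits e) (f : E.PointedPathGroupoid S → ℂ) : A :=
  limUnder atTop fun n => h.approx n f

theorem tendsto_lim_of_unit (h : IsPathUnits e) {f : E.PointedPathGroupoid S → ℂ}
    (hf : IsZeroAtInfty f) (hs : ∀ γ, ¬ γ.1.IsUnitArrow → f γ = 0) :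
    Tendsto (fun n => h.approx n f) atTop (𝓝 (h.lim f)) :=
  tendsto_nhds_limUnder (h.exists_tendsto_approx hf (Or.inl hs))

theorem tendsto_lim (h : IsPathUnits e) (f : C_c(E.PointedPathGroupoid S, ℂ)) :
    Tendsto (fun n => h.approx n f) atTop (𝓝 (h.lim f)) :=
  tendsto_nhds_limUnder
    (h.exists_tendsto_approx (isZeroAtInfty f) (Or.inr (exists_support_subset_band f)))

/-- The *-homomorphism `C_c(𝒢) → A` which maps the indicator functions of the cylinders to the
matrix units. -/
def rep (h : IsPathUnits e) : C_c(E.PointedPathGroupoid S, ℂ) →ₗ[ℂ] A where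
  toFun f := h.lim f
  map_add' f g := by
    refine tendsto_nhds_unique (h.tendsto_lim (f + g)) ?_
    simp only [CompactlySupportedContinuousMap.coe_add, map_add]
    exact (h.tendsto_lim f).add (h.tendsto_lim g)
  map_smul' c f := by
    refine tendsto_nhds_unique (h.tendsto_lim (c • f)) ?_
    simp only [CompactlySupportedContinuousMap.coe_smul, map_smul, RingHom.id_apply]
    exact (h.tendsto_lim f).const_smul c

theorem rep_apply (h : IsPathUnits e) (f : C_c(E.PointedPathGroupoid S, ℂ)) :
    h.rep f = h.lim f := rfl

theorem rep_ind (h : IsPathUnits e) (α β : PathsTo S v) : h.rep (ind α β) = e v α β := by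
  refine tendsto_nhds_unique (h.tendsto_lim (ind α β)) ?_
  refine tendsto_const_nhds.congr' ?_
  filter_upwards [eventually_ge_atTop (lev v)] with n hn
  exact (h.approx_ind hn α β).symm

theorem isStarHom_rep (h : IsPathUnits e) : IsStarHom h.rep where
  map_mul f g := by
    obtain ⟨k, hk⟩ := exists_convolution f g
    refine ⟨k, hk, tendsto_nhds_unique (h.tendsto_lim k) ?_⟩
    refine ((h.tendsto_lim f).mul (h.tendsto_lim g)).congr' ?_
    obtain ⟨N, hN⟩ := exists_support_subset_band g
    filter_upwards [eventually_ge_atTop N] with n hn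
    rw [hk, h.approx_convolution _ fun γ hγ => hN γ fun h => hγ (band_mono hn h)]
  map_star f := by
    obtain ⟨k, hk⟩ := exists_involution f
    refine ⟨k, hk, tendsto_nhds_unique (h.tendsto_lim k) ?_⟩
    rw [hk]
    simp only [h.approx_involution]
    exact (h.tendsto_lim f).star

theorem denseRange_rep (h : IsPathUnits e) : DenseRange h.rep := by
  refine h.dense.mono ?_
  rw [← LinearMap.coe_range, SetLike.coe_subset_coe, Submodule.span_le]
  rintro _ ⟨v, α, β, rfl⟩
  exact ⟨ind α β, h.rep_ind α β⟩

end IsPathUnits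

end DirectedGraph

/-! ### Every representation of the convolution algebra is dominated -/

namespace DirectedGraph

open Leveled PointedPathGroupoid Filter Topology

variable {E : DirectedGraph} {S : Set E.V} [Leveled E] {v : E.V}

namespace PointedPathGroupoid

theorem convolution_of_unit {n : ℕ} {f g : E.PointedPathGroupoid S → ℂ}
    (hf : ∀ γ, ¬ γ.1.IsUnitArrow → f γ = 0) (hg : ∀ γ, ¬ γ.1.IsUnitArrow → g γ = 0)
    (hgn : ∀ γ, γ ∉ band S n → g γ = 0) : convolution f g = f * g := by
  funext γ
  obtain ⟨m, hm⟩ := exists_mem_band γ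
  obtain ⟨v, hv, α, β, z, rfl⟩ := band_mono (le_max_left m n) hm
  rw [convolution_arr f fun γ hγ => hgn γ fun h => hγ (band_mono (hv ▸ le_max_right m n) h),
    Finset.sum_eq_single α, Pi.mul_apply]
  · rcases eq_or_ne α β with rfl | h
    · rfl
    · rw [hg (arr α β z), mul_zero, mul_zero]
      rwa [isUnitArrow_arr_iff]
  · intro δ _ hδ
    rw [hf (arr α δ z), zero_mul]
    rw [isUnitArrow_arr_iff]
    exact hδ.symm
  · simp

theorem involution_of_unit {f : E.PointedPathGroupoid S → ℂ}
    (hf : ∀ γ, ¬ γ.1.IsUnitArrow → f γ = 0) : involution f = star f := by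
  funext γ
  obtain ⟨v, α, β, z, rfl⟩ := exists_arr γ
  rw [involution_arr, Pi.star_apply]
  rcases eq_or_ne α β with rfl | h
  · rfl
  · rw [hf, hf] <;> rw [isUnitArrow_arr_iff]
    · exact h
    · exact h.symm

theorem convolution_ind (α β γ δ : PathsTo S v) :
    convolution (ind α β) (ind γ δ) = if β = γ then ⇑(ind α δ) else 0 := by
  have hb : ∀ α β : PathsTo S v, ∀ η, η ∉ band S (lev v) → ind α β η = 0 := fun α β η hη => by
    rw [ind_apply, Set.indicator_of_notMem fun h => hη (cylinder_subset_band le_rfl α β h)]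
  funext η
  by_cases hη : η ∈ band S (lev v)
  · obtain ⟨w, hw, α', β', z, rfl⟩ := hη
    rw [convolution_arr _ (hw ▸ hb γ δ)]
    rcases eq_or_ne v w with rfl | hvw
    · simp only [ind_arr, apply_ite (fun f : E.PointedPathGroupoid S → ℂ => f (arr α' β' z)),
        Pi.zero_apply]
      rw [Finset.sum_eq_single β]
      · by_cases h1 : α = α' <;> by_cases h2 : β = γ <;> by_cases h3 : δ = β' <;>
          simp [h1, h2, h3, eq_comm]
      · intro x _ hx
        rw [if_neg fun h => hx h.2.symm, zero_mul]
      · simp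
    · have h0 : ∀ α β : PathsTo S v, ∀ α' β' : PathsTo S w, ind α β (arr α' β' z) = 0 :=
        fun α β α' β' => ind_arr_ne hw.symm hvw α β α' β' z
      simp only [h0, mul_zero, Finset.sum_const_zero]
      split_ifs
      · rw [h0]
      · rfl
  · rw [convolution_eq_zero (hb α β) (hb γ δ) hη]
    split_ifs
    · rw [hb _ _ _ hη]
    · rfl

theorem convolution_ind_of_ne {w : E.V} (hvw : lev v = lev w) (hne : v ≠ w) (α β : PathsTo S v)
    (γ δ : PathsTo S w) : convolution (ind α β) (ind γ δ) = 0 := by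
  have hb : ∀ η, η ∉ band S (lev v) → ind α β η = 0 := fun η hη => by
    rw [ind_apply, Set.indicator_of_notMem fun h => hη (cylinder_subset_band le_rfl α β h)]
  have hb' : ∀ η, η ∉ band S (lev v) → ind γ δ η = 0 := fun η hη => by
    rw [ind_apply, Set.indicator_of_notMem fun h => hη (cylinder_subset_band hvw.ge γ δ h)]
  funext η
  by_cases hη : η ∈ band S (lev v)
  · obtain ⟨u, hu, α', β', z, rfl⟩ := hη
    rw [convolution_arr _ (hu ▸ hb')]
    refine Finset.sum_eq_zero fun x _ => ?_
    rcases eq_or_ne v u with rfl | h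
    · rw [ind_arr_ne hvw.symm hne.symm γ δ x β' z, mul_zero]
    · rw [ind_arr_ne hu.symm h α β α' x z, zero_mul]
  · rw [convolution_eq_zero hb hb' hη]
    rfl

theorem involution_ind (α β : PathsTo S v) : involution (ind α β) = ind β α := by
  have hb : ∀ α β : PathsTo S v, ∀ η, η ∉ band S (lev v) → ind α β η = 0 := fun α β η hη => by
    rw [ind_apply, Set.indicator_of_notMem fun h => hη (cylinder_subset_band le_rfl α β h)]
  funext η
  by_cases hη : η ∈ band S (lev v)
  · obtain ⟨w, hw, α', β', z, rfl⟩ := hη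
    rw [involution_arr]
    rcases eq_or_ne v w with rfl | hvw
    · rw [ind_arr, ind_arr]
      simp only [and_comm]
      split_ifs <;> simp
    · rw [ind_arr_ne hw.symm hvw, ind_arr_ne hw.symm hvw, star_zero]
  · rw [involution_eq_zero (hb α β) hη, hb β α η hη]

/-- The units in the `n`-th band. -/
def unitBand (S : Set E.V) (n : ℕ) : Set (E.PointedPathGroupoid S) :=
  ⋃ v : {v : E.V // lev v = n}, ⋃ α : PathsTo S v.1, cylinder α α

theorem mem_unitBand_iff {n : ℕ} {γ : E.PointedPathGroupoid S} :
    γ ∈ unitBand S n ↔ γ.1.IsUnitArrow ∧ γ ∈ band S n := by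
  simp only [unitBand, Set.mem_iUnion]
  constructor
  · rintro ⟨v, α, z, rfl⟩
    exact ⟨(isUnitArrow_arr_iff α α z).2 rfl, arr_mem_band v.2 α α z⟩
  · rintro ⟨h, v, hv, α, β, z, rfl⟩
    obtain rfl := (isUnitArrow_arr_iff α β z).1 h
    exact ⟨⟨v, hv⟩, α, z, rfl⟩

theorem isClopen_unitBand (n : ℕ) : IsClopen (unitBand S n) :=
  isClopen_iUnion_of_finite fun _ => isClopen_iUnion_of_finite fun α => isClopen_cylinder α α

theorem isCompact_unitBand (n : ℕ) : IsCompact (unitBand S n) :=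
  isCompact_iUnion fun _ => isCompact_iUnion fun α => isCompact_cylinder α α

open Classical in
/-- Extension by zero of a function on the units in the `n`-th band. -/
def extendUnitBand (n : ℕ) (g : C(unitBand S n, ℂ)) : C_c(E.PointedPathGroupoid S, ℂ) :=
  mkBand (fun γ => if h : γ ∈ unitBand S n then g ⟨γ, h⟩ else 0) (by
    refine continuous_iff_continuousAt.2 fun γ => ?_
    by_cases hγ : γ ∈ unitBand S n
    · refine (isClopen_unitBand n).isOpen.isOpenEmbedding_subtypeVal.continuousAt_iff
        (x := (⟨γ, hγ⟩ : unitBand S n)).1 ?_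
      refine g.continuous.continuousAt.congr (Eventually.of_forall fun x => ?_)
      simp [x.2]
    · refine continuousAt_const.congr (f := fun _ => (0 : ℂ)) ?_
      filter_upwards [(isClopen_unitBand n).compl.isOpen.mem_nhds hγ] with x hx
      have hx' : ¬ x ∈ unitBand S n := hx
      simp only [hx', dite_false]) n
    fun γ hγ => dif_neg fun h => hγ (mem_unitBand_iff.1 h).2

theorem extendUnitBand_of_mem {n : ℕ} (g : C(unitBand S n, ℂ)) {γ : E.PointedPathGroupoid S}
    (h : γ ∈ unitBand S n) : extendUnitBand n g γ = g ⟨γ, h⟩ := dif_pos h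

theorem extendUnitBand_of_notMem {n : ℕ} (g : C(unitBand S n, ℂ)) {γ : E.PointedPathGroupoid S}
    (h : γ ∉ unitBand S n) : extendUnitBand n g γ = 0 := dif_neg h

namespace IsStarHom

variable {C : Type*} [NonUnitalCStarAlgebra C] {π : C_c(E.PointedPathGroupoid S, ℂ) →ₗ[ℂ] C}

omit [Leveled E] in
theorem apply_mul (hπ : IsStarHom π) {f g k : C_c(E.PointedPathGroupoid S, ℂ)}
    (hk : ⇑k = convolution f g) : π k = π f * π g := by
  obtain ⟨k', hk', h⟩ := hπ.map_mul f g
  rw [← h, DFunLike.coe_injective (hk.trans hk'.symm)]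

omit [Leveled E] in
theorem apply_star (hπ : IsStarHom π) {f k : C_c(E.PointedPathGroupoid S, ℂ)}
    (hk : ⇑k = involution f) : π k = star (π f) := by
  obtain ⟨k', hk', h⟩ := hπ.map_star f
  rw [← h, DFunLike.coe_injective (hk.trans hk'.symm)]

/-- The restriction of a representation to the continuous functions on the compact set of units in
the `n`-th band. -/
def onUnitBand (hπ : IsStarHom π) (n : ℕ) : C(unitBand S n, ℂ) →⋆ₙₐ[ℂ] C where
  toFun g := π (extendUnitBand n g)
  map_smul' c g := by
    rw [MonoidHom.id_apply, ← map_smul]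
    congr 1
    ext γ
    by_cases h : γ ∈ unitBand S n
    · simp [extendUnitBand_of_mem _ h]
    · simp [extendUnitBand_of_notMem _ h]
  map_zero' := by
    rw [← map_zero π]
    congr 1
    ext γ
    by_cases h : γ ∈ unitBand S n
    · simp [extendUnitBand_of_mem _ h]
    · simp [extendUnitBand_of_notMem _ h]
  map_add' g g' := by
    rw [← map_add]
    congr 1
    ext γ
    by_cases h : γ ∈ unitBand S n
    · simp [extendUnitBand_of_mem _ h]
    · simp [extendUnitBand_of_notMem _ h]
  map_mul' g g' := by
    refine hπ.apply_mul ?_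
    have hu : ∀ g : C(unitBand S n, ℂ), ∀ γ : E.PointedPathGroupoid S, ¬ γ.1.IsUnitArrow →
        extendUnitBand n g γ = 0 := fun g γ hγ =>
      extendUnitBand_of_notMem g fun h => hγ (mem_unitBand_iff.1 h).1
    rw [convolution_of_unit (n := n) (hu g) (hu g') fun γ hγ =>
      extendUnitBand_of_notMem g' fun h => hγ (mem_unitBand_iff.1 h).2]
    funext γ
    by_cases h : γ ∈ unitBand S n
    · simp [extendUnitBand_of_mem _ h]
    · simp [extendUnitBand_of_notMem _ h]
  map_star' g := by
    refine hπ.apply_star ?_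
    rw [involution_of_unit fun γ hγ =>
      extendUnitBand_of_notMem g fun h => hγ (mem_unitBand_iff.1 h).1]
    funext γ
    by_cases h : γ ∈ unitBand S n
    · simp [extendUnitBand_of_mem _ h]
    · simp [extendUnitBand_of_notMem _ h]

theorem norm_le_of_unit (hπ : IsStarHom π) {f : C_c(E.PointedPathGroupoid S, ℂ)}
    (hf : ∀ γ, ¬ γ.1.IsUnitArrow → f γ = 0) {n : ℕ} (hn : ∀ γ, γ ∉ band S n → f γ = 0)
    {M : ℝ} (hM : 0 ≤ M) (hfM : ∀ γ, ‖f γ‖ ≤ M) : ‖π f‖ ≤ M := by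
  have : CompactSpace (unitBand S n) := isCompact_iff_compactSpace.1 (isCompact_unitBand n)
  let g : C(unitBand S n, ℂ) := ⟨fun γ => f γ.1, f.continuous.comp continuous_subtype_val⟩
  have hfg : f = extendUnitBand n g := by
    ext γ
    by_cases h : γ ∈ unitBand S n
    · rw [extendUnitBand_of_mem _ h]
      rfl
    · rw [extendUnitBand_of_notMem _ h]
      by_cases hγ : γ.1.IsUnitArrow
      · exact hn γ fun hb => h (mem_unitBand_iff.2 ⟨hγ, hb⟩)
      · exact hf γ hγ
  rw [hfg]
  exact (NonUnitalStarAlgHom.norm_apply_le (hπ.onUnitBand n) g).trans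
    ((ContinuousMap.norm_le g hM).2 fun γ => hfM γ.1)

theorem norm_le_of_cylinder (hπ : IsStarHom π) {α β : PathsTo S v}
    {f : C_c(E.PointedPathGroupoid S, ℂ)} (hf : ∀ γ, γ ∉ cylinder α β → f γ = 0) {M : ℝ}
    (hM : 0 ≤ M) (hfM : ∀ γ, ‖f γ‖ ≤ M) : ‖π f‖ ≤ M := by
  have hb : ∀ γ, γ ∉ band S (lev v) → f γ = 0 := fun γ hγ =>
    hf γ fun h => hγ (cylinder_subset_band le_rfl α β h)
  obtain ⟨f', hf'⟩ := exists_involution f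
  obtain ⟨k, hk⟩ := exists_convolution f' f
  refine abs_le_of_sq_le_sq' ?_ hM |>.2
  rw [sq, ← CStarRing.norm_star_mul_self, ← hπ.apply_star hf', ← hπ.apply_mul hk]
  rw [hf'] at hk
  refine hπ.norm_le_of_unit (n := lev v) (fun γ hγ => ?_) (fun γ hγ => ?_) (by positivity)
    fun γ => ?_
  · rw [hk]
    rcases convolution_involution_self hf γ with h0 | ⟨z, rfl, -⟩
    · exact h0
    · exact absurd ((isUnitArrow_arr_iff β β z).2 rfl) hγ
  · rw [hk]
    exact convolution_eq_zero (fun γ => involution_eq_zero hb) hb hγ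
  · rw [hk]
    rcases convolution_involution_self hf γ with h0 | ⟨z, rfl, h0⟩
    · rw [h0, norm_zero]
      positivity
    · rw [h0, norm_mul, norm_star, ← sq]
      exact pow_le_pow_left₀ (norm_nonneg _) (hfM _) 2

theorem norm_le_of_band (hπ : IsStarHom π) {N : ℕ} {f : C_c(E.PointedPathGroupoid S, ℂ)}
    (hf : ∀ γ, γ ∉ band S N → f γ = 0) {M : ℝ} (hM : 0 ≤ M) (hfM : ∀ γ, ‖f γ‖ ≤ M) :
    ‖π f‖ ≤ IsPathUnits.bandCard S N * M := by
  have hsum : f = ∑ v : {v : E.V // lev v = N}, ∑ α : PathsTo S v.1, ∑ β : PathsTo S v.1,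
      mkBand ((cylinder α β).indicator f) ((isClopen_cylinder α β).continuous_indicator f.continuous)
        N (fun γ hγ => by rw [Set.indicator_apply_eq_zero]; exact fun _ => hf γ hγ) := by
    refine DFunLike.coe_injective ((eq_sum_indicator hf).trans ?_)
    simp [CompactlySupportedContinuousMap.coe_sum]
  rw [hsum]
  simp only [map_sum, IsPathUnits.bandCard, Finset.sum_mul, one_mul]
  refine norm_sum_le_of_le _ fun v _ => norm_sum_le_of_le _ fun α _ =>
    norm_sum_le_of_le _ fun β _ => ?_
  refine hπ.norm_le_of_cylinder (α := α) (β := β)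
    (fun γ hγ => Set.indicator_of_notMem hγ f) hM
    (fun γ => (norm_indicator_le_norm_self f γ).trans (hfM γ))

theorem isMatrixUnits (hπ : IsStarHom π) (n : ℕ) :
    IsMatrixUnits fun (v : {v : E.V // lev v = n}) (α β : PathsTo S v.1) => π (ind α β) where
  star_eq v α β := (hπ.apply_star (involution_ind α β).symm).symm
  mul_same v α β γ δ := by
    obtain ⟨k, hk⟩ := exists_convolution (ind α β) (ind γ δ)
    rw [← hπ.apply_mul hk]
    rw [convolution_ind] at hk
    split_ifs at hk ⊢
    · rw [DFunLike.coe_injective hk]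
    · rw [DFunLike.coe_injective (hk.trans CompactlySupportedContinuousMap.coe_zero.symm), map_zero]
  mul_ne v w α β γ δ hvw := by
    obtain ⟨k, hk⟩ := exists_convolution (ind α β) (ind γ δ)
    rw [← hπ.apply_mul hk]
    rw [convolution_ind_of_ne (v.2.trans w.2.symm) fun h => hvw (Subtype.ext h)] at hk
    rw [DFunLike.coe_injective (hk.trans CompactlySupportedContinuousMap.coe_zero.symm), map_zero]

end IsStarHom

end PointedPathGroupoid

/-- The representation `h.rep` dominates every *-homomorphism of the convolution algebra to a
C*-algebra: on locally constant functions because all C*-norms on a finite-dimensional algebra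
agree, and in general because locally constant functions approximate uniformly inside a band. -/
theorem IsPathUnits.norm_le_norm_rep {A : Type*} [NonUnitalCStarAlgebra A]
    {e : ∀ v : E.V, PathsTo S v → PathsTo S v → A} (h : IsPathUnits e)
    {C : Type*} [NonUnitalCStarAlgebra C] {π : C_c(E.PointedPathGroupoid S, ℂ) →ₗ[ℂ] C}
    (hπ : IsStarHom π) (f : C_c(E.PointedPathGroupoid S, ℂ)) : ‖π f‖ ≤ ‖h.rep f‖ := by
  obtain ⟨N, hN⟩ := exists_support_subset_band f
  have h1 : ∀ n, ‖π (disc n f)‖ ≤ ‖h.approx n f‖ := by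
    intro n
    have h2 : π (disc n f) = (hπ.isMatrixUnits n).hom (sample n f) := by
      simp only [disc, map_sum, map_smul]
      rfl
    rw [h2, h.approx_eq_hom]
    exact (h.isMatrixUnits n).norm_hom_le_norm_hom (fun v α => h.ne_zero v α) (hπ.isMatrixUnits n) _
  have h3 : Tendsto (fun n => π (disc n f)) atTop (𝓝 (π f)) := by
    rw [Metric.tendsto_atTop]
    intro ε hε
    have hK := IsPathUnits.bandCard_nonneg (S := S) N
    obtain ⟨M, hM⟩ := (isZeroAtInfty f).exists_norm_sub_disc_le
      (show 0 < ε / (IsPathUnits.bandCard S N + 1) by positivity)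
    refine ⟨max M N, fun n hn => ?_⟩
    have h4 : ‖π (f - disc n f)‖ ≤ IsPathUnits.bandCard S N * _ :=
      hπ.norm_le_of_band (N := N) (f := f - disc n f) (fun γ hγ => by
        change f γ - disc n f γ = 0
        rw [hN γ hγ, disc_eq_zero_of_band ((le_max_right M N).trans hn) hN hγ, sub_zero])
        (by positivity) (hM n ((le_max_left M N).trans hn))
    rw [dist_comm, dist_eq_norm, ← map_sub]
    refine h4.trans_lt ?_
    rw [mul_div_assoc', div_lt_iff₀ (by positivity)]
    nlinarith
  exact le_of_tendsto_of_tendsto' h3.norm (h.tendsto_lim f).norm h1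

theorem IsPathUnits.isGroupoidCStarAlgebra {A : Type u} [NonUnitalCStarAlgebra A]
    {e : ∀ v : E.V, PathsTo S v → PathsTo S v → A} (h : IsPathUnits e) :
    IsGroupoidCStarAlgebra.{u, v} h.rep where
  isStarHom := h.isStarHom_rep
  denseRange := h.denseRange_rep
  norm_le _ _ _ _ _ hπ f := h.norm_le_norm_rep hπ f

end DirectedGraph

/-! ### The diagonal subalgebra -/

namespace DirectedGraph

open Leveled PointedPathGroupoid Filter Topology

variable {E : DirectedGraph} {S : Set E.V}

namespace PointedPathGroupoid

open Classical in
/-- Extension by zero of a function on the unit space. -/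
def extendUnits (g : UnitSpace E S → ℂ) (γ : E.PointedPathGroupoid S) : ℂ :=
  if h : γ.1.IsUnitArrow then g ⟨γ, h⟩ else 0

theorem extendUnits_of_unit (g : UnitSpace E S → ℂ) {γ : E.PointedPathGroupoid S}
    (h : γ.1.IsUnitArrow) : extendUnits g γ = g ⟨γ, h⟩ := dif_pos h

theorem extendUnits_of_not_unit (g : UnitSpace E S → ℂ) {γ : E.PointedPathGroupoid S}
    (h : ¬ γ.1.IsUnitArrow) : extendUnits g γ = 0 := dif_neg h

variable [Leveled E] {v : E.V}

theorem isZeroAtInfty_extendUnits (g : C₀(UnitSpace E S, ℂ)) :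
    IsZeroAtInfty (extendUnits (S := S) g) where
  continuous := by
    refine continuous_of_arr 0 fun v _ α β => ?_
    by_cases h : α = β
    · subst h
      have hu : ∀ z, (arr α α z).1.IsUnitArrow := fun z => (isUnitArrow_arr_iff α α z).2 rfl
      have : (fun z => extendUnits g (arr α α z)) =
          fun z => g (⟨arr α α z, hu z⟩ : UnitSpace E S) :=
        funext fun z => extendUnits_of_unit g (hu z)
      rw [this]
      exact g.continuous.comp ((isOpenEmbedding_arr α α).continuous.subtype_mk hu)
    · have : (fun z => extendUnits g (arr α β z)) = fun _ => 0 :=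
        funext fun z => extendUnits_of_not_unit g fun hu => h ((isUnitArrow_arr_iff α β z).1 hu)
      rw [this]
      exact continuous_const
  exists_isCompact ε hε := by
    have h1 := (Metric.tendsto_nhds.1 (ZeroAtInftyContinuousMapClass.zero_at_infty g)) ε hε
    obtain ⟨K, hK, hKg⟩ := mem_cocompact.1 h1
    refine ⟨Subtype.val '' K, hK.image continuous_subtype_val, fun γ hγ => ?_⟩
    by_cases hu : γ.1.IsUnitArrow
    · rw [extendUnits_of_unit g hu]
      have : (⟨γ, hu⟩ : UnitSpace E S) ∈ Kᶜ := fun h => hγ ⟨_, h, rfl⟩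
      simpa using hKg this
    · rwa [extendUnits_of_not_unit g hu, norm_zero]

/-- The indicator function of `Z(α, α)` on the unit space. -/
def indUnit (α : PathsTo S v) : C₀(UnitSpace E S, ℂ) where
  toFun x := ind α α x.1
  continuous_toFun := (ind α α).continuous.comp continuous_subtype_val
  zero_at_infty' := by
    refine tendsto_const_nhds.congr' ?_
    have hK : IsCompact (Subtype.val ⁻¹' cylinder α α : Set (UnitSpace E S)) := by
      rw [Subtype.isCompact_iff, Set.image_preimage_eq_of_subset]
      · exact isCompact_cylinder α α
      · rintro _ ⟨z, rfl⟩
        exact ⟨⟨_, (isUnitArrow_arr_iff α α z).2 rfl⟩, rfl⟩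
    filter_upwards [hK.compl_mem_cocompact] with x hx
    rw [ind_apply]
    exact (Set.indicator_of_notMem (s := cylinder α α) hx _).symm

theorem extendUnits_indUnit (α : PathsTo S v) :
    extendUnits (indUnit α : C₀(UnitSpace E S, ℂ)) = ind α α := by
  funext γ
  by_cases hu : γ.1.IsUnitArrow
  · exact extendUnits_of_unit _ hu
  · rw [extendUnits_of_not_unit _ hu, ind_apply, Set.indicator_of_notMem]
    rintro ⟨z, rfl⟩
    exact hu ((isUnitArrow_arr_iff α α z).2 rfl)

end PointedPathGroupoid

namespace IsPathUnits

variable [Leveled E] {v : E.V} {A : Type*} [NonUnitalCStarAlgebra A]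
  {e : ∀ v : E.V, PathsTo S v → PathsTo S v → A}

theorem approx_extendUnits_mul (h : IsPathUnits e) (n : ℕ) (g g' : UnitSpace E S → ℂ) :
    h.approx n (extendUnits (g * g')) = h.approx n (extendUnits g) * h.approx n (extendUnits g') := by
  have hu : ∀ g : UnitSpace E S → ℂ, ∀ γ : E.PointedPathGroupoid S, ¬ γ.1.IsUnitArrow →
      extendUnits g γ = 0 := fun g γ => extendUnits_of_not_unit g
  rw [approx_eq_hom, approx_eq_hom, approx_eq_hom, ← map_mul, sample_eq_diagonal (hu _),
    sample_eq_diagonal (hu _), sample_eq_diagonal (hu _)]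
  congr 1
  funext v
  rw [Pi.mul_apply, Matrix.diagonal_mul_diagonal]
  congr 1
  funext α
  have hα := (isUnitArrow_arr_iff α α (Tail.some v.1)).2 rfl
  rw [extendUnits_of_unit _ hα, extendUnits_of_unit _ hα, extendUnits_of_unit _ hα]
  rfl

theorem approx_extendUnits_star (h : IsPathUnits e) (n : ℕ) (g : UnitSpace E S → ℂ) :
    h.approx n (extendUnits (star g)) = star (h.approx n (extendUnits g)) := by
  rw [← h.approx_involution, involution_of_unit fun γ => extendUnits_of_not_unit g]
  congr 1
  funext γ
  by_cases hu : γ.1.IsUnitArrow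
  · simp [extendUnits_of_unit _ hu]
  · simp [extendUnits_of_not_unit _ hu]

theorem tendsto_extendUnits (h : IsPathUnits e) (g : C₀(UnitSpace E S, ℂ)) :
    Tendsto (fun n => h.approx n (extendUnits (S := S) g)) atTop
      (𝓝 (h.lim (extendUnits (S := S) g))) :=
  h.tendsto_lim_of_unit (isZeroAtInfty_extendUnits g) fun _ => extendUnits_of_not_unit g

/-- The *-homomorphism `C₀(𝒢⁰) → A` extending `h.rep` on `C_c(𝒢⁰)`. -/
def diagHom (h : IsPathUnits e) : C₀(UnitSpace E S, ℂ) →⋆ₙₐ[ℂ] A where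
  toFun g := h.lim (extendUnits (S := S) g)
  map_smul' c g := by
    refine tendsto_nhds_unique (h.tendsto_extendUnits (c • g)) ?_
    have : extendUnits (S := S) (c • g : C₀(UnitSpace E S, ℂ)) = c • extendUnits (S := S) g := by
      funext γ
      by_cases hu : γ.1.IsUnitArrow
      · simp [extendUnits_of_unit _ hu]
      · simp [extendUnits_of_not_unit _ hu]
    simp only [this, map_smul, MonoidHom.id_apply]
    exact (h.tendsto_extendUnits g).const_smul c
  map_zero' := by
    refine tendsto_nhds_unique (h.tendsto_extendUnits 0) ?_
    have : extendUnits (S := S) (0 : C₀(UnitSpace E S, ℂ)) = 0 := by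
      funext γ
      by_cases hu : γ.1.IsUnitArrow
      · simp [extendUnits_of_unit _ hu]
      · simp [extendUnits_of_not_unit _ hu]
    simp only [this, map_zero]
    exact tendsto_const_nhds
  map_add' g g' := by
    refine tendsto_nhds_unique (h.tendsto_extendUnits (g + g')) ?_
    have : extendUnits (S := S) (g + g' : C₀(UnitSpace E S, ℂ)) =
        extendUnits (S := S) g + extendUnits (S := S) g' := by
      funext γ
      by_cases hu : γ.1.IsUnitArrow
      · simp [extendUnits_of_unit _ hu]
      · simp [extendUnits_of_not_unit _ hu]
    simp only [this, map_add]
    exact (h.tendsto_extendUnits g).add (h.tendsto_extendUnits g')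
  map_mul' g g' := by
    refine tendsto_nhds_unique (h.tendsto_extendUnits (g * g')) ?_
    simp only [ZeroAtInftyContinuousMap.coe_mul, h.approx_extendUnits_mul]
    exact (h.tendsto_extendUnits g).mul (h.tendsto_extendUnits g')
  map_star' g := by
    refine tendsto_nhds_unique (h.tendsto_extendUnits (star g)) ?_
    simp only [ZeroAtInftyContinuousMap.coe_star, h.approx_extendUnits_star]
    exact (h.tendsto_extendUnits g).star

theorem diagHom_apply (h : IsPathUnits e) (g : C₀(UnitSpace E S, ℂ)) :
    h.diagHom g = h.lim (extendUnits (S := S) g) := rfl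

theorem diagHom_eq_rep (h : IsPathUnits e) (g : C₀(UnitSpace E S, ℂ))
    (f : C_c(E.PointedPathGroupoid S, ℂ)) (hf : ∀ γ, ¬ γ.1.IsUnitArrow → f γ = 0)
    (hfg : ∀ γ : UnitSpace E S, f γ.1 = g γ) : h.diagHom g = h.rep f := by
  have : extendUnits (S := S) g = f := by
    funext γ
    by_cases hu : γ.1.IsUnitArrow
    · rw [extendUnits_of_unit _ hu, ← hfg]
    · rw [extendUnits_of_not_unit _ hu, hf γ hu]
  rw [diagHom_apply, this, rep_apply]

theorem diagHom_indUnit (h : IsPathUnits e) (α : PathsTo S v) :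
    h.diagHom (indUnit α) = e v α α := by
  rw [diagHom_apply, extendUnits_indUnit, ← rep_apply, rep_ind]

theorem norm_e_pos (h : IsPathUnits e) (α : PathsTo S v) : 0 < ‖e v α α‖ :=
  norm_pos_iff.2 (h.ne_zero v α)

theorem norm_e_le (h : IsPathUnits e) (α β : PathsTo S v) : ‖e v α β‖ ≤ 1 :=
  (h.isMatrixUnits (lev v)).norm_le_one ⟨v, rfl⟩ α β

theorem norm_e_self (h : IsPathUnits e) (α : PathsTo S v) : ‖e v α α‖ = 1 := by
  have h1 : ‖e v α α‖ * ‖e v α α‖ = ‖e v α α‖ := by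
    rw [← CStarRing.norm_star_mul_self, h.star_eq, h.mul_same, if_pos rfl]
  exact mul_left_cancel₀ (h.norm_e_pos α).ne' (h1.trans (mul_one _).symm)

theorem norm_apply_le_norm_approx (h : IsPathUnits e) (f : E.PointedPathGroupoid S → ℂ)
    (α β : PathsTo S v) : ‖f (arr α β (Tail.some v))‖ ≤ ‖h.approx (lev v) f‖ := by
  have h1 := (h.isMatrixUnits (lev v)).mul_hom_mul (sample (lev v) f) ⟨v, rfl⟩ α α β α
  rw [← approx_eq_hom] at h1
  have h2 : ‖f (arr α β (Tail.some v)) • e v α α‖ ≤ ‖h.approx (lev v) f‖ := by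
    refine (congrArg norm h1).symm.trans_le ((norm_mul_le _ _).trans ?_)
    refine (mul_le_of_le_one_right (norm_nonneg _) (h.norm_e_le β α)).trans ((norm_mul_le _ _).trans ?_)
    exact mul_le_of_le_one_left (norm_nonneg _) (h.norm_e_le α α)
  rwa [norm_smul, h.norm_e_self, mul_one] at h2

theorem diagHom_injective (h : IsPathUnits e) : Function.Injective h.diagHom := by
  rw [injective_iff_map_eq_zero]
  intro g hg
  ext ⟨γ, hγ⟩
  have ht := h.tendsto_extendUnits g
  rw [← diagHom_apply, hg] at ht
  obtain ⟨m, hm⟩ := exists_mem_band γ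
  rw [ZeroAtInftyContinuousMap.coe_zero, Pi.zero_apply, ← norm_le_zero_iff]
  refine le_of_forall_pos_le_add fun ε hε => ?_
  obtain ⟨M, hM⟩ := (isZeroAtInfty_extendUnits g).exists_norm_sub_disc_le
    (show 0 < ε / 2 by positivity)
  obtain ⟨N, hN⟩ := Metric.tendsto_atTop.1 ht (ε / 2) (by positivity)
  let n := max (max m M) N
  obtain ⟨v, hv, α, β, z, rfl⟩ :=
    band_mono ((le_max_left m M).trans (le_max_left _ N)) hm
  have h1 := hM n ((le_max_right m M).trans (le_max_left _ N)) (arr α β z)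
  have h2 := hN n (le_max_right _ N)
  rw [disc_arr _ hv, extendUnits_of_unit _ hγ] at h1
  rw [dist_zero_right] at h2
  have h3 := h.norm_apply_le_norm_approx (extendUnits (S := S) g) α β
  have h4 : h.approx (lev v) (extendUnits (S := S) g) = h.approx n (extendUnits (S := S) g) := by
    rw [hv]
  rw [h4] at h3
  have h5 := norm_le_norm_sub_add (g ⟨arr α β z, hγ⟩)
    (extendUnits (S := S) g (arr α β (Tail.some v)))
  linarith

/-- The diagonal subalgebra, the image of `C₀(𝒢⁰)`. -/
def diag (h : IsPathUnits e) : NonUnitalStarSubalgebra ℂ A := NonUnitalStarAlgHom.range h.diagHom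

theorem e_mem_diag (h : IsPathUnits e) (α : PathsTo S v) : e v α α ∈ h.diag :=
  ⟨indUnit α, h.diagHom_indUnit α⟩

theorem isClosed_diag (h : IsPathUnits e) : IsClosed (h.diag : Set A) := by
  rw [diag, NonUnitalStarAlgHom.coe_range]
  exact (NonUnitalStarAlgHom.isometry h.diagHom h.diagHom_injective).isClosedEmbedding.isClosed_range

theorem diag_comm (h : IsPathUnits e) {b c : A} (hb : b ∈ h.diag) (hc : c ∈ h.diag) :
    b * c = c * b := by
  obtain ⟨f, rfl⟩ := hb
  obtain ⟨g, rfl⟩ := hc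
  exact (map_mul h.diagHom f g).symm.trans ((congrArg h.diagHom (mul_comm f g)).trans
    (map_mul h.diagHom g f))

/-- The diagonal is the closed span of the diagonal matrix units. -/
theorem mem_closure_of_mem_diag (h : IsPathUnits e) {b : A} (hb : b ∈ h.diag) :
    b ∈ closure (Submodule.span ℂ {a | ∃ v α, a = e v α α} : Set A) := by
  obtain ⟨g, rfl⟩ := hb
  refine mem_closure_of_tendsto (h.tendsto_extendUnits g) (Eventually.of_forall fun n => ?_)
  rw [h.approx_of_unit fun γ => extendUnits_of_not_unit g]
  exact sum_mem fun v _ => sum_mem fun α _ =>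
    Submodule.smul_mem _ _ (Submodule.subset_span ⟨v.1, α, rfl⟩)

end IsPathUnits

end DirectedGraph

/-! ### The conditional expectation -/

section Pinching

variable {A : Type*} [NonUnitalCStarAlgebra A] {κ : Type*} [Fintype κ] [DecidableEq κ] {p : κ → A}

theorem norm_sum_le_one_of_orthogonal (hp : ∀ i, star (p i) = p i)
    (hpp : ∀ i j, p i * p j = if i = j then p i else 0) : ‖∑ i, p i‖ ≤ 1 := by
  have h1 : star (∑ i, p i) * ∑ i, p i = ∑ i, p i := by
    simp [Finset.sum_mul, Finset.mul_sum, hp, hpp]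
  have h2 : ‖∑ i, p i‖ * ‖∑ i, p i‖ = ‖∑ i, p i‖ := by
    rw [← CStarRing.norm_star_mul_self, h1]
  nlinarith [norm_nonneg (∑ i, p i)]

/-- Compressing to the diagonal blocks given by orthogonal projections does not increase the
norm. -/
theorem norm_sum_compression_le [PartialOrder A] [StarOrderedRing A] (hp : ∀ i, star (p i) = p i)
    (hpp : ∀ i j, p i * p j = if i = j then p i else 0) (a : A) :
    ‖∑ i, p i * a * p i‖ ≤ ‖a‖ := by
  have h1 : star (∑ i, p i * a * p i) * ∑ i, p i * a * p i =
      ∑ i, p i * (star a * p i * a) * p i := by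
    rw [star_sum, Finset.sum_mul]
    refine Finset.sum_congr rfl fun i _ => ?_
    rw [Finset.mul_sum, Finset.sum_eq_single i]
    · calc star (p i * a * p i) * (p i * a * p i)
          = p i * star a * ((p i * p i) * a) * p i := by simp [hp, mul_assoc]
        _ = _ := by simp [hpp, mul_assoc]
    · intro j _ hj
      calc star (p i * a * p i) * (p j * a * p j)
          = p i * star a * ((p i * p j) * a) * p j := by simp [hp, mul_assoc]
        _ = 0 := by simp [hpp, hj.symm]
    · simp
  have h2 : ∀ i, p i * (star a * p i * a) * p i ≤ ‖star a * a‖ • p i := fun i => by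
    have h3 : star a * p i * a ≤ star a * a := by
      rw [← sub_nonneg]
      have : star a * a - star a * p i * a = star (a - p i * a) * (a - p i * a) := by
        have h4 : p i * (p i * a) = p i * a := by rw [← mul_assoc, hpp, if_pos rfl]
        simp only [star_sub, star_mul, hp, sub_mul, mul_sub, mul_assoc, h4]
        abel
      rw [this]
      exact star_mul_self_nonneg _
    have h5 := star_left_conjugate_le_conjugate h3 (p i)
    have h6 := CStarAlgebra.star_left_conjugate_le_norm_smul (a := p i) (b := star a * a)
      (IsSelfAdjoint.star_mul_self a)
    rw [hp] at h5 h6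
    rw [hpp, if_pos rfl] at h6
    exact h5.trans h6
  have h7 : ‖∑ i, p i * (star a * p i * a) * p i‖ ≤ ‖star a * a‖ := by
    have h8 : (0 : A) ≤ ∑ i, p i * (star a * p i * a) * p i :=
      h1 ▸ star_mul_self_nonneg _
    have h9 : ∑ i, p i * (star a * p i * a) * p i ≤ ‖star a * a‖ • ∑ i, p i := by
      rw [Finset.smul_sum]
      exact Finset.sum_le_sum fun i _ => h2 i
    refine (CStarAlgebra.norm_le_norm_of_nonneg_of_le h8 h9).trans ?_
    rw [norm_smul, norm_norm]
    exact mul_le_of_le_one_right (norm_nonneg _) (norm_sum_le_one_of_orthogonal hp hpp)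
  refine abs_le_of_sq_le_sq' ?_ (norm_nonneg a) |>.2
  rw [sq, sq, ← CStarRing.norm_star_mul_self, ← CStarRing.norm_star_mul_self, h1]
  exact h7

end Pinching

namespace DirectedGraph

open Leveled PointedPathGroupoid Filter Topology

variable {E : DirectedGraph} {S : Set E.V}

theorem PathsTo.sigma_snoc_injective {v : E.V} (α β : PathsTo S v) {g g' : Out E v}
    (h : (⟨E.r g.1, α.snoc g⟩ : Σ w, PathsTo S w) = ⟨E.r g'.1, β.snoc g'⟩) : α = β ∧ g = g' := by
  have h1 := congrArg (fun x : Σ w, PathsTo S w => x.2.1.edges) h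
  have h2 := congrArg (fun x : Σ w, PathsTo S w => x.2.1.source) h
  simp only [snoc, FinPath.snoc] at h1 h2
  obtain ⟨h3, h4⟩ := List.append_inj' h1 rfl
  exact ⟨Subtype.ext (FinPath.ext h2 h3), Subtype.ext (List.singleton_injective h4)⟩

namespace IsPathUnits

variable [Leveled E] {v : E.V} {A : Type*} [NonUnitalCStarAlgebra A]
  {e : ∀ v : E.V, PathsTo S v → PathsTo S v → A}

/-- The index set of the diagonal matrix units of level `n`. -/
abbrev Level (S : Set E.V) (n : ℕ) : Type := Σ v : {v : E.V // lev v = n}, PathsTo S v.1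

instance (n : ℕ) : DecidableEq (Level S n) := Classical.decEq _

/-- The diagonal matrix units of level `n`. -/
def proj (e : ∀ v : E.V, PathsTo S v → PathsTo S v → A) {n : ℕ} (x : Level S n) : A :=
  e x.1.1 x.2 x.2

theorem star_proj (h : IsPathUnits e) {n : ℕ} (x : Level S n) : star (proj e x) = proj e x :=
  h.star_eq _ _ _

theorem proj_mul_proj (h : IsPathUnits e) {n : ℕ} (x y : Level S n) :
    proj e x * proj e y = if x = y then proj e x else 0 := by
  split_ifs with hxy
  · subst hxy
    exact (h.mul_same _ _ _ _ _).trans (if_pos rfl)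
  · obtain ⟨v, α⟩ := x
    obtain ⟨w, β⟩ := y
    rcases eq_or_ne v w with rfl | hvw
    · exact (h.mul_same _ _ _ _ _).trans (if_neg fun hαβ => hxy (congrArg (Sigma.mk v) hαβ))
    · exact h.mul_ne _ _ _ _ _ _ (v.2.trans w.2.symm) fun h => hvw (Subtype.ext h)

theorem e_mul_e_of_ne (h : IsPathUnits e) {w : E.V} (hvw : lev v = lev w) {α : PathsTo S v}
    {β : PathsTo S w} (hne : (⟨v, α⟩ : Σ v, PathsTo S v) ≠ ⟨w, β⟩) :
    e v α α * e w β β = 0 := by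
  rcases eq_or_ne v w with rfl | hvw'
  · rw [h.mul_same, if_neg fun hαβ => hne (by rw [hαβ])]
  · exact h.mul_ne _ _ _ _ _ _ hvw hvw'

theorem proj_mem_diag (h : IsPathUnits e) {n : ℕ} (x : Level S n) : proj e x ∈ h.diag :=
  h.e_mem_diag x.2

/-- A diagonal matrix unit is minimal relative to those of earlier levels. -/
theorem exists_proj_mul (h : IsPathUnits e) {n : ℕ} (hn : lev v ≤ n) (α : PathsTo S v)
    (x : Level S n) : ∃ c : ℂ, proj e x * e v α α = c • proj e x := by
  refine ⟨sample n (ind α α) x.1 x.2 x.2, ?_⟩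
  have h1 := (h.isMatrixUnits n).mul_hom_mul (sample n (ind α α)) x.1 x.2 x.2 x.2 x.2
  rw [← h.approx_eq_hom, h.approx_ind hn] at h1
  change proj e x * e v α α * proj e x = _ • proj e x at h1
  rw [← h1, mul_assoc, h.diag_comm (h.e_mem_diag α) (h.proj_mem_diag x), ← mul_assoc,
    h.proj_mul_proj, if_pos rfl]

/-- The compression to the diagonal of the matrix algebra of level `n`. -/
def expect (e : ∀ v : E.V, PathsTo S v → PathsTo S v → A) (n : ℕ) : A →ₗ[ℂ] A where
  toFun a := ∑ x : Level S n, proj e x * a * proj e x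
  map_add' a b := by simp [mul_add, add_mul, Finset.sum_add_distrib]
  map_smul' c a := by simp [mul_smul_comm, smul_mul_assoc, Finset.smul_sum]

theorem expect_apply (n : ℕ) (a : A) :
    expect e n a = ∑ x : Level S n, proj e x * a * proj e x := rfl

theorem expect_mul_left (h : IsPathUnits e) (n : ℕ) {b : A} (hb : b ∈ h.diag) (a : A) :
    expect e n (b * a) = b * expect e n a := by
  rw [expect_apply, expect_apply, Finset.mul_sum]
  refine Finset.sum_congr rfl fun x _ => ?_
  rw [← mul_assoc, ← h.diag_comm hb (h.proj_mem_diag x)]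
  simp only [mul_assoc]

theorem expect_mul_right (h : IsPathUnits e) (n : ℕ) {b : A} (hb : b ∈ h.diag) (a : A) :
    expect e n (a * b) = expect e n a * b := by
  rw [expect_apply, expect_apply, Finset.sum_mul]
  refine Finset.sum_congr rfl fun x _ => ?_
  rw [mul_assoc, mul_assoc, h.diag_comm hb (h.proj_mem_diag x)]
  simp only [mul_assoc]

theorem expect_star (h : IsPathUnits e) (n : ℕ) (a : A) :
    expect e n (star a) = star (expect e n a) := by
  simp only [expect_apply, star_sum, star_mul, h.star_proj, mul_assoc]

theorem expect_e (h : IsPathUnits e) {n : ℕ} (hn : lev v ≤ n) (α β : PathsTo S v) :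
    expect e n (e v α β) = if α = β then e v α α else 0 := by
  obtain ⟨k, rfl⟩ := Nat.exists_eq_add_of_le hn
  clear hn
  induction k generalizing v with
  | zero =>
    rw [expect_apply, Finset.sum_eq_single ⟨⟨v, rfl⟩, α⟩]
    · simp only [proj, h.mul_same, if_true, eq_comm]
    · rintro ⟨w, γ⟩ - hne
      rcases eq_or_ne w ⟨v, rfl⟩ with rfl | hw
      · simp only [proj]
        rw [h.mul_same, if_neg fun hγ => hne (by rw [hγ]), zero_mul]
      · simp only [proj]
        rw [h.mul_ne _ _ _ _ _ _ w.2 fun h => hw (Subtype.ext h), zero_mul]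
    · simp
  | succ k ih =>
    rw [h.split, map_sum]
    have h1 : ∀ g : Out E v, expect e (lev v + (k + 1)) (e (E.r g.1) (α.snoc g) (β.snoc g)) =
        if α = β then e (E.r g.1) (α.snoc g) (α.snoc g) else 0 := fun g => by
      have hlev : lev v + (k + 1) = lev (E.r g.1) + k := by
        rw [lev_r, g.2]
        omega
      rw [hlev, ih]
      simp only [(PathsTo.snoc_injective g).eq_iff]
    simp only [h1]
    split_ifs
    · rw [h.split v α α]
    · simp

/-- Compression kills the corner between distinct diagonal matrix units of the same level. -/
theorem expect_corner (h : IsPathUnits e) {w : E.V} (hvw : lev v = lev w) {n : ℕ} (hn : lev v ≤ n)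
    {α : PathsTo S v} {β : PathsTo S w} (hne : (⟨v, α⟩ : Σ v, PathsTo S v) ≠ ⟨w, β⟩) (a : A) :
    expect e n (e v α α * a * e w β β) = 0 := by
  rw [expect_apply]
  refine Finset.sum_eq_zero fun x _ => ?_
  obtain ⟨c, hc⟩ := h.exists_proj_mul hn α x
  obtain ⟨d, hd⟩ := h.exists_proj_mul (hvw ▸ hn) β x
  have h1 : (c * d) • proj e x = 0 := by
    rw [mul_smul, ← hd, ← smul_mul_assoc, ← hc, mul_assoc, h.e_mul_e_of_ne hvw hne, mul_zero]
  have h2 : c * d = 0 := (smul_eq_zero.1 h1).resolve_right (h.ne_zero _ _)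
  calc proj e x * (e v α α * a * e w β β) * proj e x
      = (proj e x * e v α α) * a * (e w β β * proj e x) := by simp only [mul_assoc]
    _ = (c * d) • (proj e x * a * proj e x) := by
        rw [h.diag_comm (h.e_mem_diag β) (h.proj_mem_diag x), hc, hd, smul_mul_assoc,
          smul_mul_smul_comm]
    _ = 0 := by rw [h2, zero_smul]

/-- Compression is equivariant for conjugation by matrix units: both sides are compared edge by
edge down to level `n`, where the identity is evident. -/
theorem expect_conj (h : IsPathUnits e) {n : ℕ} (hn : lev v ≤ n) (α β : PathsTo S v) (a : A) :
    expect e n (e v β α * a * e v α β) = e v β α * expect e n a * e v α β := by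
  obtain ⟨k, rfl⟩ := Nat.exists_eq_add_of_le hn
  clear hn
  induction k generalizing v with
  | zero =>
    have h1 : ∀ γ : PathsTo S v, ∀ x : Level S (lev v + 0), x ≠ ⟨⟨v, rfl⟩, γ⟩ →
        ∀ δ, proj e x * e v γ δ = 0 := by
      rintro γ ⟨w, δ⟩ hne ε
      rcases eq_or_ne w ⟨v, rfl⟩ with rfl | hw
      · exact (h.mul_same _ _ _ _ _).trans (if_neg fun hγ => hne (congrArg (Sigma.mk _) hγ))
      · exact h.mul_ne _ _ _ _ _ _ w.2 fun h => hw (Subtype.ext h)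
    rw [expect_apply, expect_apply, Finset.sum_eq_single ⟨⟨v, rfl⟩, β⟩, Finset.mul_sum,
      Finset.sum_mul, Finset.sum_eq_single ⟨⟨v, rfl⟩, α⟩]
    · have h2 : ∀ γ δ : PathsTo S v, e v γ γ * e v γ δ = e v γ δ := fun γ δ => by
        rw [h.mul_same, if_pos rfl]
      have h3 : ∀ γ δ : PathsTo S v, e v γ δ * e v δ δ = e v γ δ := fun γ δ => by
        rw [h.mul_same, if_pos rfl]
      calc e v β β * (e v β α * a * e v α β) * e v β β
          = (e v β β * e v β α) * a * (e v α β * e v β β) := by simp only [mul_assoc]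
        _ = (e v β α * e v α α) * a * (e v α α * e v α β) := by rw [h2, h3, h2, h3]
        _ = e v β α * (e v α α * a * e v α α) * e v α β := by simp only [mul_assoc]
    · intro x _ hx
      rw [mul_assoc, mul_assoc, h1 α x hx, mul_zero, mul_zero]
    · simp
    · intro x _ hx
      rw [← mul_assoc, ← mul_assoc, h1 β x hx, zero_mul, zero_mul, zero_mul]
    · simp
  | succ k ih =>
    have hl : ∀ g : Out E v, lev v + (k + 1) = lev (E.r g.1) + k := fun g => by
      rw [lev_r, g.2]
      omega
    have hl' : ∀ g : Out E v, lev (E.r g.1) ≤ lev v + (k + 1) := fun g => by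
      rw [hl g]
      exact Nat.le_add_right _ _
    have hc : ∀ g g' : Out E v, g ≠ g' → ∀ (γ : PathsTo S v) (b : A),
        expect e (lev v + (k + 1)) (e (E.r g.1) (γ.snoc g) (γ.snoc g) * b *
          e (E.r g'.1) (γ.snoc g') (γ.snoc g')) = 0 := fun g g' hg γ b =>
      h.expect_corner (by rw [lev_r, lev_r, g.2, g'.2]) (hl' g)
        (fun heq => hg (PathsTo.sigma_snoc_injective γ γ heq).2) b
    have h2 : ∀ (g : Out E v) (γ δ : PathsTo S v), e (E.r g.1) (γ.snoc g) (γ.snoc g) *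
        e (E.r g.1) (γ.snoc g) (δ.snoc g) = e (E.r g.1) (γ.snoc g) (δ.snoc g) := fun g γ δ => by
      rw [h.mul_same, if_pos rfl]
    have h3 : ∀ (g : Out E v) (γ δ : PathsTo S v), e (E.r g.1) (γ.snoc g) (δ.snoc g) *
        e (E.r g.1) (δ.snoc g) (δ.snoc g) = e (E.r g.1) (γ.snoc g) (δ.snoc g) := fun g γ δ => by
      rw [h.mul_same, if_pos rfl]
    rw [h.split v β α, h.split v α β]
    simp only [Finset.sum_mul, Finset.mul_sum, map_sum]
    refine Finset.sum_congr rfl fun g' _ => Finset.sum_congr rfl fun g _ => ?_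
    rcases eq_or_ne g g' with rfl | hg
    · rw [hl g]
      exact ih _ _
    · have h4 := hc g g' hg α a
      rw [h.expect_mul_right _ (h.e_mem_diag _), h.expect_mul_left _ (h.e_mem_diag _)] at h4
      have h5 := hc g g' hg β (e (E.r g.1) (β.snoc g) (α.snoc g) * a *
        e (E.r g'.1) (α.snoc g') (β.snoc g'))
      have h6 : e (E.r g.1) (β.snoc g) (β.snoc g) * (e (E.r g.1) (β.snoc g) (α.snoc g) * a *
          e (E.r g'.1) (α.snoc g') (β.snoc g')) * e (E.r g'.1) (β.snoc g') (β.snoc g') =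
          e (E.r g.1) (β.snoc g) (α.snoc g) * a * e (E.r g'.1) (α.snoc g') (β.snoc g') := by
        rw [← mul_assoc, ← mul_assoc, h2 g β α, mul_assoc _ _ (e _ (β.snoc g') _), h3 g' α β]
      rw [← h6, h5, ← h3 g β α, ← h2 g' α β]
      calc (0 : A) = e (E.r g.1) (β.snoc g) (α.snoc g) * 0 *
            e (E.r g'.1) (α.snoc g') (β.snoc g') := by simp
        _ = _ := by
            rw [← h4]
            simp only [mul_assoc]

/-- A closed property of vectors that is stable under linear combinations holds everywhere as soon
as it holds for the matrix units. -/
theorem forall_mem_of_isClosed (h : IsPathUnits e) {V : Submodule ℂ A}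
    (hV : IsClosed (V : Set A)) (he : ∀ v α β, e v α β ∈ V) (a : A) : a ∈ V := by
  refine closure_minimal ?_ hV (h.dense a)
  rw [SetLike.coe_subset_coe, Submodule.span_le]
  rintro _ ⟨v, α, β, rfl⟩
  exact he v α β

section Order

variable [PartialOrder A] [StarOrderedRing A]

theorem norm_expect_le (h : IsPathUnits e) (n : ℕ) (a : A) : ‖expect e n a‖ ≤ ‖a‖ :=
  norm_sum_compression_le h.star_proj h.proj_mul_proj a

theorem exists_tendsto_expect (h : IsPathUnits e) (a : A) :
    ∃ b, Tendsto (fun n => expect e n a) atTop (𝓝 b) := by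
  have h1 : ∀ c ∈ Submodule.span ℂ {a | ∃ v α β, a = e v α β},
      ∃ b, ∀ᶠ n in atTop, expect e n c = b := by
    intro c hc
    induction hc using Submodule.span_induction with
    | mem c hc =>
      obtain ⟨v, α, β, rfl⟩ := hc
      exact ⟨_, (eventually_ge_atTop (lev v)).mono fun n hn => h.expect_e hn α β⟩
    | zero => exact ⟨0, Eventually.of_forall fun n => map_zero _⟩
    | add c d _ _ hc hd =>
      obtain ⟨b, hb⟩ := hc
      obtain ⟨b', hb'⟩ := hd
      refine ⟨b + b', ?_⟩
      filter_upwards [hb, hb'] with n hn hn'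
      rw [map_add, hn, hn']
    | smul t c _ hc =>
      obtain ⟨b, hb⟩ := hc
      refine ⟨t • b, ?_⟩
      filter_upwards [hb] with n hn
      rw [map_smul, hn]
  refine cauchySeq_tendsto_of_complete (Metric.cauchySeq_iff'.2 fun ε hε => ?_)
  obtain ⟨c, hc, hca⟩ := Metric.dense_iff.1 h.dense a (ε / 2) (by positivity)
  obtain ⟨b, hb⟩ := h1 c hca
  obtain ⟨N, hN⟩ := eventually_atTop.1 hb
  refine ⟨N, fun n hn => ?_⟩
  have h2 : expect e n a - expect e N a = expect e n (a - c) - expect e N (a - c) := by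
    rw [map_sub, map_sub, hN n hn, hN N le_rfl]
    abel
  rw [Metric.mem_ball, dist_comm, dist_eq_norm] at hc
  rw [dist_eq_norm, h2]
  have h3 := norm_sub_le (expect e n (a - c)) (expect e N (a - c))
  have h4 := h.norm_expect_le n (a - c)
  have h5 := h.norm_expect_le N (a - c)
  linarith

/-- The conditional expectation onto the diagonal subalgebra. -/
def cexp (h : IsPathUnits e) : A →ₗ[ℂ] A where
  toFun a := (h.exists_tendsto_expect a).choose
  map_add' a b := by
    refine tendsto_nhds_unique (h.exists_tendsto_expect (a + b)).choose_spec ?_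
    simp only [map_add]
    exact (h.exists_tendsto_expect a).choose_spec.add (h.exists_tendsto_expect b).choose_spec
  map_smul' c a := by
    refine tendsto_nhds_unique (h.exists_tendsto_expect (c • a)).choose_spec ?_
    simp only [map_smul, RingHom.id_apply]
    exact (h.exists_tendsto_expect a).choose_spec.const_smul c

theorem tendsto_expect (h : IsPathUnits e) (a : A) :
    Tendsto (fun n => expect e n a) atTop (𝓝 (h.cexp a)) :=
  (h.exists_tendsto_expect a).choose_spec

theorem norm_cexp_le (h : IsPathUnits e) (a : A) : ‖h.cexp a‖ ≤ ‖a‖ :=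
  le_of_tendsto' (h.tendsto_expect a).norm fun n => h.norm_expect_le n a

theorem continuous_cexp (h : IsPathUnits e) : Continuous h.cexp :=
  AddMonoidHomClass.continuous_of_bound h.cexp 1 fun a => by
    rw [one_mul]
    exact h.norm_cexp_le a

theorem cexp_nonneg (h : IsPathUnits e) {a : A} (ha : 0 ≤ a) : 0 ≤ h.cexp a :=
  ge_of_tendsto' (h.tendsto_expect a) fun n => Finset.sum_nonneg fun x _ => by
    have := star_left_conjugate_nonneg ha (proj e x)
    rwa [h.star_proj] at this

theorem cexp_star (h : IsPathUnits e) (a : A) : h.cexp (star a) = star (h.cexp a) := by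
  refine tendsto_nhds_unique (h.tendsto_expect (star a)) ?_
  simp only [h.expect_star]
  exact (h.tendsto_expect a).star

theorem cexp_mul_left (h : IsPathUnits e) {b : A} (hb : b ∈ h.diag) (a : A) :
    h.cexp (b * a) = b * h.cexp a := by
  refine tendsto_nhds_unique (h.tendsto_expect (b * a)) ?_
  simp only [h.expect_mul_left _ hb]
  exact (h.tendsto_expect a).const_mul b

theorem cexp_mul_right (h : IsPathUnits e) {b : A} (hb : b ∈ h.diag) (a : A) :
    h.cexp (a * b) = h.cexp a * b := by
  refine tendsto_nhds_unique (h.tendsto_expect (a * b)) ?_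
  simp only [h.expect_mul_right _ hb]
  exact (h.tendsto_expect a).mul_const b

theorem cexp_e (h : IsPathUnits e) (α β : PathsTo S v) :
    h.cexp (e v α β) = if α = β then e v α α else 0 := by
  refine tendsto_nhds_unique (h.tendsto_expect _) (tendsto_const_nhds.congr' ?_)
  filter_upwards [eventually_ge_atTop (lev v)] with n hn
  exact (h.expect_e hn α β).symm

theorem cexp_conj (h : IsPathUnits e) (α β : PathsTo S v) (a : A) :
    h.cexp (e v β α * a * e v α β) = e v β α * h.cexp a * e v α β := by
  refine tendsto_nhds_unique (h.tendsto_expect _)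
    ((((h.tendsto_expect a).const_mul _).mul_const _).congr' ?_)
  filter_upwards [eventually_ge_atTop (lev v)] with n hn
  exact (h.expect_conj hn α β a).symm

theorem cexp_mem (h : IsPathUnits e) (a : A) : h.cexp a ∈ h.diag := by
  refine h.forall_mem_of_isClosed (V := h.diag.toSubmodule.comap h.cexp)
    (h.isClosed_diag.preimage h.continuous_cexp) (fun v α β => ?_) a
  rw [Submodule.mem_comap, h.cexp_e]
  split_ifs
  · exact h.e_mem_diag α
  · exact zero_mem _

theorem cexp_eq (h : IsPathUnits e) {b : A} (hb : b ∈ h.diag) : h.cexp b = b := by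
  refine closure_minimal (t := {b | h.cexp b = b}) ?_
    (isClosed_eq h.continuous_cexp continuous_id) (h.mem_closure_of_mem_diag hb)
  refine (Submodule.span_le (p := LinearMap.eqLocus h.cexp LinearMap.id)).2 ?_
  rintro _ ⟨v, α, rfl⟩
  exact (h.cexp_e α α).trans (if_pos rfl)

theorem isConditionalExpectation (h : IsPathUnits e) :
    IsConditionalExpectation h.diag h.cexp where
  map_mem := h.cexp_mem
  map_eq _ := h.cexp_eq
  map_nonneg _ := h.cexp_nonneg
  norm_map_le := h.norm_cexp_le
  map_mul_left _ := h.cexp_mul_left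
  map_mul_right _ := h.cexp_mul_right

end Order

end IsPathUnits

end DirectedGraph

namespace DirectedGraph

open Leveled PointedPathGroupoid Filter Topology

variable {E : DirectedGraph} {S : Set E.V}

namespace IsPathUnits

variable [Leveled E] {v : E.V} {A : Type*} [NonUnitalCStarAlgebra A]
  {e : ∀ v : E.V, PathsTo S v → PathsTo S v → A}

/-! ### Faithfulness of the conditional expectation -/

theorem eventually_mem_range_hom (h : IsPathUnits e) {c : A}
    (hc : c ∈ Submodule.span ℂ {a | ∃ v α β, a = e v α β}) :
    ∀ᶠ n in atTop, ∃ M, (h.isMatrixUnits n).hom M = c := by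
  induction hc using Submodule.span_induction with
  | mem c hc =>
    obtain ⟨v, α, β, rfl⟩ := hc
    filter_upwards [eventually_ge_atTop (lev v)] with n hn
    exact ⟨sample n (ind α β), h.approx_ind hn α β⟩
  | zero => exact Eventually.of_forall fun n => ⟨0, map_zero _⟩
  | add c d _ _ hc hd =>
    filter_upwards [hc, hd] with n hn hn'
    obtain ⟨M, rfl⟩ := hn
    obtain ⟨N, rfl⟩ := hn'
    exact ⟨M + N, map_add _ _ _⟩
  | smul t c _ hc =>
    filter_upwards [hc] with n hn
    obtain ⟨M, rfl⟩ := hn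
    exact ⟨t • M, map_smul _ _ _⟩

section Faithful

variable [PartialOrder A] [StarOrderedRing A]

theorem cexp_star_mul_self_add (h : IsPathUnits e) {a b : A} (ha : h.cexp (star a * a) = 0)
    (hb : h.cexp (star b * b) = 0) : h.cexp (star (a + b) * (a + b)) = 0 := by
  have h1 : h.cexp (star (a + b) * (a + b)) + h.cexp (star (a - b) * (a - b)) = 0 := by
    have : star (a + b) * (a + b) + star (a - b) * (a - b) =
        (2 : ℂ) • (star a * a) + (2 : ℂ) • (star b * b) := by
      simp only [star_add, star_sub, add_mul, mul_add, sub_mul, mul_sub, two_smul]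
      abel
    rw [← map_add, this, map_add, map_smul, map_smul, ha, hb, smul_zero, add_zero]
  exact ((add_eq_zero_iff_of_nonneg (h.cexp_nonneg (star_mul_self_nonneg _))
    (h.cexp_nonneg (star_mul_self_nonneg _))).1 h1).1

/-- The left kernel of the conditional expectation is stable under right multiplication by the
columns of the matrix algebras. -/
theorem cexp_star_mul_self_mul_column (h : IsPathUnits e) {a : A}
    (ha : h.cexp (star a * a) = 0) (ξ : PathsTo S v → ℂ) (β : PathsTo S v) :
    h.cexp (star (a * ∑ α, ξ α • e v α β) * (a * ∑ α, ξ α • e v α β)) = 0 := by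
  rw [Finset.mul_sum]
  induction (Finset.univ : Finset (PathsTo S v)) using Finset.induction_on with
  | empty => simp
  | insert α s hα ih =>
    rw [Finset.sum_insert hα]
    refine h.cexp_star_mul_self_add ?_ ih
    have : star (a * ξ α • e v α β) * (a * ξ α • e v α β) =
        (star (ξ α) * ξ α) • (e v β α * (star a * a) * e v α β) := by
      rw [mul_smul_comm, star_smul, smul_mul_smul_comm, star_mul, h.star_eq]
      simp only [mul_assoc]
    rw [this, map_smul, h.cexp_conj, ha, mul_zero, zero_mul, smul_zero]

/-- The conditional expectation is faithful. An element `c` of a matrix algebra near `a` almost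
attains its norm on a column `q`, and `a q` is in the left kernel of the expectation along with
`a`; so `(c q)* (c q)`, which is a multiple of a diagonal matrix unit, is small. -/
theorem cexp_faithful (h : IsPathUnits e) {a : A} (ha : h.cexp (star a * a) = 0) : a = 0 := by
  have key : ∀ c ∈ Submodule.span ℂ {a | ∃ v α β, a = e v α β},
      ‖c‖ ^ 2 ≤ 4 * (‖c - a‖ * (‖c‖ + ‖a‖)) := by
    intro c hc
    obtain ⟨n, M, rfl⟩ := (h.eventually_mem_range_hom hc).exists
    rcases eq_or_ne M 0 with rfl | hM
    · rw [map_zero, norm_zero, zero_pow two_ne_zero]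
      positivity
    obtain ⟨w, β, ξ, t, hq, ht, hcq⟩ := (h.isMatrixUnits n).exists_column M hM
    set c := (h.isMatrixUnits n).hom M
    set q := ∑ α, ξ α • e w.1 α β
    have hcM : ‖c‖ ≤ 2 * t := by
      have := (h.isMatrixUnits n).norm_hom_le M
      linarith
    have h1 : h.cexp (star (c * q) * (c * q)) = ((t ^ 2 : ℝ) : ℂ) • e w.1 β β := by
      rw [hcq, map_smul, h.cexp_e, if_pos rfl]
    have h2 : h.cexp (star (a * q) * (a * q)) = 0 := h.cexp_star_mul_self_mul_column ha ξ β
    have h3 : t ^ 2 ≤ ‖star (c * q) * (c * q) - star (a * q) * (a * q)‖ := by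
      refine le_trans ?_ (h.norm_cexp_le _)
      rw [map_sub, h1, h2, sub_zero, norm_smul, h.norm_e_self, mul_one, Complex.norm_real,
        Real.norm_of_nonneg (by positivity)]
    have h4 : star (c * q) * (c * q) - star (a * q) * (a * q) =
        star (c * q) * ((c - a) * q) + star ((c - a) * q) * (a * q) := by
      simp only [star_mul, star_sub, mul_sub, sub_mul, mul_assoc]
      abel
    have h5 : ∀ x : A, ‖x * q‖ ≤ ‖x‖ := fun x =>
      (norm_mul_le _ _).trans (mul_le_of_le_one_right (norm_nonneg _) hq)
    have h6 : ‖star (c * q) * ((c - a) * q)‖ ≤ ‖c‖ * ‖c - a‖ := by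
      refine (norm_mul_le _ _).trans ?_
      rw [norm_star]
      exact mul_le_mul (h5 _) (h5 _) (norm_nonneg _) (norm_nonneg _)
    have h7 : ‖star ((c - a) * q) * (a * q)‖ ≤ ‖c - a‖ * ‖a‖ := by
      refine (norm_mul_le _ _).trans ?_
      rw [norm_star]
      exact mul_le_mul (h5 _) (h5 _) (norm_nonneg _) (norm_nonneg _)
    rw [h4] at h3
    have h8 := norm_add_le (star (c * q) * ((c - a) * q)) (star ((c - a) * q) * (a * q))
    nlinarith [norm_nonneg c]
  have hcl : IsClosed {c : A | ‖c‖ ^ 2 ≤ 4 * (‖c - a‖ * (‖c‖ + ‖a‖))} :=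
    isClosed_le (by fun_prop) (by fun_prop)
  have h1 : ‖a‖ ^ 2 ≤ 4 * (‖a - a‖ * (‖a‖ + ‖a‖)) := closure_minimal key hcl (h.dense a)
  rw [sub_self, norm_zero, zero_mul, mul_zero] at h1
  exact norm_eq_zero.1 (pow_eq_zero_iff two_ne_zero |>.1 (le_antisymm h1 (by positivity)))

end Faithful

/-! ### An approximate unit and a strictly positive element -/

/-- The unit of the matrix algebra of level `n`. -/
def levelUnit (e : ∀ v : E.V, PathsTo S v → PathsTo S v → A) (n : ℕ) : A :=
  ∑ x : Level S n, proj e x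

theorem levelUnit_mem_diag (h : IsPathUnits e) (n : ℕ) : levelUnit e n ∈ h.diag :=
  sum_mem fun x _ => h.proj_mem_diag x

theorem norm_levelUnit_le (h : IsPathUnits e) (n : ℕ) : ‖levelUnit e n‖ ≤ 1 :=
  norm_sum_le_one_of_orthogonal h.star_proj h.proj_mul_proj

theorem star_levelUnit (h : IsPathUnits e) (n : ℕ) : star (levelUnit e n) = levelUnit e n := by
  simp only [levelUnit, star_sum, h.star_proj]

theorem levelUnit_mul_self (h : IsPathUnits e) (n : ℕ) :
    levelUnit e n * levelUnit e n = levelUnit e n := by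
  simp [levelUnit, Finset.sum_mul, Finset.mul_sum, h.proj_mul_proj]

theorem levelUnit_mul_hom (h : IsPathUnits e) (n : ℕ)
    (M : ∀ v : {v : E.V // lev v = n}, Matrix (PathsTo S v.1) (PathsTo S v.1) ℂ) :
    levelUnit e n * (h.isMatrixUnits n).hom M = (h.isMatrixUnits n).hom M := by
  have : levelUnit e n = (h.isMatrixUnits n).hom 1 := by
    rw [IsMatrixUnits.hom_apply, levelUnit, Fintype.sum_sigma]
    refine Finset.sum_congr rfl fun v _ => Finset.sum_congr rfl fun α _ => ?_
    simp [Matrix.one_apply, proj]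
  rw [this, ← map_mul, one_mul]

theorem tendsto_levelUnit_mul (h : IsPathUnits e) (a : A) :
    Tendsto (fun n => levelUnit e n * a) atTop (𝓝 a) := by
  refine Metric.tendsto_atTop.2 fun ε hε => ?_
  obtain ⟨c, hc, hca⟩ := Metric.dense_iff.1 h.dense a (ε / 2) (by positivity)
  obtain ⟨N, hN⟩ := eventually_atTop.1 (h.eventually_mem_range_hom hca)
  refine ⟨N, fun n hn => ?_⟩
  obtain ⟨M, rfl⟩ := hN n hn
  set c := (h.isMatrixUnits n).hom M with hcM
  rw [Metric.mem_ball, dist_eq_norm] at hc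
  have h1 : levelUnit e n * a - a = (c - a) - levelUnit e n * (c - a) := by
    rw [mul_sub, hcM, h.levelUnit_mul_hom]
    abel
  rw [dist_eq_norm, h1]
  have h2 : ‖levelUnit e n * (c - a)‖ ≤ ‖c - a‖ :=
    (norm_mul_le _ _).trans (mul_le_of_le_one_left (norm_nonneg _) (h.norm_levelUnit_le n))
  have h3 := norm_sub_le (c - a) (levelUnit e n * (c - a))
  linarith

section Order

variable [PartialOrder A] [StarOrderedRing A]

theorem levelUnit_nonneg (h : IsPathUnits e) (n : ℕ) : 0 ≤ levelUnit e n := by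
  rw [← h.levelUnit_mul_self]
  nth_rewrite 1 [← h.star_levelUnit]
  exact star_mul_self_nonneg _

open PositiveLinearMap in
/-- A positive functional that vanishes on the units of all levels is zero. -/
theorem eq_zero_of_levelUnit (h : IsPathUnits e) (φ : A →ₚ[ℂ] ℂ)
    (hφ : ∀ n, φ (levelUnit e n) = 0) (a : A) : φ a = 0 := by
  have h1 : ∀ n, φ (levelUnit e n * a) = 0 := fun n => by
    have h2 := norm_inner_le_norm (𝕜 := ℂ) (φ.toPreGNS (levelUnit e n)) (φ.toPreGNS a)
    have h3 := φ.preGNS_norm_sq (φ.toPreGNS (levelUnit e n))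
    rw [φ.ofPreGNS_toPreGNS, h.star_levelUnit, h.levelUnit_mul_self, hφ] at h3
    have h4 : ‖φ.toPreGNS (levelUnit e n)‖ = 0 := by
      exact_mod_cast pow_eq_zero_iff two_ne_zero |>.1 h3
    rw [h4, zero_mul, φ.preGNS_inner_def, φ.ofPreGNS_toPreGNS, φ.ofPreGNS_toPreGNS,
      h.star_levelUnit] at h2
    exact norm_le_zero_iff.1 h2
  obtain ⟨C, hC⟩ := φ.exists_norm_apply_le
  have hcont : Continuous φ := AddMonoidHomClass.continuous_of_bound φ C hC
  refine tendsto_nhds_unique ((hcont.tendsto a).comp (h.tendsto_levelUnit_mul a)) ?_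
  exact tendsto_const_nhds.congr fun n => (h1 n).symm

theorem exists_isStrictlyPositiveIn (h : IsPathUnits e) :
    ∃ b ∈ h.diag, IsStrictlyPositiveIn b := by
  have hs : Summable fun n : ℕ => ((1 / 2 : ℝ) ^ n) • levelUnit e n := by
    refine Summable.of_norm_bounded summable_geometric_two fun n => ?_
    rw [norm_smul, Real.norm_of_nonneg (by positivity)]
    exact mul_le_of_le_one_right (by positivity) (h.norm_levelUnit_le n)
  have hn : ∀ n : ℕ, 0 ≤ ((1 / 2 : ℝ) ^ n) • levelUnit e n := fun n =>
    smul_nonneg (by positivity) (h.levelUnit_nonneg n)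
  have hle : ∀ n : ℕ, ((1 / 2 : ℝ) ^ n) • levelUnit e n ≤
      ∑' n : ℕ, ((1 / 2 : ℝ) ^ n) • levelUnit e n := fun n => hs.le_tsum n fun m _ => hn m
  refine ⟨∑' n : ℕ, ((1 / 2 : ℝ) ^ n) • levelUnit e n, ?_, tsum_nonneg hn, fun φ hφ => ?_⟩
  · refine h.isClosed_diag.mem_of_tendsto hs.hasSum (Eventually.of_forall fun s => ?_)
    refine sum_mem fun n _ => ?_
    rw [← Complex.coe_smul]
    exact SMulMemClass.smul_mem _ (h.levelUnit_mem_diag n)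
  · have h0 : 0 ≤ φ (∑' n : ℕ, ((1 / 2 : ℝ) ^ n) • levelUnit e n) :=
      map_nonneg φ (tsum_nonneg hn)
    refine lt_of_le_of_ne h0 fun heq => ?_
    obtain ⟨a, ha⟩ := hφ
    refine ha (h.eq_zero_of_levelUnit φ (fun n => ?_) a)
    have h1 : φ (((1 / 2 : ℝ) ^ n) • levelUnit e n) ≤ 0 := heq ▸ φ.monotone' (hle n)
    have h2 := le_antisymm h1 (map_nonneg φ (hn n))
    rw [← Complex.coe_smul, map_smul, smul_eq_zero] at h2
    exact h2.resolve_left (by simp)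

/-! ### Free normalizers of the diagonal -/

/-- The expectation vanishes on a free normalizer `a`: with `d` its value at `a`, both `a* a` and
`a a*` are in the diagonal and have product zero, `d (a* a) = (a a*) d`, hence `d (a* a) = 0`, and
`d* d ≤ a* a`. -/
theorem cexp_eq_zero_of_mem_freeNormalizers (h : IsPathUnits e) {a : A}
    (ha : a ∈ freeNormalizers h.diag) : h.cexp a = 0 := by
  obtain ⟨h1, h2, h3⟩ := ha
  have hs : star a * a ∈ h.diag := by
    refine h.isClosed_diag.mem_of_tendsto ((h.tendsto_levelUnit_mul a).const_mul (star a))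
      (Eventually.of_forall fun n => ?_)
    have := h1 _ (h.levelUnit_mem_diag n)
    rwa [mul_assoc] at this
  have hr : a * star a ∈ h.diag := by
    refine h.isClosed_diag.mem_of_tendsto ((h.tendsto_levelUnit_mul (star a)).const_mul a)
      (Eventually.of_forall fun n => ?_)
    have := h2 _ (h.levelUnit_mem_diag n)
    rwa [mul_assoc] at this
  set d := h.cexp a with hd
  have hdm : d ∈ h.diag := h.cexp_mem a
  have hsr : a * star a * (star a * a) = 0 := by
    have : star a * star a = 0 := by rw [← star_mul, h3, star_zero]
    rw [mul_assoc, ← mul_assoc (star a), this, zero_mul, mul_zero]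
  have hds : d * (star a * a) = a * star a * d := by
    rw [hd, ← h.cexp_mul_right hs, ← h.cexp_mul_left hr, mul_assoc]
  have hdss : d * (star a * a) * (star a * a) = 0 := by
    rw [hds, mul_assoc, h.diag_comm hdm hs, ← mul_assoc, hsr, zero_mul]
  have hds0 : d * (star a * a) = 0 := by
    rw [← CStarRing.mul_star_self_eq_zero_iff, star_mul (d) _,
      (IsSelfAdjoint.star_mul_self a).star_eq, ← mul_assoc, hdss, zero_mul]
  have hle : star d * d ≤ star a * a := by
    have h4 : h.cexp (star (a - d) * (a - d)) = star a * a - star d * d := by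
      have h5 : star (a - d) * (a - d) = star a * a - star d * a - star a * d + star d * d := by
        simp only [star_sub, sub_mul, mul_sub]
        abel
      rw [h5, map_add, map_sub, map_sub, h.cexp_eq hs, h.cexp_mul_left (star_mem hdm),
        h.cexp_mul_right hdm, h.cexp_star, ← hd, h.cexp_eq (mul_mem (star_mem hdm) hdm)]
      abel
    rw [← sub_nonneg, ← h4]
    exact h.cexp_nonneg (star_mul_self_nonneg _)
  have hdd : d * star d = 0 := by
    have h6 := star_left_conjugate_le_conjugate hle (star d)
    rw [star_star, hds0, zero_mul] at h6
    have h7 : d * (star d * d) * star d = star (d * star d) * (d * star d) := by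
      simp only [star_mul, star_star, mul_assoc]
    rw [h7] at h6
    exact CStarRing.star_mul_self_eq_zero_iff _ |>.1 (le_antisymm h6 (star_mul_self_nonneg _))
  exact CStarRing.mul_star_self_eq_zero_iff _ |>.1 hdd

theorem e_mem_freeNormalizers (h : IsPathUnits e) {α β : PathsTo S v} (hne : α ≠ β) :
    e v α β ∈ freeNormalizers h.diag := by
  have h1 : ∀ (α β : PathsTo S v), ∀ b ∈ h.diag, e v β α * b * e v α β ∈ h.diag :=
    fun α β b hb => by
      rw [← h.cexp_eq hb, ← h.cexp_conj]
      exact h.cexp_mem _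
  refine ⟨?_, ?_, ?_⟩
  · rw [h.star_eq]
    exact h1 α β
  · rw [h.star_eq]
    exact h1 β α
  · rw [h.mul_same, if_neg hne.symm]

theorem closure_span_freeNormalizers (h : IsPathUnits e) :
    closure (Submodule.span ℂ (freeNormalizers h.diag) : Set A) = {a | h.cexp a = 0} := by
  refine Set.Subset.antisymm ?_ fun a ha => ?_
  · refine closure_minimal ?_ (isClosed_eq h.continuous_cexp continuous_const)
    exact (Submodule.span_le (p := LinearMap.ker h.cexp)).2 fun a ha =>
      h.cexp_eq_zero_of_mem_freeNormalizers ha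
  · have hc : Continuous (LinearMap.id - h.cexp : A →ₗ[ℂ] A) :=
      continuous_id.sub h.continuous_cexp
    have h1 := h.forall_mem_of_isClosed
      (V := (Submodule.span ℂ (freeNormalizers h.diag)).topologicalClosure.comap
        (LinearMap.id - h.cexp))
      ((Submodule.isClosed_topologicalClosure _).preimage hc) (fun v α β => ?_) a
    · have h2 : a - h.cexp a ∈ (Submodule.span ℂ (freeNormalizers h.diag)).topologicalClosure := h1
      rw [show h.cexp a = 0 from ha, sub_zero] at h2
      exact h2
    · rw [Submodule.mem_comap, LinearMap.sub_apply, LinearMap.id_apply, h.cexp_e]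
      split_ifs with hαβ
      · rw [hαβ, sub_self]
        exact zero_mem _
      · rw [sub_zero]
        exact Submodule.le_topologicalClosure _ (Submodule.subset_span (h.e_mem_freeNormalizers hαβ))

theorem isKumjianDiagonal (h : IsPathUnits e) : IsKumjianDiagonal h.diag where
  isClosed := h.isClosed_diag
  comm _ hb _ hc := h.diag_comm hb hc
  exists_strictlyPositive := h.exists_isStrictlyPositiveIn
  exists_expectation := ⟨h.cexp, h.isConditionalExpectation, fun _ => h.cexp_faithful,
    h.closure_span_freeNormalizers⟩

end Order

end IsPathUnits

end DirectedGraph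

/-! ### The Bratteli diagram of a tower of matrix units -/

theorem DirectedGraph.Leveled.sum_out {E : DirectedGraph} [Leveled E] {v : E.V} {A κ : Type*}
    [AddCommMonoid A] [Fintype κ] (f : κ → Out E v) (hf : f.Bijective) (F : Out E v → A)
    (G : κ → A) (h : ∀ x, F (f x) = G x) : ∑ g, F g = ∑ x, G x :=
  (Fintype.sum_bijective f hf _ _ fun x => (h x).symm).symm

namespace MatrixSystem

open DirectedGraph

variable {A : Type*} [NonUnitalCStarAlgebra A] {s : ℕ → MatrixSystem A}

namespace Refinement

variable {s s' : MatrixSystem A} (R : Refinement s s')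

/-- The indices of the `i`-th summand that are not reached from the previous level. -/
def unreached (i : Fin s'.p) : Finset (Fin (s'.size i)) :=
  (Finset.univ.image fun x : Σ j, Fin (R.mult i j) × Fin (s.size j) => R.emb i x.1 x.2.1 x.2.2)ᶜ

theorem mem_unreached {i : Fin s'.p} {c : Fin (s'.size i)} :
    c ∈ R.unreached i ↔ ∀ j t a, R.emb i j t a ≠ c := by
  simp [unreached]

theorem card_unreached (i : Fin s'.p) :
    ((R.unreached i).card : ℤ) = s'.size i - ∑ j, (R.mult i j : ℤ) * s.size j := by
  have h := Finset.card_compl_add_card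
    (Finset.univ.image fun x : Σ j, Fin (R.mult i j) × Fin (s.size j) =>
      R.emb i x.1 x.2.1 x.2.2)
  rw [Finset.card_image_of_injective _ (R.emb_injective i)] at h
  simp only [Finset.card_univ, Fintype.card_sigma, Fintype.card_prod, Fintype.card_fin] at h
  rw [eq_sub_iff_add_eq]
  exact_mod_cast h

theorem card_unreached_le_one (i : Fin s'.p) : (R.unreached i).card ≤ 1 :=
  Finset.card_le_one.2 fun _ hc _ hd =>
    R.compl_subsingleton i _ _ (R.mem_unreached.1 hc) (R.mem_unreached.1 hd)

end Refinement

variable (R : ∀ n, Refinement (s n) (s (n + 1)))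

/-- The Bratteli diagram of a tower of matrix units. -/
abbrev diagram : BratteliDiagram where
  p n := (s n).p
  size n := (s n).size
  size_pos n := (s n).size_pos
  mult n := (R n).mult

/-- The graph of the Bratteli diagram of a tower; it unfolds to `(diagram R).graph`. -/
abbrev graph : DirectedGraph where
  V := Σ n, Fin (s n).p
  Edge := Σ (n : ℕ) (i : Fin (s (n + 1)).p) (j : Fin (s n).p), Fin ((R n).mult i j)
  s e := ⟨e.1, e.2.2.1⟩
  r e := ⟨e.1 + 1, e.2.1⟩

/-- The distinguished vertices of the graph of a tower. -/
def points : Set (graph R).V := (diagram R).points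

theorem slack_succ (n : ℕ) (i : Fin (s (n + 1)).p) :
    (diagram R).slack ⟨n + 1, i⟩ = ((R n).unreached i).card :=
  ((R n).card_unreached i).symm

theorem slack_le_one (h0 : (s 0).p = 0) (w : (diagram R).Vertex) : (diagram R).slack w ≤ 1 := by
  obtain ⟨_ | n, i⟩ := w
  · exact (Fin.cast h0 i).elim0
  · refine (slack_succ R n i).trans_le ?_
    exact_mod_cast (R n).card_unreached_le_one i

theorem mem_points {n : ℕ} {i : Fin (s (n + 1)).p} :
    (⟨n + 1, i⟩ : (graph R).V) ∈ points R ↔ ∃ c, ∀ j t a, (R n).emb i j t a ≠ c := by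
  have h1 : (⟨n + 1, i⟩ : (graph R).V) ∈ points R ↔ (((R n).unreached i).card : ℤ) = 1 := by
    rw [← slack_succ]
    rfl
  have h2 := (R n).card_unreached_le_one i
  have h3 : 0 < ((R n).unreached i).card ↔ ∃ c, ∀ j t a, (R n).emb i j t a ≠ c := by
    simp only [Finset.card_pos, Finset.Nonempty, Refinement.mem_unreached]
  rw [h1, ← h3]
  omega

/-- The sum over the copies of a diagonal matrix unit in the next matrix algebra. -/
theorem hom_diagonal_eq {n : ℕ} (j : Fin (s n).p) (a : Fin ((s n).size j)) :
    (s (n + 1)).isMatrixUnits.hom (fun i => Matrix.diagonal fun c =>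
      if c ∈ Finset.univ.image (fun t => (R n).emb i j t a) then 1 else 0) = (s n).e j a a := by
  rw [(R n).sum_eq, IsMatrixUnits.hom_apply]
  refine Finset.sum_congr rfl fun i _ => ?_
  have hinj : Function.Injective fun t => (R n).emb i j t a := fun t t' h => by
    have := (R n).emb_injective i (a₁ := ⟨j, t, a⟩) (a₂ := ⟨j, t', a⟩) h
    simpa using this
  rw [← Finset.sum_image (f := fun c => (s (n + 1)).e i c c)
    (g := fun t => (R n).emb i j t a) hinj.injOn]
  generalize Finset.univ.image (fun t => (R n).emb i j t a) = T
  simp [Matrix.diagonal_apply, ite_smul, Finset.sum_ite_mem]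

theorem corresponds : (diagram R).Corresponds fun n => (s n).toSubalgebra := by
  let Ψ : ∀ n, (diagram R).LevelAlgebra n ≃⋆ₐ[ℂ] (s n).toSubalgebra := fun n =>
    StarAlgEquiv.ofInjective' (s n).isMatrixUnits.hom ((s n).isMatrixUnits.hom_injective (s n).ne_zero)
  have hΨ : ∀ n M, (Ψ n M : A) = (s n).isMatrixUnits.hom M := fun _ _ => rfl
  refine ⟨fun n => (Ψ n).symm, fun n i j a y hy => ?_⟩
  let N : (diagram R).LevelAlgebra (n + 1) := fun i => Matrix.diagonal fun c =>
    if c ∈ Finset.univ.image (fun t => (R n).emb i j t a) then 1 else 0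
  have hyN : y = Ψ (n + 1) N := by
    refine Subtype.ext (hy.trans ?_)
    rw [hΨ, StarAlgEquiv.symm_symm, hΨ]
    exact ((s n).isMatrixUnits.hom_single j a a).trans (hom_diagonal_eq R j a).symm
  have hinj : Function.Injective fun t => (R n).emb i j t a := fun t t' h => by
    have := (R n).emb_injective i (a₁ := ⟨j, t, a⟩) (a₂ := ⟨j, t', a⟩) h
    simpa using this
  rw [hyN, StarAlgEquiv.symm_apply_apply, Matrix.rank_diagonal,
    Fintype.card_of_subtype (Finset.univ.image fun t => (R n).emb i j t a) (by simp),
    Finset.card_image_of_injective _ hinj, Finset.card_univ, Fintype.card_fin]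

instance : Leveled (graph R) where
  lev v := v.1
  lev_r _ := rfl
  finite_lev n := (Set.finite_range (Sigma.mk n)).subset <| by
    rintro ⟨_, i⟩ rfl
    exact ⟨i, rfl⟩
  finite_out v := by
    obtain ⟨n, j⟩ := v
    refine (Set.finite_range fun x : Σ i, Fin ((R n).mult i j) =>
      (⟨n, x.1, j, x.2⟩ : (graph R).Edge)).subset ?_
    rintro ⟨m, i, k, t⟩ h
    cases h
    exact ⟨⟨i, t⟩, rfl⟩
  exists_out v := by
    obtain ⟨n, j⟩ := v
    by_contra! h
    refine (s n).ne_zero j ⟨0, (s n).size_pos j⟩ ?_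
    rw [(R n).sum_eq]
    exact Finset.sum_eq_zero fun i _ => Finset.sum_eq_zero fun t _ => (h ⟨n, i, j, t⟩ rfl).elim

open Classical in
/-- The path from a distinguished vertex that leads to a given index of a matrix algebra: the index
is traced back until it is not reached from the previous level. -/
def path (h0 : (s 0).p = 0) : ∀ (n : ℕ) (i : Fin (s n).p) (_ : Fin ((s n).size i)),
    PathsTo (points R) ⟨n, i⟩
  | 0, i, _ => (Fin.cast h0 i).elim0
  | n + 1, i, c =>
    if h : ∃ x : Σ j, Fin ((R n).mult i j) × Fin ((s n).size j),
        (R n).emb i x.1 x.2.1 x.2.2 = c then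
      (path h0 n h.choose.1 h.choose.2.2).snoc ⟨⟨n, i, h.choose.1, h.choose.2.1⟩, rfl⟩
    else PathsTo.nil ((mem_points R).2 ⟨c, fun j t a hc => h ⟨⟨j, t, a⟩, hc⟩⟩)

variable (h0 : (s 0).p = 0)

theorem path_emb {n : ℕ} (i : Fin (s (n + 1)).p) (j : Fin (s n).p) (t : Fin ((R n).mult i j))
    (a : Fin ((s n).size j)) :
    path R h0 (n + 1) i ((R n).emb i j t a) = (path R h0 n j a).snoc ⟨⟨n, i, j, t⟩, rfl⟩ := by
  have h : ∃ x : Σ j, Fin ((R n).mult i j) × Fin ((s n).size j),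
      (R n).emb i x.1 x.2.1 x.2.2 = (R n).emb i j t a := ⟨⟨j, t, a⟩, rfl⟩
  have h1 : h.choose = ⟨j, t, a⟩ := (R n).emb_injective i h.choose_spec
  have h2 : ∀ x : Σ j, Fin ((R n).mult i j) × Fin ((s n).size j), x = ⟨j, t, a⟩ →
      ((path R h0 n x.1 x.2.2).snoc ⟨⟨n, i, x.1, x.2.1⟩, rfl⟩ : PathsTo (points R) ⟨n + 1, i⟩) =
        (path R h0 n j a).snoc ⟨⟨n, i, j, t⟩, rfl⟩ := by
    rintro _ rfl
    rfl
  rw [path, dif_pos h]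
  exact h2 _ h1

theorem path_of_forall_ne {n : ℕ} {i : Fin (s (n + 1)).p} {c : Fin ((s (n + 1)).size i)}
    (hc : ∀ j t a, (R n).emb i j t a ≠ c) :
    path R h0 (n + 1) i c = PathsTo.nil ((mem_points R).2 ⟨c, hc⟩) := by
  rw [path, dif_neg]
  rintro ⟨x, hx⟩
  exact hc _ _ _ hx

theorem path_injective (n : ℕ) (i : Fin (s n).p) : Function.Injective (path R h0 n i) := by
  induction n with
  | zero => exact (Fin.cast h0 i).elim0
  | succ n ih =>
    intro c d hcd
    by_cases hc : ∀ j t a, (R n).emb i j t a ≠ c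
    · by_cases hd : ∀ j t a, (R n).emb i j t a ≠ d
      · exact (R n).compl_subsingleton i c d hc hd
      · push Not at hd
        obtain ⟨j, t, a, rfl⟩ := hd
        rw [path_of_forall_ne R h0 hc, path_emb] at hcd
        have := congrArg (fun x => x.1.edges.length) hcd
        simp [PathsTo.nil, PathsTo.snoc, FinPath.nil, FinPath.snoc] at this
    · push Not at hc
      obtain ⟨j, t, a, rfl⟩ := hc
      by_cases hd : ∀ j t a, (R n).emb i j t a ≠ d
      · rw [path_of_forall_ne R h0 hd, path_emb] at hcd
        have := congrArg (fun x => x.1.edges.length) hcd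
        simp [PathsTo.nil, PathsTo.snoc, FinPath.nil, FinPath.snoc] at this
      · push Not at hd
        obtain ⟨j', t', a', rfl⟩ := hd
        rw [path_emb, path_emb] at hcd
        have h1 := congrArg (fun x => x.1.edges) hcd
        have h2 := congrArg (fun x => x.1.source) hcd
        simp only [PathsTo.snoc, FinPath.snoc] at h1 h2
        obtain ⟨h3, h4⟩ := List.append_inj' h1 rfl
        have h5 := List.singleton_injective h4
        cases h5
        rw [ih j (Subtype.ext (FinPath.ext h2 h3))]

theorem path_surjective (v : (graph R).V) : Function.Surjective (path R h0 v.1 v.2) := by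
  intro (α : PathsTo (points R) v)
  induction α using PathsTo.snoc_induction with
  | nil v hv =>
    obtain ⟨_ | n, i⟩ := v
    · exact (Fin.cast h0 i).elim0
    · obtain ⟨c, hc⟩ := (mem_points R).1 hv
      exact ⟨c, path_of_forall_ne R h0 hc⟩
  | snoc v α g ih =>
    obtain ⟨⟨n, i, j, t⟩, rfl⟩ := g
    obtain ⟨a, rfl⟩ := ih
    exact ⟨(R n).emb i j t a, path_emb R h0 i j t a⟩

/-- The indices of a matrix algebra correspond to the paths leading to its vertex. -/
def pathEquiv (v : (graph R).V) : Fin ((s v.1).size v.2) ≃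
    PathsTo (points R) v :=
  Equiv.ofBijective (path R h0 v.1 v.2) ⟨path_injective R h0 v.1 v.2, path_surjective R h0 v⟩

/-- The matrix units of a tower, indexed by paths. -/
def pathUnits (v : (graph R).V)
    (α β : PathsTo (points R) v) : A :=
  (s v.1).e v.2 ((pathEquiv R h0 v).symm α) ((pathEquiv R h0 v).symm β)

theorem pathUnits_path {n : ℕ} (i : Fin (s n).p) (a b : Fin ((s n).size i)) :
    pathUnits R h0 ⟨n, i⟩ (path R h0 n i a) (path R h0 n i b) = (s n).e i a b := by
  have h : ∀ a, (pathEquiv R h0 ⟨n, i⟩).symm (path R h0 n i a) = a := fun a =>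
    (pathEquiv R h0 ⟨n, i⟩).symm_apply_apply a
  rw [pathUnits, h, h]

theorem isPathUnits (hs : IsAFTower fun n => (s n).toSubalgebra) :
    IsPathUnits (pathUnits R h0) where
  star_eq v α β := (s v.1).isMatrixUnits.star_eq _ _ _
  mul_same v α β γ δ := by
    rw [pathUnits, pathUnits, (s v.1).isMatrixUnits.mul_same]
    simp only [EmbeddingLike.apply_eq_iff_eq]
    rfl
  mul_ne v w α β γ δ hvw hne := by
    obtain ⟨n, i⟩ := v
    obtain ⟨m, j⟩ := w
    obtain rfl : n = m := hvw
    exact (s n).isMatrixUnits.mul_ne _ _ _ _ _ _ fun hij => hne (congrArg (Sigma.mk n) hij)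
  split v α β := by
    obtain ⟨n, j⟩ := v
    obtain ⟨a, rfl⟩ := path_surjective R h0 ⟨n, j⟩ α
    obtain ⟨b, rfl⟩ := path_surjective R h0 ⟨n, j⟩ β
    rw [pathUnits_path, (R n).sum_eq, ← Fintype.sum_sigma' fun i t =>
      (s (n + 1)).e i ((R n).emb i j t a) ((R n).emb i j t b)]
    refine (Leveled.sum_out (E := graph R) (v := ⟨n, j⟩) (fun x : Σ i, Fin ((R n).mult i j) =>
      ⟨⟨n, x.1, j, x.2⟩, rfl⟩) ⟨?_, ?_⟩ _ _ fun x => ?_).symm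
    · rintro ⟨i, t⟩ ⟨i', t'⟩ h
      cases h
      rfl
    · rintro ⟨⟨m, i, k, t⟩, h⟩
      cases h
      exact ⟨⟨i, t⟩, rfl⟩
    · rw [← pathUnits_path R h0, path_emb, path_emb]
  ne_zero v α := (s v.1).ne_zero _ _
  dense := by
    refine hs.dense.mono (Set.iUnion_subset fun n => ?_)
    rintro _ ⟨M, rfl⟩
    change (s n).isMatrixUnits.hom M ∈ Submodule.span ℂ _
    rw [IsMatrixUnits.hom_apply]
    refine sum_mem fun i _ => sum_mem fun a _ => sum_mem fun b _ =>
      Submodule.smul_mem _ _ (Submodule.subset_span ?_)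
    exact ⟨⟨n, i⟩, _, _, (pathUnits_path R h0 i a b).symm⟩

end MatrixSystem

end

theorem corollary4p4 {A : Type u} [NonUnitalCStarAlgebra A] [PartialOrder A] [StarOrderedRing A]
    (hA : IsAFAlgebra A) :
    ∃ (D : ℕ → NonUnitalStarSubalgebra ℂ A) (E : BratteliDiagram),
      IsAFTower D ∧ E.Corresponds D ∧ (∀ w : E.Vertex, E.slack w ≤ 1) ∧
      ∃ ι : C_c(E.graph.PointedPathGroupoid E.points, ℂ) →ₗ[ℂ] A,
        DirectedGraph.PointedPathGroupoid.IsGroupoidCStarAlgebra.{u, v} ι ∧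
        ∃ B : NonUnitalStarSubalgebra ℂ A,
          IsKumjianDiagonal B ∧
          ∃ ψ : C₀(DirectedGraph.PointedPathGroupoid.UnitSpace E.graph E.points, ℂ) ≃⋆ₐ[ℂ] B,
            ∀ (g : C₀(DirectedGraph.PointedPathGroupoid.UnitSpace E.graph E.points, ℂ))
              (f : C_c(E.graph.PointedPathGroupoid E.points, ℂ)),
              (∀ γ : E.graph.PointedPathGroupoid E.points, ¬ γ.1.IsUnitArrow → f γ = 0) →
              (∀ γ : DirectedGraph.PointedPathGroupoid.UnitSpace E.graph E.points,
                f γ.1 = g γ) →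
              (ψ g : A) = ι f := by
  obtain ⟨s, h0, ⟨R⟩, hs⟩ := MatrixSystem.exists_tower hA
  have h := MatrixSystem.isPathUnits R h0 hs
  exact ⟨fun n => (s n).toSubalgebra, MatrixSystem.diagram R, hs, MatrixSystem.corresponds R,
    MatrixSystem.slack_le_one R h0, h.rep, h.isGroupoidCStarAlgebra, h.diag, h.isKumjianDiagonal,
    StarAlgEquiv.ofInjective' h.diagHom h.diagHom_injective, h.diagHom_eq_rep⟩
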